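/- **Setting.** Let $S,A_1,A_2,H\ge 1$ be integers, $\mathcal S=\{1,\dots,S\}$, $\mathcal A_i=\{1,\dots,A_i\}$, $\mathcal A=\mathcal A_1\times\mathcal A_2$, and write $\Delta(X)$ for the set of probability distributions on a finite set $X$. A two-player zero-sum robust Markov game has rewards $r_{1,h}:\mathcal S\times\mathcal A\to[0,1]$ and $r_{2,h}=-r_{1,h}$, a nominal kernel $P^0_h:\mathcal S\times\mathcal A\to\Delta(\mathcal S)$ ($1\le h\le H$), and an uncertainty level $R$; its uncertainty set $\mathcal U^R$ is the set of all kernels $P=(P_h)_h$ such that for all $(h,s,\boldsymbol a)$ there is $P'\in\Delta(\mathcal S)$ with $P_h(\cdot|s,\boldsymbol a)=(1-R)P^0_h(\cdot|s,\boldsymbol a)+RP'$. For a joint Markov policy $\pi$ put $$V^{\pi,R}_{i,h}(s)=\inf_{P\in\mathcal U^R}\mathbb E_{\pi,P}\Big[\sum_{t=h}^H r_{i,t}(s_t,\boldsymbol a_t)\,\Big|\,s_h=s\Big],\qquad V^{\star,\pi_{-i},R}_{i,h}(s)=\max_{\pi_i'}V^{\pi_i'\times\pi_{-i},R}_{i,h}(s),$$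 the maximum being over Markov policies of player $i$. A product policy $\pi=\pi_1\times\pi_2$ is an $\varepsilon$-robust Nash equilibrium if $$\mathsf{gap}_{\mathsf{NE}}(\pi)=\max_{s\in\mathcal S}\max_{i=1,2}\big\{V^{\star,\pi_{-i},R}_{i,1}(s)-V^{\pi,R}_{i,1}(s)\big\}\le\varepsilon .$$ **Algorithm.** Let $L=\min\{H,1/R\}$ (with $1/0=\infty$). Given $K\ge1$, $\delta$ and constants $c_\alpha,c_{\mathsf b}>0$, let $$\alpha_k=\frac{c_\alpha\log K}{k-1+c_\alpha\log K},\qquad \eta_k=\sqrt{\frac{\log K}{\alpha_kL}},\qquad \alpha_k^K=\alpha_k\prod_{j=k+1}^K(1-\alpha_j).$$ Start from $\widehat V_{i,H+1}=0$. For $h=H,\dots,1$ set $Q^0_{i,h}=0$ and $\pi^1_{i,h}(\cdot|s)$ uniform, and for $k=1,\dots,K$ do the following for each player $i$. Independently for all $(s,a_i)\in\mathcal S\times\mathcal A_i$ (and for both players), draw $a_j\sim\pi^k_{j,h}(\cdot|s)$ for $j\ne i$, let $\boldsymbol a$ be the resulting joint action in which player $i$ plays $a_i$, draw $s'\sim P^0_h(\cdot|s,\boldsymbol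 a)$, and set $$q^k_{i,h}(s,a_i)=r_{i,h}(s,\boldsymbol a)+(1-R)\widehat V_{i,h+1}(s')+R\min_{\tilde s}\widehat V_{i,h+1}(\tilde s),$$ $$Q^k_{i,h}=(1-\alpha_k)Q^{k-1}_{i,h}+\alpha_kq^k_{i,h},\qquad \pi^{k+1}_{i,h}(\cdot|s)\propto\exp\big(\eta_{k+1}Q^k_{i,h}(s,\cdot)\big).$$ After the $K$ rounds at step $h$, let $$\beta_{i,h}(s)=c_{\mathsf b}\sqrt{\frac{\log^3\frac{KS(A_1+A_2)}{\delta}}{KL}}\sum_{k=1}^K\alpha_k^K\Big\{\mathsf{Var}_{a\sim\pi^k_{i,h}(\cdot|s)}\big(q^k_{i,h}(s,a)\big)+L\Big\},$$ $$\widehat V_{i,h}(s)=\min\Big\{\sum_{k=1}^K\alpha_k^K\,\mathbb E_{a\sim\pi^k_{i,h}(\cdot|s)}\big[q^k_{i,h}(s,a)\big]+\beta_{i,h}(s),\;H-h+1\Big\}.$$ The output is $\widehat\pi_1\times\widehat\pi_2$ with $\widehat\pi_{i,h}=\sum_{k=1}^K\alpha_k^K\pi^k_{i,h}$; the total number of samples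 drawn is $KHS(A_1+A_2)$. **Corollary.** For every constant $c_\alpha>0$, every sufficiently large constant $c_{\mathsf b}$ (how large depends only on $c_\alpha$), there is a constant $C>0$ depending only on $c_\alpha$ and $c_{\mathsf b}$ such that the following holds. For every two-player zero-sum robust Markov game as above with $0\le R<1$, every $\varepsilon\in(0,H]$, every $\delta\in(0,1)$ and every integer $K\ge1$ with $$KHS(A_1+A_2)\ge\frac{CH^3S(A_1+A_2)}{\varepsilon^2}\min\Big\{H,\frac1R\Big\}\log^3\Big(\frac{KS(A_1+A_2)}{\delta}\Big),$$ with probability at least $1-\delta$ the product policy $\widehat\pi_1\times\widehat\pi_2$ returned by the algorithm is an $\varepsilon$-robust Nash equilibrium, that is, $\mathsf{gap}_{\mathsf{NE}}(\widehat\pi_1\times\widehat\pi_2)\le\varepsilon$. -/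

import Mathlib

noncomputable section

namespace RobustMG

/-! ### Finite probability -/

/-- A point of the probability simplex, as a law one can sample from. -/
def simplexPMF {X : Type} [Fintype X] (p : stdSimplex ℝ X) : PMF X :=
  PMF.ofFintype (fun x => ENNReal.ofReal (p x)) (by
    have h0 : ∀ x, 0 ≤ p x := p.2.1
    have h1 : ∑ x, p x = 1 := p.2.2
    rw [← ENNReal.ofReal_sum_of_nonneg (fun x _ => h0 x), h1, ENNReal.ofReal_one])

/-- The law of a finite family of independent random elements with laws `p i`. -/
def indepPMF {ι : Type} [Fintype ι] [DecidableEq ι] {X : ι → Type} [∀ i, Fintype (X i)]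
    (p : ∀ i, PMF (X i)) : PMF (∀ i, X i) :=
  PMF.ofFintype (fun x => ∏ i, p i (x i)) (by
    rw [← Fintype.prod_sum]
    refine Finset.prod_eq_one fun i _ => ?_
    rw [← tsum_fintype (L := .unconditional _)]
    exact (p i).tsum_coe)

/-- The softmax (exponential weights) distribution `x ↦ exp (f x) / ∑ y, exp (f y)`. -/
def softmax {X : Type} [Fintype X] [Nonempty X] (f : X → ℝ) : stdSimplex ℝ X :=
  ⟨fun x => Real.exp (f x) / ∑ y, Real.exp (f y),
    fun x => div_nonneg (Real.exp_pos _).le (Finset.sum_nonneg fun y _ => (Real.exp_pos _).le),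
    by
      rw [← Finset.sum_div]
      exact div_self (Finset.sum_pos (fun y _ => Real.exp_pos _) Finset.univ_nonempty).ne'⟩

/-- The mean of `f` under the weights `p`. -/
def mean {X : Type} [Fintype X] (p : stdSimplex ℝ X) (f : X → ℝ) : ℝ := ∑ x, p x * f x

/-- The variance of `f` under the weights `p`. -/
def var {X : Type} [Fintype X] (p : stdSimplex ℝ X) (f : X → ℝ) : ℝ :=
  mean p fun x => (f x - mean p f) ^ 2

/-! ### Robust Markov games -/

/-- Joint actions of `m` players, player `i` having the actions `Fin (A i)`. -/
abbrev Joint {m : ℕ} (A : Fin m → ℕ) : Type := (i : Fin m) → Fin (A i)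

/-- Non-stationary transition kernels. The steps are `1, …, H`; the other indices are never used. -/
abbrev TransKernel {m : ℕ} (S : ℕ) (A : Fin m → ℕ) : Type :=
  ℕ → Fin S → Joint A → stdSimplex ℝ (Fin S)

/-- A profile `(π_1, …, π_m)` of Markov policies, `π i h s a` being the weight that player `i` puts
on its action `a` in state `s` at step `h`. -/
abbrev Profile {m : ℕ} (S : ℕ) (A : Fin m → ℕ) : Type :=
  (i : Fin m) → ℕ → Fin S → Fin (A i) → ℝ

/-- A finite-horizon `m`-player Markov game with states `Fin S` and an `R`-contamination
uncertainty set around the nominal kernel `P0`. -/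
structure Game (m S : ℕ) (A : Fin m → ℕ) where
  /-- the horizon -/
  H : ℕ
  /-- the uncertainty level -/
  R : ℝ
  /-- the nominal transition kernel -/
  P0 : TransKernel S A
  /-- `r i h s a` is the reward of player `i` at step `h` -/
  r : Fin m → ℕ → Fin S → Joint A → ℝ

/-- Two-player zero-sum: the first player's rewards lie in `[0, 1]`, the second one's are their
negatives. -/
def Game.IsZeroSum {S : ℕ} {A : Fin 2 → ℕ} (G : Game 2 S A) : Prop :=
  ∀ h ∈ Finset.Icc 1 G.H, ∀ s a, G.r 0 h s a ∈ Set.Icc (0 : ℝ) 1 ∧ G.r 1 h s a = -G.r 0 h s a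

/-- `min {H, 1/R}`, with `1/0 = ∞`. -/
def Game.effHorizon {m S : ℕ} {A : Fin m → ℕ} (G : Game m S A) : ℝ :=
  if G.R = 0 then (G.H : ℝ) else min (G.H : ℝ) (1 / G.R)

/-- The uncertainty set: the product over `(h, s, a)` of the sets
`{(1 - R) P0_{h,s,a} + R P' | P' ∈ Δ(S)}`. -/
def Game.uncertaintySet {m S : ℕ} {A : Fin m → ℕ} (G : Game m S A) : Set (TransKernel S A) :=
  {P | ∀ h s a, ∃ P' : stdSimplex ℝ (Fin S),
    ∀ s', P h s a s' = (1 - G.R) * G.P0 h s a s' + G.R * P' s'}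

/-- Expectation, over the trajectory `s_h = s`, `a_t ∼ π_t(· | s_t)`, `s_{t+1} ∼ P_t(· | s_t, a_t)`,
of `g + ∑_{t = h}^{H} r_{i,t}(s_t, a_t)`, where `n` is the number `H - h + 1` of steps still to be
played (so that the first of `n + 1` remaining steps is step `H - n`) and `g` is the reward
accumulated before. -/
def Game.expReturn {m S : ℕ} {A : Fin m → ℕ} (G : Game m S A) (π : ℕ → Fin S → Joint A → ℝ)
    (P : TransKernel S A) (i : Fin m) : ℕ → Fin S → ℝ → ℝ
  | 0, _, g => g
  | n + 1, s, g => ∑ a, π (G.H - n) s a *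
      ∑ s', P (G.H - n) s a s' * G.expReturn π P i n s' (g + G.r i (G.H - n) s a)

/-- The value function `V_{i,h}^{π,P}(s)` of a joint Markov policy `π` under the kernel `P`. -/
def Game.value {m S : ℕ} {A : Fin m → ℕ} (G : Game m S A) (π : ℕ → Fin S → Joint A → ℝ)
    (P : TransKernel S A) (i : Fin m) (h : ℕ) (s : Fin S) : ℝ :=
  G.expReturn π P i (G.H + 1 - h) s 0

/-- The robust value function `V_{i,h}^{π,R}(s)`. -/
def Game.robustValue {m S : ℕ} {A : Fin m → ℕ} (G : Game m S A) (π : ℕ → Fin S → Joint A → ℝ)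
    (i : Fin m) (h : ℕ) (s : Fin S) : ℝ :=
  ⨅ P : G.uncertaintySet, G.value π P.1 i h s

/-- The product policy `π_1 × ⋯ × π_m`. -/
def prodPolicy {m S : ℕ} {A : Fin m → ℕ} (π : Profile S A) : ℕ → Fin S → Joint A → ℝ :=
  fun h s a => ∏ i, π i h s (a i)

/-- `V_{i,h}^{⋆,π_{-i},R}(s)`: the optimal robust value of player `i` over its Markov policies, the
other players following `π`. -/
def Game.bestResponseValue {m S : ℕ} {A : Fin m → ℕ} (G : Game m S A) (π : Profile S A)
    (i : Fin m) (h : ℕ) (s : Fin S) : ℝ :=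
  ⨆ π' : ℕ → Fin S → stdSimplex ℝ (Fin (A i)),
    G.robustValue (prodPolicy (Function.update π i fun t x a => π' t x a)) i h s

/-- `gap_NE(π)`. -/
def Game.gapNE {m S : ℕ} {A : Fin m → ℕ} (G : Game m S A) (π : Profile S A) : ℝ :=
  ⨆ s : Fin S, ⨆ i : Fin m, (G.bestResponseValue π i 1 s - G.robustValue (prodPolicy π) i 1 s)

/-- `π_1 × ⋯ × π_m` is an `ε`-robust Nash equilibrium. -/
def Game.IsRobustNE {m S : ℕ} {A : Fin m → ℕ} (G : Game m S A) (ε : ℝ) (π : Profile S A) : Prop :=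
  (∀ i, ∀ h ∈ Finset.Icc 1 G.H, ∀ s, π i h s ∈ stdSimplex ℝ (Fin (A i))) ∧ G.gapNE π ≤ ε

/-! ### The robust Q-FTRL algorithm -/

/-- The step size `α_k = c_α log K / (k - 1 + c_α log K)`. -/
def stepAlpha (cα : ℝ) (K k : ℕ) : ℝ :=
  cα * Real.log K / ((k : ℝ) - 1 + cα * Real.log K)

/-- The weight `α_k^K = α_k ∏_{j = k+1}^{K} (1 - α_j)`. -/
def weightAlpha (cα : ℝ) (K k : ℕ) : ℝ :=
  stepAlpha cα K k * ∏ j ∈ Finset.Icc (k + 1) K, (1 - stepAlpha cα K j)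

/-- The step size `η_k = √(log K / (α_k min {H, 1/R}))`. -/
def Game.stepEta {m S : ℕ} {A : Fin m → ℕ} (G : Game m S A) (cα : ℝ) (K k : ℕ) : ℝ :=
  Real.sqrt (Real.log K / (stepAlpha cα K k * G.effHorizon))

/-- The data drawn in one round at one step: for every player `i`, state `s` and action `a_i`, a
joint action and a next state. -/
abbrev Sample {m : ℕ} (S : ℕ) (A : Fin m → ℕ) : Type :=
  (i : Fin m) → Fin S → Fin (A i) → Joint A × Fin S

/-- The law of the data of one round at step `h` when the current policies are `p`. The draws for
different `(i, s, a_i)` are independent; in the draw for `(i, s, a_i)` player `i` plays `a_i`, the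
other players play independently according to `p`, and then the next state is drawn from the
nominal kernel. -/
def Game.sampleLaw {m S : ℕ} {A : Fin m → ℕ} (G : Game m S A) (h : ℕ)
    (p : (i : Fin m) → Fin S → stdSimplex ℝ (Fin (A i))) : PMF (Sample S A) :=
  indepPMF fun i => indepPMF fun s => indepPMF fun ai =>
    (indepPMF (Function.update (fun j => simplexPMF (p j s)) i (PMF.pure ai))).bind fun a =>
      (simplexPMF (G.P0 h s a)).map fun s' => (a, s')

/-- `q_{i,h}^k = r_{i,h}^k + (1 - R) P_{i,h}^k V_{i,h+1} + R min V_{i,h+1}` for the data `x` of round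
`k`, where `V = V_{·,h+1}`; the row `P_{i,h}^k(· | s, a_i)` is the point mass at the drawn next
state. -/
def Game.qHat {m S : ℕ} {A : Fin m → ℕ} (G : Game m S A) (h : ℕ) (V : Fin m → Fin S → ℝ)
    (x : Sample S A) (i : Fin m) (s : Fin S) (ai : Fin (A i)) : ℝ :=
  G.r i h s (x i s ai).1 + (1 - G.R) * V i (x i s ai).2 + G.R * ⨅ s', V i s'

/-- The Q-estimate `Q_{i,h}^k`, from the data `x 1, …, x k` of the first `k` rounds. -/
def Game.QHat {m S : ℕ} {A : Fin m → ℕ} (G : Game m S A) (cα : ℝ) (K h : ℕ)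
    (V : Fin m → Fin S → ℝ) (x : ℕ → Sample S A) (i : Fin m) (s : Fin S) : ℕ → Fin (A i) → ℝ
  | 0, _ => 0
  | k + 1, ai => (1 - stepAlpha cα K (k + 1)) * G.QHat cα K h V x i s k ai
      + stepAlpha cα K (k + 1) * G.qHat h V (x (k + 1)) i s ai

/-- The policy `π_{i,h}^k(· | s) ∝ exp (η_k Q_{i,h}^{k-1}(s, ·))`, for `k ≥ 1`; it is uniform for
`k = 1` since `Q_{i,h}^0 = 0`. -/
def Game.iterPolicy {m S : ℕ} {A : Fin m → ℕ} [∀ i, NeZero (A i)] (G : Game m S A) (cα : ℝ)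
    (K h : ℕ) (V : Fin m → Fin S → ℝ) (x : ℕ → Sample S A) (k : ℕ) (i : Fin m) (s : Fin S) :
    stdSimplex ℝ (Fin (A i)) :=
  softmax fun ai => G.stepEta cα K k * G.QHat cα K h V x i s (k - 1) ai

/-- The law of the data `x 1, …, x k` of the first `k` rounds at step `h` (the entries of other
indices are not used and keep a default value): in round `k + 1` one samples with the policies
`π_{·,h}^{k+1}` obtained from the data of the rounds before. -/
def Game.roundsLaw {m S : ℕ} {A : Fin m → ℕ} [NeZero S] [∀ i, NeZero (A i)] (G : Game m S A)
    (cα : ℝ) (K h : ℕ) (V : Fin m → Fin S → ℝ) : ℕ → PMF (ℕ → Sample S A)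
  | 0 => PMF.pure fun _ _ _ _ => (fun _ => 0, 0)
  | k + 1 => (G.roundsLaw cα K h V k).bind fun x =>
      (G.sampleLaw h (G.iterPolicy cα K h V x (k + 1))).map fun y => Function.update x (k + 1) y

/-- The averaged policy `∑_k α_k^K π_{i,h}^k(· | s)`. -/
def Game.avgPolicy {m S : ℕ} {A : Fin m → ℕ} [∀ i, NeZero (A i)] (G : Game m S A) (cα : ℝ)
    (K h : ℕ) (V : Fin m → Fin S → ℝ) (x : ℕ → Sample S A) (i : Fin m) (s : Fin S) :
    Fin (A i) → ℝ :=
  fun ai => ∑ k ∈ Finset.Icc 1 K, weightAlpha cα K k * G.iterPolicy cα K h V x k i s ai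

/-- The bonus `β_{i,h}(s)`. -/
def Game.bonus {m S : ℕ} {A : Fin m → ℕ} [∀ i, NeZero (A i)] (G : Game m S A) (cα cb δ : ℝ)
    (K h : ℕ) (V : Fin m → Fin S → ℝ) (x : ℕ → Sample S A) (i : Fin m) (s : Fin S) : ℝ :=
  cb * Real.sqrt (Real.log (K * S * (∑ j, (A j : ℝ)) / δ) ^ 3 / (K * G.effHorizon)) *
    ∑ k ∈ Finset.Icc 1 K, weightAlpha cα K k *
      (var (G.iterPolicy cα K h V x k i s) (G.qHat h V (x k) i s) + G.effHorizon)

/-- The value estimate `V̂_{i,h}(s)` obtained at step `h` from `V = V̂_{·,h+1}` and the data `x`. -/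
def Game.valueHat {m S : ℕ} {A : Fin m → ℕ} [∀ i, NeZero (A i)] (G : Game m S A) (cα cb δ : ℝ)
    (K h : ℕ) (V : Fin m → Fin S → ℝ) (x : ℕ → Sample S A) (i : Fin m) (s : Fin S) : ℝ :=
  min ((∑ k ∈ Finset.Icc 1 K, weightAlpha cα K k *
        mean (G.iterPolicy cα K h V x k i s) (G.qHat h V (x k) i s))
      + G.bonus cα cb δ K h V x i s)
    ((G.H : ℝ) - h + 1)

/-- The joint law of the value estimates `V̂_{·,h}` and of the averaged policies at the steps
`h, …, H`, after the `n = H - h + 1` steps `H, …, h` have been processed. -/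
def Game.run {m S : ℕ} {A : Fin m → ℕ} [NeZero S] [∀ i, NeZero (A i)] (G : Game m S A)
    (cα cb δ : ℝ) (K : ℕ) : ℕ → PMF ((Fin m → Fin S → ℝ) × Profile S A)
  | 0 => PMF.pure (0, 0)
  | n + 1 => (G.run cα cb δ K n).bind fun o =>
      (G.roundsLaw cα K (G.H - n) o.1 K).map fun x =>
        (G.valueHat cα cb δ K (G.H - n) o.1 x,
          fun i => Function.update (o.2 i) (G.H - n) (G.avgPolicy cα K (G.H - n) o.1 x i))

/-- The law of the profile `(π̂_1, …, π̂_m)` that the algorithm returns with `K` rounds per step. -/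
def Game.output {m S : ℕ} {A : Fin m → ℕ} [NeZero S] [∀ i, NeZero (A i)] (G : Game m S A)
    (cα cb δ : ℝ) (K : ℕ) : PMF (Profile S A) :=
  (G.run cα cb δ K G.H).map Prod.snd

end RobustMG

end

/-!
Over a contamination set an infimum of expectations is `(1 - R)` times the nominal expectation plus
`R` times a minimum over the states, so that, up to the accumulated minima, robust values are values
of a game discounted by `1 - R`. Since the rewards add up to zero, the gap of a product policy is
controlled by the sum over the two players of the optimal discounted values against the opponent,
and it suffices to bracket these by the estimates `V̂`. The exponential weights regret bound, with
the variance bonus, shows that `V̂` corrected by a quadratic potential `c (V̂ - min V̂)²` does so: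
the variance at one step is nearly the mean of the squared excess of the next estimate over its
minimum minus the squared excess of the present one, so the potential makes the variances telescope
and leaves an error of order `√(log³ / (K L)) L` per step instead of one `L` times as large.

The deviations at one step are controlled by exponential supermartingales. A union bound over the
steps would cost a factor `H` that the logarithm does not contain. Instead one bounds the expected
number of steps at which the deviations are large: such a step costs only `O(L)`, and Markov's
inequality bounds their total cost with probability `1 - δ`.
-/

noncomputable section

namespace RobustMG

open Finset
open scoped ENNReal

/-! ### Expectations under probability mass functions -/

/-- The expectation of an extended nonnegative function: `PMF`s carry no `σ`-algebra, so this is a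
sum rather than a Lebesgue integral. -/
def pexp {α : Type*} (p : PMF α) (f : α → ℝ≥0∞) : ℝ≥0∞ := ∑' a, p a * f a

/-- The expectation of a real function on a finite type, where no integrability is at stake. -/
def rexp {α : Type*} [Fintype α] (p : PMF α) (f : α → ℝ) : ℝ := ∑ a, (p a).toReal * f a

section pexp
variable {α β : Type*}

lemma pexp_mono (p : PMF α) {f g : α → ℝ≥0∞} (h : ∀ a, f a ≤ g a) : pexp p f ≤ pexp p g :=
  ENNReal.tsum_le_tsum fun a => mul_le_mul_right (h a) _

lemma pexp_const (p : PMF α) (c : ℝ≥0∞) : pexp p (fun _ => c) = c := by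
  rw [pexp, ENNReal.tsum_mul_right, p.tsum_coe, one_mul]

lemma pexp_add (p : PMF α) (f g : α → ℝ≥0∞) :
    pexp p (fun a => f a + g a) = pexp p f + pexp p g := by
  simp only [pexp, mul_add, ENNReal.tsum_add]

lemma pexp_sum {ι : Type*} (t : Finset ι) (p : PMF α) (f : ι → α → ℝ≥0∞) :
    pexp p (fun a => ∑ i ∈ t, f i a) = ∑ i ∈ t, pexp p (f i) := by
  classical
  induction t using Finset.induction_on with
  | empty => simp [pexp]
  | insert i t hi ih => simp only [sum_insert hi, pexp_add, ih]

lemma pexp_mul_left (p : PMF α) (c : ℝ≥0∞) (f : α → ℝ≥0∞) :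
    pexp p (fun a => c * f a) = c * pexp p f := by
  simp only [pexp, ← ENNReal.tsum_mul_left]
  exact tsum_congr fun a => by ring

lemma pexp_pure (a : α) (f : α → ℝ≥0∞) : pexp (PMF.pure a) f = f a := by
  rw [pexp, tsum_eq_single a]
  · simp
  · intro b hb
    simp [hb]

lemma pexp_bind (p : PMF α) (k : α → PMF β) (f : β → ℝ≥0∞) :
    pexp (p.bind k) f = pexp p fun a => pexp (k a) f := by
  simp only [pexp, PMF.bind_apply, ← ENNReal.tsum_mul_right, ← ENNReal.tsum_mul_left]
  rw [ENNReal.tsum_comm]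
  exact tsum_congr fun a => tsum_congr fun b => by ring

lemma pexp_map (p : PMF α) (k : α → β) (f : β → ℝ≥0∞) :
    pexp (p.map k) f = pexp p fun a => f (k a) := by
  rw [← PMF.bind_pure_comp, pexp_bind]
  simp only [Function.comp, pexp_pure]

lemma toOuterMeasure_eq_pexp (p : PMF α) (s : Set α) :
    p.toOuterMeasure s = pexp p (s.indicator 1) := by
  rw [PMF.toOuterMeasure_apply]
  refine tsum_congr fun a => ?_
  by_cases h : a ∈ s <;> simp [h]

lemma one_sub_le_toOuterMeasure_of_pexp_le (p : PMF α) (s : Set α) (f : α → ℝ≥0∞) {ε : ℝ≥0∞}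
    (hf : pexp p f ≤ ε) (h : ∀ a, a ∉ s → 1 ≤ f a) : 1 - ε ≤ p.toOuterMeasure s := by
  rw [toOuterMeasure_eq_pexp, tsub_le_iff_right]
  calc (1 : ℝ≥0∞) = pexp p fun _ => 1 := (pexp_const p 1).symm
    _ ≤ pexp p fun a => s.indicator 1 a + f a := by
        refine pexp_mono p fun a => ?_
        by_cases ha : a ∈ s
        · simp [ha]
        · simpa [ha] using h a ha
    _ ≤ _ := by rw [pexp_add]; gcongr

lemma pexp_indicator_or_le (p : PMF α) (P Q : α → Prop) :
    pexp p ({a | P a ∨ Q a}.indicator 1)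
      ≤ pexp p ({a | P a}.indicator 1) + pexp p ({a | Q a}.indicator 1) := by
  rw [← pexp_add]
  refine pexp_mono p fun a => ?_
  by_cases hP : P a <;> by_cases hQ : Q a <;> simp [hP, hQ]

lemma pexp_indicator_exists_le {ι : Type*} [Fintype ι] (p : PMF α) (P : ι → α → Prop) :
    pexp p ({a | ∃ i, P i a}.indicator 1) ≤ ∑ i, pexp p ({a | P i a}.indicator 1) := by
  rw [← pexp_sum]
  refine pexp_mono p fun a => ?_
  by_cases h : ∃ i, P i a
  · obtain ⟨i, hi⟩ := h
    calc _ ≤ (1 : ℝ≥0∞) := Set.indicator_le_self' (by simp) a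
      _ = {a | P i a}.indicator 1 a := by simp [hi]
      _ ≤ _ := single_le_sum (f := fun i => {a | P i a}.indicator (1 : α → ℝ≥0∞) a)
        (fun _ _ => zero_le) (mem_univ i)
  · simp [h]

lemma pexp_ofReal [Fintype α] (p : PMF α) (f : α → ℝ) (hf : ∀ a, 0 ≤ f a) :
    pexp p (fun a => ENNReal.ofReal (f a)) = ENNReal.ofReal (rexp p f) := by
  rw [pexp, tsum_fintype, rexp, ENNReal.ofReal_sum_of_nonneg
    (fun a _ => mul_nonneg ENNReal.toReal_nonneg (hf a))]
  refine sum_congr rfl fun a _ => ?_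
  rw [ENNReal.ofReal_mul ENNReal.toReal_nonneg, ENNReal.ofReal_toReal (p.apply_ne_top a)]

end pexp

section rexp
variable {α β : Type*} [Fintype α] [Fintype β]

lemma sum_toReal_apply (p : PMF α) : ∑ a, (p a).toReal = 1 := by
  rw [← ENNReal.toReal_sum fun a _ => p.apply_ne_top a, ← tsum_fintype (L := .unconditional _),
    p.tsum_coe, ENNReal.toReal_one]

lemma rexp_mono (p : PMF α) {f g : α → ℝ} (h : ∀ a, f a ≤ g a) : rexp p f ≤ rexp p g :=
  sum_le_sum fun a _ => mul_le_mul_of_nonneg_left (h a) ENNReal.toReal_nonneg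

lemma rexp_const (p : PMF α) (c : ℝ) : rexp p (fun _ => c) = c := by
  rw [rexp, ← sum_mul, sum_toReal_apply, one_mul]

lemma rexp_add (p : PMF α) (f g : α → ℝ) :
    rexp p (fun a => f a + g a) = rexp p f + rexp p g := by
  simp only [rexp, mul_add, sum_add_distrib]

lemma rexp_mul_left (p : PMF α) (c : ℝ) (f : α → ℝ) :
    rexp p (fun a => c * f a) = c * rexp p f := by
  simp only [rexp, mul_sum]
  exact sum_congr rfl fun a _ => by ring

lemma rexp_sub (p : PMF α) (f g : α → ℝ) :
    rexp p (fun a => f a - g a) = rexp p f - rexp p g := by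
  simp only [rexp, mul_sub, sum_sub_distrib]

lemma rexp_sum {ι : Type*} (t : Finset ι) (p : PMF α) (f : ι → α → ℝ) :
    rexp p (fun a => ∑ i ∈ t, f i a) = ∑ i ∈ t, rexp p (f i) := by
  simp only [rexp, mul_sum]
  exact sum_comm

lemma rexp_bind (p : PMF α) (k : α → PMF β) (f : β → ℝ) :
    rexp (p.bind k) f = rexp p fun a => rexp (k a) f := by
  simp only [rexp, PMF.bind_apply, tsum_fintype, mul_sum]
  rw [sum_comm]
  refine sum_congr rfl fun b _ => ?_
  rw [ENNReal.toReal_sum fun a _ => ENNReal.mul_ne_top (p.apply_ne_top a) ((k a).apply_ne_top b),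
    sum_mul]
  exact sum_congr rfl fun a _ => by rw [ENNReal.toReal_mul]; ring

lemma rexp_pure (a : α) (f : α → ℝ) : rexp (PMF.pure a) f = f a := by
  classical
  rw [rexp, sum_eq_single a]
  · simp
  · intro b _ hb
    simp [hb]
  · simp

lemma rexp_map (p : PMF α) (k : α → β) (f : β → ℝ) :
    rexp (p.map k) f = rexp p fun a => f (k a) := by
  rw [← PMF.bind_pure_comp, rexp_bind]
  simp only [Function.comp, rexp_pure]

lemma simplexPMF_toReal {X : Type} [Fintype X] (p : stdSimplex ℝ X) (x : X) :
    (simplexPMF p x).toReal = p x := by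
  have h : 0 ≤ p x := p.2.1 x
  rw [simplexPMF, PMF.ofFintype_apply, ENNReal.toReal_ofReal h]

lemma rexp_simplexPMF {X : Type} [Fintype X] (p : stdSimplex ℝ X) (f : X → ℝ) :
    rexp (simplexPMF p) f = ∑ x, p x * f x := by
  simp only [rexp, simplexPMF_toReal]

lemma rexp_exp_sub_le_one_of_exp_le (p : PMF α) {X Y : α → ℝ} {v : ℝ}
    (hXY : ∀ a, Real.exp (X a) ≤ 1 + Y a) (hY : rexp p Y ≤ v) :
    rexp p (fun a => Real.exp (X a - v)) ≤ 1 :=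
  calc rexp p (fun a => Real.exp (X a - v))
      = Real.exp (-v) * rexp p (fun a => Real.exp (X a)) := by
        simp only [← rexp_mul_left, ← Real.exp_add, neg_add_eq_sub]
    _ ≤ Real.exp (-v) * rexp p (fun a => 1 + Y a) := by gcongr; exact rexp_mono p hXY
    _ ≤ Real.exp (-v) * Real.exp v := by
        gcongr
        rw [rexp_add, rexp_const]
        linarith [Real.add_one_le_exp v]
    _ = 1 := by rw [← Real.exp_add, neg_add_cancel, Real.exp_zero]

lemma exp_le_one_add_self_add_sq {x : ℝ} (hx : x ≤ 1) : Real.exp x ≤ 1 + x + x ^ 2 := by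
  rcases le_total (-1) x with h | h
  · linarith [(abs_le.1 (Real.abs_exp_sub_one_sub_id_le (abs_le.2 ⟨h, hx⟩))).2]
  · nlinarith [Real.exp_le_one_iff.2 (h.trans (by norm_num))]

lemma exp_le_one_add_two_mul {x : ℝ} (h0 : 0 ≤ x) (hx : x ≤ 1) : Real.exp x ≤ 1 + 2 * x := by
  nlinarith [exp_le_one_add_self_add_sq hx]

lemma rexp_exp_sub_le_one (p : PMF α) {X : α → ℝ} {v : ℝ} (hX : ∀ a, X a ≤ 1)
    (hmean : rexp p X ≤ 0) (hsq : rexp p (fun a => X a ^ 2) ≤ v) :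
    rexp p (fun a => Real.exp (X a - v)) ≤ 1 := by
  refine rexp_exp_sub_le_one_of_exp_le p (Y := fun a => X a + X a ^ 2) (fun a => ?_) ?_
  · rw [← add_assoc]
    exact exp_le_one_add_self_add_sq (hX a)
  · rw [rexp_add]
    linarith

lemma rexp_exp_mul_sub_sq_mul_le_one (p : PMF α) {X : α → ℝ} {c D v : ℝ} (hc : 0 ≤ c)
    (hcD : c * D ≤ 1) (hX : ∀ a, X a ≤ D) (hmean : rexp p X = 0)
    (hsq : rexp p (fun a => X a ^ 2) ≤ v) :
    rexp p (fun a => Real.exp (c * X a - c ^ 2 * v)) ≤ 1 := by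
  refine rexp_exp_sub_le_one p (fun a => (mul_le_mul_of_nonneg_left (hX a) hc).trans hcD) ?_ ?_
  · rw [rexp_mul_left, hmean, mul_zero]
  · simp only [mul_pow, rexp_mul_left]
    exact mul_le_mul_of_nonneg_left hsq (sq_nonneg c)

lemma rexp_exp_sub_two_mul_le_one (p : PMF α) {X : α → ℝ} {v : ℝ} (hX0 : ∀ a, 0 ≤ X a)
    (hX : ∀ a, X a ≤ 1) (hmean : rexp p X ≤ v) :
    rexp p (fun a => Real.exp (X a - 2 * v)) ≤ 1 := by
  refine rexp_exp_sub_le_one_of_exp_le p (Y := fun a => 2 * X a)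
    (fun a => exp_le_one_add_two_mul (hX0 a) (hX a)) ?_
  rw [rexp_mul_left]
  linarith

end rexp

/-! ### Integration against product weights -/

lemma prod_update_apply {ι : Type*} [Fintype ι] [DecidableEq ι] {X : ι → Type*}
    (μ : ∀ i, X i → ℝ) (i : ι) (ν : X i → ℝ) (x : ∀ i, X i) :
    ∏ j, Function.update μ i ν j (x j) = ν (x i) * ∏ j ∈ univ.erase i, μ j (x j) := by
  rw [← mul_prod_erase _ _ (mem_univ i), Function.update_self]
  congr 1
  exact prod_congr rfl fun j hj => by rw [Function.update_of_ne (ne_of_mem_erase hj)]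

section prodMean
variable {ι : Type*} [Fintype ι] [DecidableEq ι] {X : ι → Type*} [∀ i, Fintype (X i)]

/-- The integral of `F` against the product of the weights `μ i`, which need not be nonnegative or
sum to one: it is multilinear in `μ`. -/
def prodMean (μ : ∀ i, X i → ℝ) (F : (∀ i, X i) → ℝ) : ℝ := ∑ x, (∏ i, μ i (x i)) * F x

lemma prodMean_mono (μ : ∀ i, X i → ℝ) (hμ : ∀ i a, 0 ≤ μ i a) {F F' : (∀ i, X i) → ℝ}
    (h : ∀ x, F x ≤ F' x) : prodMean μ F ≤ prodMean μ F' :=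
  sum_le_sum fun x _ =>
    mul_le_mul_of_nonneg_left (h x) (prod_nonneg fun i _ => hμ i _)

lemma prodMean_add (μ : ∀ i, X i → ℝ) (F F' : (∀ i, X i) → ℝ) :
    prodMean μ (fun x => F x + F' x) = prodMean μ F + prodMean μ F' := by
  simp only [prodMean, mul_add, sum_add_distrib]

lemma prodMean_mul_left (μ : ∀ i, X i → ℝ) (c : ℝ) (F : (∀ i, X i) → ℝ) :
    prodMean μ (fun x => c * F x) = c * prodMean μ F := by
  simp only [prodMean, mul_sum]
  exact sum_congr rfl fun a _ => by ring

lemma prodMean_const (μ : ∀ i, X i → ℝ) (hμ : ∀ i, ∑ a, μ i a = 1) (c : ℝ) :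
    prodMean μ (fun _ => c) = c := by
  rw [prodMean, ← sum_mul, ← Fintype.prod_sum, prod_eq_one fun i _ => hμ i, one_mul]

lemma le_prodMean {μ : ∀ i, X i → ℝ} (hμ : ∀ i, μ i ∈ stdSimplex ℝ (X i)) {F : (∀ i, X i) → ℝ}
    {lo : ℝ} (h : ∀ x, lo ≤ F x) : lo ≤ prodMean μ F := by
  simpa only [prodMean_const μ (fun i => (hμ i).2)] using prodMean_mono μ (fun i => (hμ i).1) h

lemma prodMean_le {μ : ∀ i, X i → ℝ} (hμ : ∀ i, μ i ∈ stdSimplex ℝ (X i)) {F : (∀ i, X i) → ℝ}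
    {hi : ℝ} (h : ∀ x, F x ≤ hi) : prodMean μ F ≤ hi := by
  simpa only [prodMean_const μ (fun i => (hμ i).2)] using prodMean_mono μ (fun i => (hμ i).1) h

lemma prodMean_apply (μ : ∀ i, X i → ℝ) (hμ : ∀ i, ∑ a, μ i a = 1) (i : ι) (g : X i → ℝ) :
    prodMean μ (fun x => g (x i)) = ∑ a, μ i a * g a := by
  have h : prodMean μ (fun x => g (x i))
      = ∑ x : ∀ i, X i, ∏ j, Function.update μ i (fun a => μ i a * g a) j (x j) := by
    refine sum_congr rfl fun x _ => ?_
    rw [prod_update_apply, ← mul_prod_erase _ _ (mem_univ i)]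
    ring
  rw [h, ← Fintype.prod_sum, ← mul_prod_erase _ _ (mem_univ i), Function.update_self,
    prod_eq_one, mul_one]
  intro j hj
  rw [Function.update_of_ne (ne_of_mem_erase hj), hμ j]

lemma prodMean_update_eq_sum [∀ i, DecidableEq (X i)] (μ : ∀ i, X i → ℝ) (i : ι) (ν : X i → ℝ)
    (F : (∀ i, X i) → ℝ) :
    prodMean (Function.update μ i ν) F
      = ∑ a, ν a * prodMean (Function.update μ i (Pi.single a 1)) F := by
  simp only [prodMean, prod_update_apply, mul_sum]
  rw [sum_comm]
  refine sum_congr rfl fun x _ => ?_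
  rw [sum_eq_single (x i)]
  · rw [Pi.single_eq_same]
    ring
  · intro b _ hb
    rw [Pi.single_eq_of_ne (Ne.symm hb)]
    ring
  · simp

lemma prodMean_eq_sum [∀ i, DecidableEq (X i)] (μ : ∀ i, X i → ℝ) (i : ι)
    (F : (∀ i, X i) → ℝ) :
    prodMean μ F = ∑ a, μ i a * prodMean (Function.update μ i (Pi.single a 1)) F := by
  conv_lhs => rw [← Function.update_eq_self i μ]
  exact prodMean_update_eq_sum μ i (μ i) F

lemma prodMean_update_sum {κ : Type*} (t : Finset κ) (μ : ∀ i, X i → ℝ) (i : ι) (w : κ → ℝ)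
    (ν : κ → X i → ℝ) (F : (∀ i, X i) → ℝ) :
    prodMean (Function.update μ i fun a => ∑ k ∈ t, w k * ν k a) F
      = ∑ k ∈ t, w k * prodMean (Function.update μ i (ν k)) F := by
  simp only [prodMean, prod_update_apply, mul_sum]
  rw [sum_comm]
  refine sum_congr rfl fun x _ => ?_
  rw [sum_mul, sum_mul]
  exact sum_congr rfl fun k _ => by ring

end prodMean

lemma update_single_mem_stdSimplex {ι : Type*} [DecidableEq ι] {X : ι → Type*} [∀ i, Fintype (X i)]
    [∀ i, DecidableEq (X i)] {μ : ∀ i, X i → ℝ}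
    (hμ : ∀ i, μ i ∈ stdSimplex ℝ (X i)) (i : ι) (a : X i) (j : ι) :
    Function.update μ i (Pi.single a 1) j ∈ stdSimplex ℝ (X j) := by
  rcases eq_or_ne j i with rfl | hj
  · rw [Function.update_self]
    exact single_mem_stdSimplex ℝ a
  · rw [Function.update_of_ne hj]
    exact hμ j

lemma rexp_indepPMF {ι : Type} [Fintype ι] [DecidableEq ι] {X : ι → Type} [∀ i, Fintype (X i)]
    (p : ∀ i, PMF (X i)) (F : (∀ i, X i) → ℝ) :
    rexp (indepPMF p) F = prodMean (fun i a => (p i a).toReal) F := by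
  refine sum_congr rfl fun x _ => ?_
  rw [indepPMF, PMF.ofFintype_apply, ENNReal.toReal_prod]

lemma rexp_indepPMF_apply {ι : Type} [Fintype ι] [DecidableEq ι] {X : ι → Type}
    [∀ i, Fintype (X i)] (p : ∀ i, PMF (X i)) (i : ι) (g : X i → ℝ) :
    rexp (indepPMF p) (fun x => g (x i)) = rexp (p i) g := by
  rw [rexp_indepPMF, prodMean_apply _ (fun j => sum_toReal_apply (p j))]
  rfl

/-! ### Means and variances on a finite set -/

section meanVar
variable {X : Type} [Fintype X]

lemma simplex_nonneg (p : stdSimplex ℝ X) (x : X) : 0 ≤ p x := p.2.1 x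

lemma simplex_sum (p : stdSimplex ℝ X) : ∑ x, p x = 1 := p.2.2

lemma mean_mono (p : stdSimplex ℝ X) {f g : X → ℝ} (h : ∀ x, f x ≤ g x) : mean p f ≤ mean p g :=
  sum_le_sum fun x _ => mul_le_mul_of_nonneg_left (h x) (simplex_nonneg p x)

lemma mean_const (p : stdSimplex ℝ X) (c : ℝ) : mean p (fun _ => c) = c := by
  rw [mean, ← sum_mul, simplex_sum, one_mul]

lemma mean_add (p : stdSimplex ℝ X) (f g : X → ℝ) :
    mean p (fun x => f x + g x) = mean p f + mean p g := by
  simp only [mean, mul_add, sum_add_distrib]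

lemma mean_mul_left (p : stdSimplex ℝ X) (c : ℝ) (f : X → ℝ) :
    mean p (fun x => c * f x) = c * mean p f := by
  simp only [mean, mul_sum]
  exact sum_congr rfl fun a _ => by ring

lemma mean_sub_sq (p : stdSimplex ℝ X) (f : X → ℝ) (c : ℝ) :
    mean p (fun x => (f x - c) ^ 2) = mean p (fun x => f x ^ 2) - 2 * c * mean p f + c ^ 2 := by
  have : (fun x => (f x - c) ^ 2) = fun x => f x ^ 2 + ((-(2 * c)) * f x + c ^ 2) := by
    ext x; ring
  rw [this, mean_add, mean_add, mean_mul_left, mean_const]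
  ring

lemma var_eq (p : stdSimplex ℝ X) (f : X → ℝ) :
    var p f = mean p (fun x => f x ^ 2) - mean p f ^ 2 := by
  rw [var, mean_sub_sq]; ring

lemma var_nonneg (p : stdSimplex ℝ X) (f : X → ℝ) : 0 ≤ var p f :=
  sum_nonneg fun x _ => mul_nonneg (simplex_nonneg p x) (sq_nonneg _)

lemma sq_mean_le (p : stdSimplex ℝ X) (f : X → ℝ) : mean p f ^ 2 ≤ mean p (fun x => f x ^ 2) := by
  have := var_nonneg p f
  rw [var_eq] at this
  linarith

lemma var_le_mean_sub_sq (p : stdSimplex ℝ X) (f : X → ℝ) (c : ℝ) :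
    var p f ≤ mean p (fun x => (f x - c) ^ 2) := by
  rw [var_eq, mean_sub_sq]
  nlinarith [sq_nonneg (mean p f - c)]

lemma var_add_const (p : stdSimplex ℝ X) (f : X → ℝ) (c : ℝ) :
    var p (fun x => f x + c) = var p f := by
  simp only [var, mean_add, mean_const, add_sub_add_right_eq_sub]

lemma var_le_sub_mean_mul (p : stdSimplex ℝ X) (f : X → ℝ) {lo hi : ℝ} (hlo : ∀ x, lo ≤ f x)
    (hhi : ∀ x, f x ≤ hi) : var p f ≤ (hi - mean p f) * (mean p f - lo) := by
  have h : mean p (fun x => f x ^ 2) ≤ mean p (fun x => (hi + lo) * f x + (-(hi * lo))) :=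
    mean_mono p fun x => by nlinarith [mul_nonneg (sub_nonneg.2 (hlo x)) (sub_nonneg.2 (hhi x))]
  rw [mean_add, mean_mul_left, mean_const] at h
  rw [var_eq]
  nlinarith

lemma le_mean (p : stdSimplex ℝ X) (f : X → ℝ) {lo : ℝ} (hlo : ∀ x, lo ≤ f x) : lo ≤ mean p f := by
  simpa only [mean_const] using mean_mono p hlo

lemma mean_le (p : stdSimplex ℝ X) (f : X → ℝ) {hi : ℝ} (hhi : ∀ x, f x ≤ hi) : mean p f ≤ hi := by
  simpa only [mean_const] using mean_mono p hhi

lemma mean_add_mul_var_le (p : stdSimplex ℝ X) (f : X → ℝ) {lo hi b : ℝ} (hlo : ∀ x, lo ≤ f x)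
    (hhi : ∀ x, f x ≤ hi) (hb : 0 ≤ b) (hb1 : b * (hi - lo) ≤ 1) :
    mean p f + b * var p f ≤ hi := by
  have hmean_le := mean_le p f hhi
  have hvar : b * var p f ≤ (hi - mean p f) * (b * (hi - lo)) :=
    calc b * var p f ≤ b * ((hi - mean p f) * (mean p f - lo)) := by
          gcongr; exact var_le_sub_mean_mul p f hlo hhi
      _ ≤ b * ((hi - mean p f) * (hi - lo)) := by
          have := sub_nonneg.2 hmean_le
          gcongr
      _ = _ := by ring
  linarith [mul_le_of_le_one_right (sub_nonneg.2 hmean_le) hb1]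

end meanVar

/-! ### Exponential weights -/

section logMean
variable {X : Type} [Fintype X]

/-- The logarithmic mean `η⁻¹ log (|X|⁻¹ ∑ exp (η f))`: the potential of exponential weights with
step size `η` and cumulative gains `f`. -/
def logMean (η : ℝ) (f : X → ℝ) : ℝ :=
  Real.log (∑ x, (Fintype.card X : ℝ)⁻¹ * Real.exp (η * f x)) / η

lemma logMean_mul {η c : ℝ} (hc : 0 < c) (f : X → ℝ) :
    logMean η (fun x => c * f x) = c * logMean (c * η) f := by
  have h : ∀ x, η * (c * f x) = c * η * f x := fun x => by ring
  simp only [logMean, h]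
  rw [mul_div_assoc', mul_div_mul_left _ _ hc.ne']

lemma mean_exp_pos (p : stdSimplex ℝ X) (f : X → ℝ) : 0 < mean p fun x => Real.exp (f x) := by
  obtain ⟨x, -, hx⟩ := exists_ne_zero_of_sum_ne_zero (simplex_sum p ▸ one_ne_zero)
  refine sum_pos' (fun y _ => mul_nonneg (simplex_nonneg p y) (Real.exp_pos _).le)
    ⟨x, mem_univ x, mul_pos ((simplex_nonneg p x).lt_of_ne' hx) (Real.exp_pos _)⟩

lemma log_mean_exp_div_le_mean_add_mul_var (p : stdSimplex ℝ X) {f : X → ℝ} {θ lo hi : ℝ}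
    (hθ : 0 < θ) (hlo : ∀ x, lo ≤ f x) (hhi : ∀ x, f x ≤ hi) (hθ1 : θ * (hi - lo) ≤ 1) :
    Real.log (mean p fun x => Real.exp (θ * f x)) / θ ≤ mean p f + θ * var p f := by
  have hcentred : mean p (fun x => θ * (f x + -mean p f)) = 0 := by
    rw [mean_mul_left, mean_add, mean_const]; ring
  have hsq : mean p (fun x => (θ * (f x + -mean p f)) ^ 2) = θ ^ 2 * var p f := by
    simp only [mul_pow, mean_mul_left, ← sub_eq_add_neg, var]
  have hmoment : mean p (fun x => Real.exp (θ * (f x + -mean p f) - θ ^ 2 * var p f)) ≤ 1 := by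
    have h := rexp_exp_sub_le_one (simplexPMF p) (X := fun x => θ * (f x + -mean p f))
      (v := θ ^ 2 * var p f) (fun x => ?_) ((rexp_simplexPMF p _).trans hcentred).le
      ((rexp_simplexPMF p _).trans hsq).le
    · rwa [rexp_simplexPMF] at h
    · exact le_trans (by gcongr; linarith [hhi x, le_mean p f hlo]) hθ1
  have hexp : ∀ x, Real.exp (θ * f x) = Real.exp (θ * mean p f + θ ^ 2 * var p f)
      * Real.exp (θ * (f x + -mean p f) - θ ^ 2 * var p f) := fun x => by
    rw [← Real.exp_add]; ring_nf
  rw [div_le_iff₀ hθ, Real.log_le_iff_le_exp (mean_exp_pos p _)]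
  simp only [hexp, mean_mul_left]
  refine (mul_le_of_le_one_right (Real.exp_pos _).le hmoment).trans_eq ?_
  ring_nf

lemma log_mean_exp_div_le (p : stdSimplex ℝ X) {f : X → ℝ} {θ hi : ℝ} (hθ : 0 < θ)
    (hhi : ∀ x, f x ≤ hi) : Real.log (mean p fun x => Real.exp (θ * f x)) / θ ≤ hi := by
  rw [div_le_iff₀ hθ, Real.log_le_iff_le_exp (mean_exp_pos p _)]
  exact mean_le p _ fun x => Real.exp_le_exp.2 (by nlinarith [hhi x])

variable [Nonempty X]

lemma card_inv_pos : (0 : ℝ) < (Fintype.card X : ℝ)⁻¹ := by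
  have : 0 < Fintype.card X := Fintype.card_pos
  positivity

lemma sum_card_inv : ∑ _x : X, (Fintype.card X : ℝ)⁻¹ = 1 := by
  rw [sum_const, card_univ, nsmul_eq_mul]
  exact mul_inv_cancel₀ (by exact_mod_cast Fintype.card_ne_zero)

lemma sum_exp_pos (f : X → ℝ) : 0 < ∑ x, (Fintype.card X : ℝ)⁻¹ * Real.exp (f x) :=
  sum_pos (fun _ _ => mul_pos card_inv_pos (Real.exp_pos _)) univ_nonempty

lemma logMean_mono_left {η η' : ℝ} (hη' : 0 < η') (h : η' ≤ η) (f : X → ℝ) :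
    logMean η' f ≤ logMean η f := by
  have hη : 0 < η := hη'.trans_le h
  have hexp : ∀ x, Real.exp (η' * f x) ^ (η / η') = Real.exp (η * f x) := fun x => by
    rw [← Real.exp_mul, mul_right_comm, mul_div_cancel₀ _ hη'.ne']
  have hjensen := Real.rpow_arith_mean_le_arith_mean_rpow univ
    (fun _ : X => (Fintype.card X : ℝ)⁻¹) (fun x => Real.exp (η' * f x))
    (fun _ _ => card_inv_pos.le) sum_card_inv (fun x _ => (Real.exp_pos _).le)
    (p := η / η') ((one_le_div hη').2 h)
  simp only [hexp] at hjensen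
  have hlog := Real.log_le_log (Real.rpow_pos_of_pos (sum_exp_pos _) _) hjensen
  rw [Real.log_rpow (sum_exp_pos _), div_mul_eq_mul_div, div_le_iff₀ hη'] at hlog
  rw [logMean, logMean, div_le_div_iff₀ hη' hη]
  linarith

lemma logMean_le {η M : ℝ} (hη : 0 < η) {f : X → ℝ} (hf : ∀ x, f x ≤ M) : logMean η f ≤ M := by
  rw [logMean, div_le_iff₀ hη, Real.log_le_iff_le_exp (sum_exp_pos _)]
  calc ∑ x, (Fintype.card X : ℝ)⁻¹ * Real.exp (η * f x)
      ≤ ∑ _x : X, (Fintype.card X : ℝ)⁻¹ * Real.exp (M * η) :=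
        sum_le_sum fun x _ => mul_le_mul_of_nonneg_left
          (Real.exp_le_exp.2 (by nlinarith [hf x])) card_inv_pos.le
    _ = Real.exp (M * η) := by rw [← sum_mul, sum_card_inv, one_mul]

lemma le_logMean_add {η : ℝ} (hη : 0 < η) (f : X → ℝ) (x : X) :
    f x ≤ logMean η f + Real.log (Fintype.card X) / η := by
  have hterm : (Fintype.card X : ℝ)⁻¹ * Real.exp (η * f x)
      ≤ ∑ x, (Fintype.card X : ℝ)⁻¹ * Real.exp (η * f x) :=
    single_le_sum (f := fun x => (Fintype.card X : ℝ)⁻¹ * Real.exp (η * f x))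
      (fun x _ => (mul_pos card_inv_pos (Real.exp_pos _)).le) (mem_univ x)
  have hlog := Real.log_le_log (mul_pos card_inv_pos (Real.exp_pos _)) hterm
  rw [Real.log_mul card_inv_pos.ne' (Real.exp_pos _).ne', Real.log_inv, Real.log_exp] at hlog
  rw [logMean, ← add_div, le_div_iff₀ hη]
  linarith

lemma mean_softmax (f g : X → ℝ) :
    mean (softmax f) g = (∑ x, Real.exp (f x) * g x) / ∑ x, Real.exp (f x) := by
  rw [sum_div]
  exact sum_congr rfl fun x _ => div_mul_eq_mul_div _ _ _

lemma logMean_add (η : ℝ) (f g : X → ℝ) :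
    logMean η (fun x => f x + g x) = logMean η f
      + Real.log (mean (softmax fun x => η * f x) fun x => Real.exp (η * g x)) / η := by
  have hratio : mean (softmax fun x => η * f x) (fun x => Real.exp (η * g x))
      = (∑ x, (Fintype.card X : ℝ)⁻¹ * Real.exp (η * (f x + g x)))
        / (∑ x, (Fintype.card X : ℝ)⁻¹ * Real.exp (η * f x)) := by
    rw [mean_softmax, ← mul_sum, ← mul_sum, mul_div_mul_left _ _ card_inv_pos.ne']
    simp only [mul_add, Real.exp_add]
  rw [hratio, Real.log_div (sum_exp_pos _).ne' (sum_exp_pos _).ne', logMean, logMean, ← add_div,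
    add_sub_cancel]

lemma logMean_convexComb_le {η η' a : ℝ} (ha0 : 0 < a) (ha1 : a < 1) (hη : 0 < η) (hη' : 0 < η')
    (hηη' : (1 - a) * η' ≤ η) (f g : X → ℝ) :
    logMean η' (fun x => (1 - a) * f x + a * g x) ≤ (1 - a) * logMean η f
      + a * (Real.log (mean (softmax fun x => η * f x) fun x => Real.exp (η * a / (1 - a) * g x))
          / (η * a / (1 - a))) := by
  have hpos : 0 < 1 - a := sub_pos.2 ha1
  have hfactor : (fun x => (1 - a) * f x + a * g x)
      = fun x => (1 - a) * (f x + a / (1 - a) * g x) := by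
    ext x; field_simp
  have hexp : ∀ x, η * (a / (1 - a) * g x) = η * a / (1 - a) * g x := fun x => by ring
  calc logMean η' (fun x => (1 - a) * f x + a * g x)
      = (1 - a) * logMean ((1 - a) * η') (fun x => f x + a / (1 - a) * g x) := by
        rw [hfactor, logMean_mul hpos]
    _ ≤ (1 - a) * logMean η (fun x => f x + a / (1 - a) * g x) :=
        mul_le_mul_of_nonneg_left (logMean_mono_left (mul_pos hpos hη') hηη' _) hpos.le
    _ = _ := by
        rw [logMean_add, mul_add]
        simp only [hexp]
        field_simp

end logMean

/-! ### Weighted averages along a sequence of step sizes -/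

/-- The weight `α_k ∏_{k < j ≤ n} (1 - α_j)` of round `k` in the running average over `n` rounds
with the step sizes `α`. -/
def stepWeight (α : ℕ → ℝ) (n k : ℕ) : ℝ := α k * ∏ j ∈ Icc (k + 1) n, (1 - α j)

lemma weightAlpha_eq (cα : ℝ) (K k : ℕ) : weightAlpha cα K k = stepWeight (stepAlpha cα K) K k :=
  rfl

lemma stepWeight_self (α : ℕ → ℝ) (n : ℕ) : stepWeight α n n = α n := by
  simp [stepWeight]

lemma stepWeight_succ (α : ℕ → ℝ) {n k : ℕ} (h : k ≤ n) :
    stepWeight α (n + 1) k = (1 - α (n + 1)) * stepWeight α n k := by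
  rw [stepWeight, stepWeight, prod_Icc_succ_top (by lia)]
  ring

lemma sum_stepWeight_succ (α : ℕ → ℝ) (g : ℕ → ℝ) (n : ℕ) :
    ∑ k ∈ Icc 1 (n + 1), stepWeight α (n + 1) k * g k
      = (1 - α (n + 1)) * ∑ k ∈ Icc 1 n, stepWeight α n k * g k + α (n + 1) * g (n + 1) := by
  rw [sum_Icc_succ_top (by lia), stepWeight_self, mul_sum]
  congr 1
  refine sum_congr rfl fun k hk => ?_
  rw [stepWeight_succ α (mem_Icc.1 hk).2]
  ring

lemma sum_stepWeight (α : ℕ → ℝ) (h1 : α 1 = 1) {n : ℕ} (hn : 1 ≤ n) :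
    ∑ k ∈ Icc 1 n, stepWeight α n k = 1 := by
  induction n, hn using Nat.le_induction with
  | base => simp [stepWeight, h1]
  | succ n _ ih =>
    have hsucc := sum_stepWeight_succ α (fun _ => 1) n
    simp only [mul_one] at hsucc
    rw [hsucc, ih, mul_one, sub_add_cancel]

lemma stepWeight_nonneg (α : ℕ → ℝ) (h0 : ∀ k, 1 ≤ k → 0 ≤ α k) (h1 : ∀ k, 1 ≤ k → α k ≤ 1)
    {n k : ℕ} (hk : 1 ≤ k) : 0 ≤ stepWeight α n k :=
  mul_nonneg (h0 k hk) (prod_nonneg fun j hj =>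
    sub_nonneg.2 (h1 j (hk.trans ((Nat.le_succ k).trans (mem_Icc.1 hj).1))))

lemma sum_stepWeight_prefix (α : ℕ → ℝ) (h1 : α 1 = 1) {n k₀ : ℕ} (hk : 1 ≤ k₀) (hn : k₀ ≤ n) :
    ∑ k ∈ Icc 1 k₀, stepWeight α n k = ∏ j ∈ Icc (k₀ + 1) n, (1 - α j) := by
  induction n, hn using Nat.le_induction with
  | base => simp [sum_stepWeight α h1 hk]
  | succ n hn ih =>
    rw [prod_Icc_succ_top (by lia), ← ih, sum_mul]
    refine sum_congr rfl fun k hk' => ?_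
    rw [stepWeight_succ α ((mem_Icc.1 hk').2.trans hn)]
    ring

section regret
variable {X : Type} [Fintype X] [Nonempty X] {α η : ℕ → ℝ} {q Q : ℕ → X → ℝ} {n : ℕ}

lemma logMean_le_sum_stepWeight (hn : 1 ≤ n) (h1 : α 1 = 1) (hα0 : ∀ k, 1 ≤ k → 0 < α k)
    (hα1 : ∀ k, 2 ≤ k → α k < 1) (hη : ∀ k, 1 ≤ k → 0 < η k)
    (hηα : ∀ k, 1 ≤ k → (1 - α k) * η (k + 1) ≤ η k)
    (hQ : ∀ k x, Q (k + 1) x = (1 - α (k + 1)) * Q k x + α (k + 1) * q (k + 1) x)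
    {g : ℕ → ℝ} (hg1 : ∀ x, q 1 x ≤ g 1)
    (hg : ∀ k ∈ Icc 2 n, Real.log (mean (softmax fun y => η k * Q (k - 1) y)
        fun y => Real.exp (η k * α k / (1 - α k) * q k y)) / (η k * α k / (1 - α k)) ≤ g k) :
    logMean (η (n + 1)) (Q n) ≤ ∑ k ∈ Icc 1 n, stepWeight α n k * g k := by
  induction n, hn using Nat.le_induction with
  | base =>
    simp only [Icc_self, sum_singleton, stepWeight_self, h1, one_mul]
    refine logMean_le (hη 2 (by lia)) fun x => ?_
    simpa only [hQ 0 x, zero_add, h1, sub_self, zero_mul, one_mul] using hg1 x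
  | succ n hn ih =>
    have hQn : Q (n + 1) = fun x => (1 - α (n + 1)) * Q n x + α (n + 1) * q (n + 1) x :=
      funext (hQ n)
    have hα1' : α (n + 1) < 1 := hα1 (n + 1) (by lia)
    have hα0' : 0 < α (n + 1) := hα0 (n + 1) (by lia)
    rw [sum_stepWeight_succ, hQn]
    refine (logMean_convexComb_le hα0' hα1' (hη (n + 1) (by lia)) (hη (n + 2) (by lia))
      (hηα (n + 1) (by lia)) _ _).trans (add_le_add ?_ ?_)
    · exact mul_le_mul_of_nonneg_left
        (ih fun k hk => hg k (Icc_subset_Icc_right n.le_succ hk)) (sub_pos.2 hα1').le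
    · exact mul_le_mul_of_nonneg_left (hg (n + 1) (mem_Icc.2 ⟨by lia, le_rfl⟩)) hα0'.le

/-- The second-order bound needs `η_k α_k (1 - α_k)⁻¹ D ≤ 1`, which fails in the first rounds; those
up to `k₀` are charged the whole range `D` of the gains instead. -/
theorem expWeights_regret {k₀ : ℕ} {lo D : ℝ} (hn : 1 ≤ n) (hk₀ : 1 ≤ k₀) (h1 : α 1 = 1)
    (hα0 : ∀ k, 1 ≤ k → 0 < α k) (hα1 : ∀ k, 2 ≤ k → α k < 1) (hη : ∀ k, 1 ≤ k → 0 < η k)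
    (hηα : ∀ k, 1 ≤ k → (1 - α k) * η (k + 1) ≤ η k)
    (hQ : ∀ k x, Q (k + 1) x = (1 - α (k + 1)) * Q k x + α (k + 1) * q (k + 1) x)
    (hlo : ∀ k ∈ Icc 1 n, ∀ x, lo ≤ q k x) (hhi : ∀ k ∈ Icc 1 n, ∀ x, q k x ≤ lo + D)
    (hD : ∀ k ∈ Icc (k₀ + 1) n, η k * α k / (1 - α k) * D ≤ 1) (x : X) :
    Q n x ≤ ∑ k ∈ Icc 1 n, stepWeight α n k *
        (mean (softmax fun y => η k * Q (k - 1) y) (q k)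
          + if k₀ < k then η k * α k / (1 - α k) *
              var (softmax fun y => η k * Q (k - 1) y) (q k) else D)
      + Real.log (Fintype.card X) / η (n + 1) := by
  have hle_mean_add : ∀ k ∈ Icc 1 n, lo + D ≤ mean (softmax fun y => η k * Q (k - 1) y) (q k) + D :=
    fun k hk => add_le_add_left (le_mean _ _ (hlo k hk)) D
  refine (le_logMean_add (hη (n + 1) (by lia)) (Q n) x).trans (add_le_add_left
    (logMean_le_sum_stepWeight hn h1 hα0 hα1 hη hηα hQ (fun y => ?_) fun k hk => ?_) _)
  · have h1n : 1 ∈ Icc 1 n := mem_Icc.2 ⟨le_rfl, hn⟩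
    rw [if_neg (by lia)]
    exact (hhi 1 h1n y).trans (hle_mean_add 1 h1n)
  · have hk1 : k ∈ Icc 1 n := Icc_subset_Icc_left one_le_two hk
    have h2k : 2 ≤ k := (mem_Icc.1 hk).1
    have hθ : 0 < η k * α k / (1 - α k) :=
      div_pos (mul_pos (hη k (by lia)) (hα0 k (by lia))) (sub_pos.2 (hα1 k h2k))
    split_ifs with hkk
    · exact log_mean_exp_div_le_mean_add_mul_var _ hθ (hlo k hk1) (hhi k hk1)
        (by simpa only [add_sub_cancel_left] using hD k (mem_Icc.2 ⟨hkk, (mem_Icc.1 hk).2⟩))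
    · exact (log_mean_exp_div_le _ hθ (hhi k hk1)).trans (hle_mean_add k hk1)

end regret

/-! ### Step sizes -/

section stepSizes
variable {cα : ℝ} {K : ℕ}

lemma stepAlpha_one (hc : 1 ≤ cα * Real.log K) : stepAlpha cα K 1 = 1 := by
  rw [stepAlpha, Nat.cast_one, sub_self, zero_add]
  exact div_self (by linarith)

lemma stepAlpha_pos (hc : 1 ≤ cα * Real.log K) {k : ℕ} (hk : 1 ≤ k) : 0 < stepAlpha cα K k := by
  have : (1 : ℝ) ≤ k := by exact_mod_cast hk
  exact div_pos (by linarith) (by linarith)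

lemma stepAlpha_le_one (hc : 1 ≤ cα * Real.log K) {k : ℕ} (hk : 1 ≤ k) :
    stepAlpha cα K k ≤ 1 := by
  have : (1 : ℝ) ≤ k := by exact_mod_cast hk
  exact (div_le_one (by linarith)).2 (by linarith)

lemma stepAlpha_lt_one (hc : 1 ≤ cα * Real.log K) {k : ℕ} (hk : 2 ≤ k) :
    stepAlpha cα K k < 1 := by
  have : (2 : ℝ) ≤ k := by exact_mod_cast hk
  exact (div_lt_one (by linarith)).2 (by linarith)

lemma stepAlpha_le_div (hc : 1 ≤ cα * Real.log K) {k : ℕ} (hk : 1 ≤ k) :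
    stepAlpha cα K k ≤ cα * Real.log K / k := by
  have : (1 : ℝ) ≤ k := by exact_mod_cast hk
  exact div_le_div_of_nonneg_left (by linarith) (by linarith) (by linarith)

lemma weightAlpha_nonneg (hc : 1 ≤ cα * Real.log K) {k : ℕ} (hk : k ∈ Icc 1 K) :
    0 ≤ weightAlpha cα K k :=
  stepWeight_nonneg _ (fun _ h => (stepAlpha_pos hc h).le) (fun _ h => stepAlpha_le_one hc h)
    (mem_Icc.1 hk).1

lemma sum_weightAlpha (hc : 1 ≤ cα * Real.log K) (hK : 1 ≤ K) :
    ∑ k ∈ Icc 1 K, weightAlpha cα K k = 1 :=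
  sum_stepWeight _ (stepAlpha_one hc) hK

lemma stepWeight_stepAlpha_le (hc : 1 ≤ cα * Real.log K) {n k : ℕ} (hk : 1 ≤ k) (hn : k ≤ n) :
    stepWeight (stepAlpha cα K) n k ≤ stepAlpha cα K n := by
  induction n, hn using Nat.le_induction with
  | base => rw [stepWeight_self]
  | succ n hn ih =>
    have hn1 : (1 : ℝ) ≤ n := by exact_mod_cast hk.trans hn
    rw [stepWeight_succ _ hn]
    refine (mul_le_mul_of_nonneg_left ih
      (sub_nonneg.2 (stepAlpha_le_one hc (by lia)))).trans ?_
    simp only [stepAlpha]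
    push_cast
    set c := cα * Real.log K
    have hden : (0 : ℝ) < n - 1 + c := by linarith
    have hden_succ : (0 : ℝ) < n + 1 - 1 + c := by linarith
    rw [one_sub_div hden_succ.ne', div_mul_div_comm,
      div_le_div_iff₀ (mul_pos hden_succ hden) hden_succ]
    nlinarith [mul_nonneg (zero_le_one.trans hc) hden_succ.le]

lemma weightAlpha_le (hc : 1 ≤ cα * Real.log K) {k : ℕ} (hk : k ∈ Icc 1 K) :
    weightAlpha cα K k ≤ cα * Real.log K / K :=
  (stepWeight_stepAlpha_le hc (mem_Icc.1 hk).1 (mem_Icc.1 hk).2).trans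
    (stepAlpha_le_div hc ((mem_Icc.1 hk).1.trans (mem_Icc.1 hk).2))

lemma sum_weightAlpha_mul_le (hc : 1 ≤ cα * Real.log K) (hK : 1 ≤ K) {f : ℕ → ℝ} {c : ℝ}
    (hf : ∀ k ∈ Icc 1 K, f k ≤ c) : ∑ k ∈ Icc 1 K, weightAlpha cα K k * f k ≤ c :=
  calc ∑ k ∈ Icc 1 K, weightAlpha cα K k * f k
      ≤ ∑ k ∈ Icc 1 K, weightAlpha cα K k * c := sum_le_sum fun k hk =>
        mul_le_mul_of_nonneg_left (hf k hk) (weightAlpha_nonneg hc hk)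
    _ = c := by rw [← sum_mul, sum_weightAlpha hc hK, one_mul]

lemma le_sum_weightAlpha_mul (hc : 1 ≤ cα * Real.log K) (hK : 1 ≤ K) {f : ℕ → ℝ} {c : ℝ}
    (hf : ∀ k ∈ Icc 1 K, c ≤ f k) : c ≤ ∑ k ∈ Icc 1 K, weightAlpha cα K k * f k :=
  calc c = ∑ k ∈ Icc 1 K, weightAlpha cα K k * c := by
        rw [← sum_mul, sum_weightAlpha hc hK, one_mul]
    _ ≤ ∑ k ∈ Icc 1 K, weightAlpha cα K k * f k := sum_le_sum fun k hk =>
        mul_le_mul_of_nonneg_left (hf k hk) (weightAlpha_nonneg hc hk)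

lemma sq_sum_weightAlpha_mul_le (hc : 1 ≤ cα * Real.log K) (hK : 1 ≤ K) (f : ℕ → ℝ) :
    (∑ k ∈ Icc 1 K, weightAlpha cα K k * f k) ^ 2
      ≤ ∑ k ∈ Icc 1 K, weightAlpha cα K k * f k ^ 2 :=
  Real.pow_arith_mean_le_arith_mean_pow_of_even _ _ _ (fun _ hk => weightAlpha_nonneg hc hk)
    (sum_weightAlpha hc hK) even_two

lemma prod_one_sub_stepAlpha_le (hc : 1 ≤ cα * Real.log K) {n k₀ : ℕ} (hn : k₀ ≤ n) :
    ∏ j ∈ Icc (k₀ + 1) n, (1 - stepAlpha cα K j) ≤ Real.exp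
      (-(cα * Real.log K * Real.log ((n + cα * Real.log K) / (k₀ + cα * Real.log K)))) := by
  set c := cα * Real.log K with hcdef
  have hpos : ∀ x : ℕ, 0 < (x : ℝ) + c := fun x => by positivity
  have hfactor : ∀ n : ℕ, 1 - stepAlpha cα K (n + 1)
      ≤ Real.exp (-(c * (Real.log ((n + 1 : ℕ) + c) - Real.log (n + c)))) := fun n => by
    refine (Real.one_sub_le_exp_neg _).trans (Real.exp_le_exp.2 (neg_le_neg ?_))
    have hlog : Real.log ((n + 1 : ℕ) + c) - Real.log (n + c) ≤ 1 / (n + c) := by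
      rw [← Real.log_div (hpos _).ne' (hpos n).ne']
      refine (Real.log_le_sub_one_of_pos (div_pos (hpos _) (hpos n))).trans_eq ?_
      have := (hpos n).ne'
      push_cast
      field_simp
      ring
    refine (mul_le_mul_of_nonneg_left hlog (by linarith)).trans_eq ?_
    rw [stepAlpha, ← hcdef, Nat.cast_add_one, add_sub_cancel_right, mul_one_div]
  rw [Real.log_div (hpos n).ne' (hpos k₀).ne']
  induction n, hn using Nat.le_induction with
  | base => simp
  | succ n hn ih =>
    rw [prod_Icc_succ_top (by lia)]
    refine (mul_le_mul ih (hfactor n) (sub_nonneg.2 (stepAlpha_le_one hc (by lia)))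
      (Real.exp_pos _).le).trans_eq ?_
    rw [← Real.exp_add]
    ring_nf

/-- The inverse of the fraction of initial rounds in which exponential weights are not yet stable.
The factor `exp (1 / cα)` makes the total weight of these rounds at most `1 / K`. -/
def burnInRatio (cα : ℝ) : ℝ := 3 * Real.exp (1 / cα)

/-- The number of initial rounds in which exponential weights are not yet stable. -/
def burnIn (cα : ℝ) (K : ℕ) : ℕ := ⌈(K : ℝ) / burnInRatio cα⌉₊

lemma burnInRatio_pos (cα : ℝ) : 0 < burnInRatio cα := by
  rw [burnInRatio]; positivity

lemma three_le_burnInRatio (hα : 0 < cα) : 3 ≤ burnInRatio cα := by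
  rw [burnInRatio]
  linarith [Real.add_one_le_exp (1 / cα), one_div_pos.2 hα]

lemma one_le_burnIn (cα : ℝ) (hK : 1 ≤ K) : 1 ≤ burnIn cα K := by
  have := burnInRatio_pos cα
  exact Nat.one_le_ceil_iff.2 (by positivity)

lemma exp_le_div_burnIn_add (hK : 1 ≤ K) {c : ℝ} (hc : 1 ≤ c)
    (hcK : c * burnInRatio cα ≤ K) :
    Real.exp (1 / cα) ≤ (K + c) / (burnIn cα K + c) := by
  have hM0 := burnInRatio_pos cα
  have hceil : ((burnIn cα K : ℕ) : ℝ) < K / burnInRatio cα + 1 :=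
    Nat.ceil_lt_add_one (by positivity)
  have hburn : burnInRatio cα * (burnIn cα K + c) ≤ 3 * K :=
    calc burnInRatio cα * (burnIn cα K + c)
        ≤ burnInRatio cα * (K / burnInRatio cα + c + c) := by gcongr; linarith
      _ = K + 2 * (c * burnInRatio cα) := by field_simp; ring
      _ ≤ 3 * K := by linarith
  rw [burnInRatio] at hburn
  rw [le_div_iff₀ (by positivity)]
  linarith

lemma sum_weightAlpha_burnIn_le (hα : 0 < cα) (hc : 1 ≤ cα * Real.log K) (hK : 1 ≤ K)
    (hcK : cα * Real.log K * burnInRatio cα ≤ K) :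
    ∑ k ∈ Icc 1 (burnIn cα K), weightAlpha cα K k ≤ 1 / K := by
  have hKp : (0 : ℝ) < K := by exact_mod_cast hK
  have hburn_le : burnIn cα K ≤ K :=
    Nat.ceil_le.2 (div_le_self hKp.le (by linarith [three_le_burnInRatio hα]))
  have hlog : 1 / cα ≤ Real.log ((K + cα * Real.log K) / (burnIn cα K + cα * Real.log K)) :=
    (Real.le_log_iff_exp_le (by positivity)).2 (exp_le_div_burnIn_add hK hc hcK)
  simp only [weightAlpha_eq]
  rw [sum_stepWeight_prefix _ (stepAlpha_one hc) (one_le_burnIn cα hK) hburn_le]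
  refine (prod_one_sub_stepAlpha_le hc hburn_le).trans ?_
  calc Real.exp (-(cα * Real.log K *
          Real.log ((K + cα * Real.log K) / (burnIn cα K + cα * Real.log K))))
      ≤ Real.exp (-(cα * Real.log K * (1 / cα))) := by gcongr
    _ = 1 / K := by
        rw [mul_right_comm, mul_one_div_cancel hα.ne', one_mul, Real.exp_neg, Real.exp_log hKp,
          one_div]

lemma stepAlpha_le_of_burnIn_lt (hc : 1 ≤ cα * Real.log K) (hK : 1 ≤ K) {k : ℕ}
    (hk : burnIn cα K < k) : stepAlpha cα K k ≤ cα * Real.log K * burnInRatio cα / K := by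
  have : (0 : ℝ) < K := by exact_mod_cast hK
  have hM := burnInRatio_pos cα
  have hKk : (K : ℝ) / burnInRatio cα ≤ k := (Nat.le_ceil _).trans (by exact_mod_cast hk.le)
  calc stepAlpha cα K k ≤ cα * Real.log K / k := stepAlpha_le_div hc (by lia)
    _ ≤ cα * Real.log K / (K / burnInRatio cα) := by gcongr
    _ = cα * Real.log K * burnInRatio cα / K := by rw [div_div_eq_mul_div]

section stepEta
variable {m S : ℕ} {A : Fin m → ℕ} (G : Game m S A)

lemma stepEta_pos (hc : 1 ≤ cα * Real.log K) (hlog : 0 < Real.log K) (hL : 0 < G.effHorizon)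
    {k : ℕ} (hk : 1 ≤ k) : 0 < G.stepEta cα K k :=
  Real.sqrt_pos.2 (div_pos hlog (mul_pos (stepAlpha_pos hc hk) hL))

lemma one_sub_mul_stepEta_le (hc : 1 ≤ cα * Real.log K) (hlog : 0 < Real.log K)
    (hL : 0 < G.effHorizon) {k : ℕ} (hk : 1 ≤ k) :
    (1 - stepAlpha cα K k) * G.stepEta cα K (k + 1) ≤ G.stepEta cα K k := by
  obtain ⟨n, rfl⟩ : ∃ n, k = n + 1 := ⟨k - 1, by lia⟩
  have hα := (stepAlpha_pos hc (show 1 ≤ n + 1 + 1 by lia)).le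
  rw [Game.stepEta, Game.stepEta]
  refine Real.le_sqrt_of_sq_le ?_
  rw [mul_pow, Real.sq_sqrt (div_nonneg hlog.le (mul_nonneg hα hL.le))]
  simp only [stepAlpha, Nat.cast_add_one, add_sub_cancel_right]
  set c := cα * Real.log K
  have : (0 : ℝ) ≤ n := n.cast_nonneg
  have : 0 < n + c := by linarith
  calc (1 - c / (n + c)) ^ 2 * (Real.log K / (c / (n + 1 + c) * G.effHorizon))
      = Real.log K / (c * G.effHorizon) * (n ^ 2 * (n + 1 + c) / (n + c) ^ 2) := by
        field_simp; ring
    _ ≤ Real.log K / (c * G.effHorizon) * (n + c) := by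
        gcongr
        rw [div_le_iff₀ (by positivity)]
        have hcubic : 0 ≤ n * c ^ 2 + c ^ 3 := by positivity
        nlinarith [mul_nonneg (sq_nonneg (n : ℝ)) (show 0 ≤ 2 * c - 1 by linarith)]
    _ = Real.log K / (c / (n + c) * G.effHorizon) := by field_simp

lemma stepEta_mul_stepAlpha {k : ℕ} (hα : 0 < stepAlpha cα K k) :
    G.stepEta cα K k * stepAlpha cα K k
      = Real.sqrt (stepAlpha cα K k * Real.log K / G.effHorizon) := by
  conv_lhs => rhs; rw [← Real.sqrt_sq hα.le]
  rw [Game.stepEta, ← Real.sqrt_mul' _ (sq_nonneg _)]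
  congr 1
  field_simp

lemma stepEta_mul_div_le (hα : 0 < cα) (hc : 1 ≤ cα * Real.log K) (hK : 1 ≤ K)
    (hL : 0 < G.effHorizon) (hcK : cα * Real.log K * burnInRatio cα ≤ K / 2) {ι : ℝ}
    (hlog : 0 ≤ Real.log K) (hι : Real.log K ≤ ι) (hι2 : 1 / 2 ≤ ι) {k : ℕ}
    (hk : burnIn cα K < k) :
    G.stepEta cα K k * stepAlpha cα K k / (1 - stepAlpha cα K k)
      ≤ 4 * Real.sqrt (cα * burnInRatio cα) * Real.sqrt (ι ^ 3 / (K * G.effHorizon)) := by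
  have hKp : (0 : ℝ) < K := by exact_mod_cast hK
  have hM := burnInRatio_pos cα
  have hap := stepAlpha_pos hc (show 1 ≤ k by lia)
  have ha := stepAlpha_le_of_burnIn_lt hc hK hk
  have ha2 : stepAlpha cα K k ≤ 1 / 2 := ha.trans ((div_le_iff₀ hKp).2 (by linarith))
  have hsq : Real.log K ^ 2 ≤ 2 ^ 2 * ι ^ 3 := by
    nlinarith [sq_nonneg ι, pow_le_pow_left₀ hlog hι 2]
  have hinside : stepAlpha cα K k * Real.log K / G.effHorizon
      ≤ 2 ^ 2 * (cα * burnInRatio cα * (ι ^ 3 / (K * G.effHorizon))) :=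
    calc stepAlpha cα K k * Real.log K / G.effHorizon
        ≤ cα * Real.log K * burnInRatio cα / K * Real.log K / G.effHorizon := by gcongr
      _ = cα * burnInRatio cα / (K * G.effHorizon) * Real.log K ^ 2 := by field_simp
      _ ≤ cα * burnInRatio cα / (K * G.effHorizon) * (2 ^ 2 * ι ^ 3) := by gcongr
      _ = 2 ^ 2 * (cα * burnInRatio cα * (ι ^ 3 / (K * G.effHorizon))) := by field_simp
  have hsqrt := Real.sqrt_le_sqrt hinside
  rw [Real.sqrt_mul (by norm_num), Real.sqrt_sq (by norm_num), Real.sqrt_mul (by positivity)]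
    at hsqrt
  rw [div_le_iff₀ (by linarith), stepEta_mul_stepAlpha G hap]
  nlinarith [Real.sqrt_nonneg (stepAlpha cα K k * Real.log K / G.effHorizon)]

lemma sqrt_div_le_stepEta_succ (hα : 0 < cα) (hlog : 0 < Real.log K) (hL : 0 < G.effHorizon) :
    Real.sqrt (K / (cα * G.effHorizon)) ≤ G.stepEta cα K (K + 1) := by
  have hc := mul_pos hα hlog
  have : (0 : ℝ) < K + cα * Real.log K := by positivity
  refine Real.sqrt_le_sqrt ?_
  calc (K : ℝ) / (cα * G.effHorizon) ≤ (K + cα * Real.log K) / (cα * G.effHorizon) := by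
        gcongr; linarith
    _ = Real.log K / (stepAlpha cα K (K + 1) * G.effHorizon) := by
        rw [stepAlpha, Nat.cast_add_one, add_sub_cancel_right]
        field_simp

lemma le_two_mul_sqrt_pow_three {ι : ℝ} (hι : 1 / 2 ≤ ι) : ι ≤ 2 * Real.sqrt (ι ^ 3) := by
  have h : ι / 2 ≤ Real.sqrt (ι ^ 3) := Real.le_sqrt_of_sq_le (by nlinarith [sq_nonneg ι])
  linarith

lemma log_div_stepEta_le (hα : 0 < cα) (hK : 1 ≤ K) (hlog : 0 < Real.log K)
    (hL : 0 < G.effHorizon) {ι : ℝ} (hι : 1 / 2 ≤ ι) :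
    ι / G.stepEta cα K (K + 1)
      ≤ 2 * Real.sqrt cα * (Real.sqrt (ι ^ 3 / (K * G.effHorizon)) * G.effHorizon) := by
  have : (0 : ℝ) < K := by exact_mod_cast hK
  have hη := sqrt_div_le_stepEta_succ G hα hlog hL
  have hsqrt : Real.sqrt cα * Real.sqrt (ι ^ 3 / (K * G.effHorizon))
      * Real.sqrt (K / (cα * G.effHorizon)) = Real.sqrt (ι ^ 3) / G.effHorizon := by
    rw [← Real.sqrt_mul hα.le, ← Real.sqrt_mul (by positivity), ← Real.sqrt_sq hL.le,
      ← Real.sqrt_div' _ (sq_nonneg _), Real.sqrt_sq hL.le]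
    congr 1
    field_simp
  rw [div_le_iff₀ ((Real.sqrt_pos.2 (by positivity)).trans_le hη)]
  calc ι ≤ 2 * Real.sqrt (ι ^ 3) := le_two_mul_sqrt_pow_three hι
    _ = 2 * G.effHorizon * (Real.sqrt (ι ^ 3) / G.effHorizon) := by field_simp
    _ = 2 * Real.sqrt cα * (Real.sqrt (ι ^ 3 / (K * G.effHorizon)) * G.effHorizon)
          * Real.sqrt (K / (cα * G.effHorizon)) := by rw [← hsqrt]; ring
    _ ≤ _ := mul_le_mul_of_nonneg_left hη (by positivity)

end stepEta

end stepSizes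

/-! ### Robust values through discounted games -/

section values
variable {m S : ℕ} {A : Fin m → ℕ} (G : Game m S A)

/-- The reward of player `i` plus the discounted nominal expectation of `W` at the next state. The
contamination of the nominal kernel only contributes a constant on top of this gain. -/
def Game.discGain (i : Fin m) (h : ℕ) (s : Fin S) (W : Fin S → ℝ) (a : Joint A) : ℝ :=
  G.r i h s a + (1 - G.R) * mean (G.P0 h s a) W

/-- The discounted value of player `i` with `n` steps to go when all players follow `π`. -/
def Game.policyDisc (G : Game m S A) (π : Profile S A) (i : Fin m) : ℕ → Fin S → ℝ
  | 0, _ => 0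
  | n + 1, s => prodMean (fun j => π j (G.H - n) s)
      (G.discGain i (G.H - n) s (G.policyDisc π i n))

/-- The optimal discounted value of player `i` with `n` steps to go when the other players
follow `π`. -/
def Game.bestDisc (G : Game m S A) (π : Profile S A) (i : Fin m) : ℕ → Fin S → ℝ
  | 0, _ => 0
  | n + 1, s => ⨆ ai : Fin (A i),
      prodMean (Function.update (fun j => π j (G.H - n) s) i (Pi.single ai 1))
        (G.discGain i (G.H - n) s (G.bestDisc π i n))

/-- The robust value functions belonging to discounted value functions `W`, indexed by the number
of steps to go: at each step the contamination moves the game to a worst next state. -/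
def Game.robustLift (W : ℕ → Fin S → ℝ) (n : ℕ) (s : Fin S) : ℝ :=
  W n s + G.R * ∑ j ∈ range n, ⨅ s', W j s'

/-- A family of joint action weights is a Markov policy on the steps `1, …, H`. -/
def Game.IsPolicy (π : ℕ → Fin S → Joint A → ℝ) : Prop :=
  ∀ h ∈ Icc 1 G.H, ∀ s, π h s ∈ stdSimplex ℝ (Joint A)

/-- The components of `π` are distributions at the steps `1, …, H`. -/
def Game.IsProfile (π : Profile S A) : Prop :=
  ∀ i, ∀ h ∈ Icc 1 G.H, ∀ s, π i h s ∈ stdSimplex ℝ (Fin (A i))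

variable {G}

lemma Game.sub_mem_Icc {n : ℕ} (hn : n < G.H) : G.H - n ∈ Icc 1 G.H :=
  mem_Icc.2 ⟨by lia, by lia⟩

lemma Game.discGain_mono (hR1 : G.R ≤ 1) (i : Fin m) (h : ℕ) (s : Fin S) {W W' : Fin S → ℝ}
    (hW : ∀ s, W s ≤ W' s) (a : Joint A) : G.discGain i h s W a ≤ G.discGain i h s W' a :=
  add_le_add le_rfl (mul_le_mul_of_nonneg_left (mean_mono _ hW) (by linarith))

lemma finite_iInf_le (W : Fin S → ℝ) (s : Fin S) : ⨅ s', W s' ≤ W s :=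
  ciInf_le (Set.finite_range W).bddBelow s

lemma Game.uncertaintySet_nonempty : Nonempty G.uncertaintySet :=
  ⟨⟨G.P0, fun h s a => ⟨G.P0 h s a, fun s' => by ring⟩⟩⟩

lemma Game.IsProfile.isPolicy {π : Profile S A} (hπ : G.IsProfile π) :
    G.IsPolicy (prodPolicy π) := fun h hh s =>
  ⟨fun _ => prod_nonneg fun i _ => (hπ i h hh s).1 _, by
    simp only [prodPolicy]
    rw [← Fintype.prod_sum (fun i a => π i h s a)]
    exact prod_eq_one fun i _ => (hπ i h hh s).2⟩

lemma Game.IsProfile.update {π : Profile S A} (hπ : G.IsProfile π) (i : Fin m)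
    (π' : ℕ → Fin S → stdSimplex ℝ (Fin (A i))) :
    G.IsProfile (Function.update π i fun t x a => π' t x a) := by
  intro j h hh s
  rcases eq_or_ne j i with rfl | hj
  · rw [Function.update_self]
    exact (π' h s).2
  · rw [Function.update_of_ne hj]
    exact hπ j h hh s

lemma prodPolicy_update (π : Profile S A) (i : Fin m) (ν : ℕ → Fin S → Fin (A i) → ℝ) (h : ℕ)
    (s : Fin S) (a : Joint A) :
    prodPolicy (Function.update π i ν) h s a
      = ∏ j, Function.update (fun j => π j h s) i (ν h s) j (a j) := by
  refine prod_congr rfl fun j _ => ?_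
  rcases eq_or_ne j i with rfl | hj
  · simp only [Function.update_self]
  · simp only [Function.update_of_ne hj]

lemma Game.expReturn_succ_eq {π : ℕ → Fin S → Joint A → ℝ} {h : ℕ} {s : Fin S}
    (hπ : π h s ∈ stdSimplex ℝ (Joint A)) (P : TransKernel S A) (ρ : Joint A → ℝ)
    (V : Fin S → ℝ) (g : ℝ) :
    ∑ a, π h s a * ∑ s', P h s a s' * (g + ρ a + V s')
      = g + ∑ a, π h s a * (ρ a + mean (P h s a) V) := by
  have hmean : ∀ a, ∑ s', P h s a s' * (g + ρ a + V s') = g + (ρ a + mean (P h s a) V) :=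
    fun a => by
      rw [← add_assoc]
      exact (mean_add (P h s a) (fun _ => g + ρ a) V).trans (by rw [mean_const])
  have hadd := mean_add ⟨π h s, hπ⟩ (fun _ => g) fun a => ρ a + mean (P h s a) V
  rw [mean_const] at hadd
  simp only [hmean]
  exact hadd

lemma Game.le_expReturn {π : ℕ → Fin S → Joint A → ℝ} (hπ : G.IsPolicy π) (P : TransKernel S A)
    (i : Fin m) {V : ℕ → Fin S → ℝ} (hV0 : ∀ s, V 0 s ≤ 0)
    (hV : ∀ n < G.H, ∀ s, V (n + 1) s ≤
      ∑ a, π (G.H - n) s a * (G.r i (G.H - n) s a + mean (P (G.H - n) s a) (V n)))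
    {n : ℕ} (hn : n ≤ G.H) (s : Fin S) (g : ℝ) : g + V n s ≤ G.expReturn π P i n s g := by
  induction n generalizing s g with
  | zero =>
    rw [Game.expReturn]
    linarith [hV0 s]
  | succ n ih =>
    have hp := hπ _ (Game.sub_mem_Icc hn) s
    calc g + V (n + 1) s ≤ _ := add_le_add le_rfl (hV n hn s)
      _ = _ := (Game.expReturn_succ_eq hp P _ _ g).symm
      _ ≤ G.expReturn π P i (n + 1) s g :=
        sum_le_sum fun a _ => mul_le_mul_of_nonneg_left
          (mean_mono (P (G.H - n) s a) fun s' => ih (by lia) s' _) (hp.1 a)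

lemma Game.expReturn_le {π : ℕ → Fin S → Joint A → ℝ} (hπ : G.IsPolicy π) (P : TransKernel S A)
    (i : Fin m) {V : ℕ → Fin S → ℝ} (hV0 : ∀ s, 0 ≤ V 0 s)
    (hV : ∀ n < G.H, ∀ s,
      ∑ a, π (G.H - n) s a * (G.r i (G.H - n) s a + mean (P (G.H - n) s a) (V n)) ≤ V (n + 1) s)
    {n : ℕ} (hn : n ≤ G.H) (s : Fin S) (g : ℝ) : G.expReturn π P i n s g ≤ g + V n s := by
  induction n generalizing s g with
  | zero =>
    rw [Game.expReturn]
    linarith [hV0 s]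
  | succ n ih =>
    have hp := hπ _ (Game.sub_mem_Icc hn) s
    calc G.expReturn π P i (n + 1) s g ≤ _ :=
        sum_le_sum fun a _ => mul_le_mul_of_nonneg_left
          (mean_mono (P (G.H - n) s a) fun s' => ih (by lia) s' _) (hp.1 a)
      _ = _ := Game.expReturn_succ_eq hp P _ _ g
      _ ≤ g + V (n + 1) s := add_le_add le_rfl (hV n hn s)

lemma Game.robustLift_succ_eq_sum {p : Joint A → ℝ} (hp : p ∈ stdSimplex ℝ (Joint A)) (i : Fin m)
    (h : ℕ) (s : Fin S) (W : ℕ → Fin S → ℝ) (n : ℕ) :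
    ∑ a, p a * G.discGain i h s (W n) a + G.R * ∑ j ∈ range (n + 1), ⨅ s', W j s'
      = ∑ a, p a * (G.discGain i h s (W n) a + G.R * (⨅ s', W n s')
          + G.R * ∑ j ∈ range n, ⨅ s', W j s') := by
  have hadd := mean_add ⟨p, hp⟩ (G.discGain i h s (W n))
    fun _ => G.R * (⨅ s', W n s') + G.R * ∑ j ∈ range n, ⨅ s', W j s'
  rw [mean_const] at hadd
  simp only [sum_range_succ, add_assoc]
  refine Eq.trans ?_ hadd.symm
  rw [mean]
  ring!

lemma Game.mean_robustLift (q : stdSimplex ℝ (Fin S)) (W : ℕ → Fin S → ℝ) (n : ℕ) :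
    mean q (G.robustLift W n) = mean q (W n) + G.R * ∑ j ∈ range n, ⨅ s', W j s' := by
  exact (mean_add q (W n) fun _ => _).trans (by rw [mean_const])

lemma Game.discGain_add_iInf_le (hR0 : 0 ≤ G.R) {P : TransKernel S A} (hP : P ∈ G.uncertaintySet)
    (i : Fin m) (h : ℕ) (s : Fin S) (a : Joint A) (W : Fin S → ℝ) :
    G.discGain i h s W a + G.R * ⨅ s', W s' ≤ G.r i h s a + mean (P h s a) W := by
  obtain ⟨P', hP'⟩ := hP h s a
  have hmean : mean (P h s a) W = (1 - G.R) * mean (G.P0 h s a) W + G.R * mean P' W := by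
    simp only [mean, hP', mul_sum, ← sum_add_distrib]
    exact sum_congr rfl fun s' _ => by ring
  have hworst := mul_le_mul_of_nonneg_left (le_mean P' W (finite_iInf_le W)) hR0
  rw [hmean, Game.discGain]
  linarith

lemma Game.robustLift_le_value (hR0 : 0 ≤ G.R) {π : ℕ → Fin S → Joint A → ℝ} (hπ : G.IsPolicy π)
    (i : Fin m) {W : ℕ → Fin S → ℝ} (hW0 : ∀ s, W 0 s = 0)
    (hW : ∀ n < G.H, ∀ s, W (n + 1) s ≤ ∑ a, π (G.H - n) s a * G.discGain i (G.H - n) s (W n) a)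
    {P : TransKernel S A} (hP : P ∈ G.uncertaintySet) (s : Fin S) :
    G.robustLift W G.H s ≤ G.value π P i 1 s := by
  rw [Game.value, Nat.add_sub_cancel, ← zero_add (G.robustLift W G.H s)]
  refine Game.le_expReturn hπ P i (by simp [Game.robustLift, hW0]) (fun n hn s => ?_) le_rfl s 0
  have hp := hπ _ (Game.sub_mem_Icc hn) s
  refine (add_le_add (hW n hn s) le_rfl).trans ?_
  rw [Game.robustLift_succ_eq_sum hp]
  refine sum_le_sum fun a _ => mul_le_mul_of_nonneg_left ?_ (hp.1 a)
  rw [Game.mean_robustLift]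
  linarith [Game.discGain_add_iInf_le hR0 hP i (G.H - n) s a (W n)]

lemma Game.robustLift_policyDisc_le_value (hR0 : 0 ≤ G.R) {π : Profile S A} (hπ : G.IsProfile π)
    (i : Fin m) (s : Fin S) {P : TransKernel S A} (hP : P ∈ G.uncertaintySet) :
    G.robustLift (G.policyDisc π i) G.H s ≤ G.value (prodPolicy π) P i 1 s :=
  Game.robustLift_le_value hR0 hπ.isPolicy i (fun _ => rfl) (fun _ _ _ => le_rfl) hP s

lemma Game.robustLift_policyDisc_le (hR0 : 0 ≤ G.R) {π : Profile S A} (hπ : G.IsProfile π)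
    (i : Fin m) (s : Fin S) :
    G.robustLift (G.policyDisc π i) G.H s ≤ G.robustValue (prodPolicy π) i 1 s :=
  have := G.uncertaintySet_nonempty
  le_ciInf fun P => Game.robustLift_policyDisc_le_value hR0 hπ i s P.2

lemma Game.prodMean_le_bestDisc (π : Profile S A) (i : Fin m) (n : ℕ) (s : Fin S)
    {ν : Fin (A i) → ℝ} (hν : ν ∈ stdSimplex ℝ (Fin (A i))) :
    prodMean (Function.update (fun j => π j (G.H - n) s) i ν)
      (G.discGain i (G.H - n) s (G.bestDisc π i n)) ≤ G.bestDisc π i (n + 1) s := by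
  rw [prodMean_update_eq_sum]
  exact mean_le ⟨ν, hν⟩ _ fun a => le_ciSup (f := fun ai : Fin (A i) =>
    prodMean (Function.update (fun j => π j (G.H - n) s) i (Pi.single ai 1))
      (G.discGain i (G.H - n) s (G.bestDisc π i n))) (Set.finite_range _).bddAbove a

lemma Game.policyDisc_le_bestDisc (hR1 : G.R ≤ 1) {π : Profile S A} (hπ : G.IsProfile π)
    (i : Fin m) {n : ℕ} (hn : n ≤ G.H) (s : Fin S) :
    G.policyDisc π i n s ≤ G.bestDisc π i n s := by
  induction n generalizing s with
  | zero => rfl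
  | succ n ih =>
    have hmem := Game.sub_mem_Icc hn
    refine le_trans ?_ (G.prodMean_le_bestDisc π i n s (hπ i (G.H - n) hmem s))
    rw [Function.update_eq_self i (fun j => π j (G.H - n) s)]
    exact prodMean_mono _ (fun j => (hπ j _ hmem s).1)
      (Game.discGain_mono hR1 i _ s fun s => ih (by lia) s)

variable [NeZero S]

lemma exists_eq_finite_iInf (W : Fin S → ℝ) : ∃ s, W s = ⨅ s', W s' :=
  exists_eq_ciInf_of_finite

lemma Game.exists_uncertaintySet_mean_eq (hR0 : 0 ≤ G.R) (hR1 : G.R ≤ 1) (W : ℕ → Fin S → ℝ) :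
    ∃ P ∈ G.uncertaintySet, ∀ h s a,
      mean (P h s a) (W (G.H - h))
        = (1 - G.R) * mean (G.P0 h s a) (W (G.H - h)) + G.R * ⨅ s', W (G.H - h) s' := by
  have hworst : ∀ n, ∃ q : stdSimplex ℝ (Fin S), mean q (W n) = ⨅ s', W n s' := fun n => by
    obtain ⟨t, ht⟩ := exists_eq_finite_iInf (W n)
    refine ⟨⟨Pi.single t 1, single_mem_stdSimplex ℝ t⟩, ?_⟩
    rw [← ht]
    exact (Fintype.sum_eq_single t fun s' hs' => by simp [hs']).trans (by simp)
  choose q hq using hworst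
  have hrow : ∀ h s a, ∃ p : stdSimplex ℝ (Fin S),
      ∀ s', p s' = (1 - G.R) * G.P0 h s a s' + G.R * q (G.H - h) s' := fun h s a =>
    ⟨⟨_, convex_stdSimplex ℝ _ (G.P0 h s a).2 (q (G.H - h)).2 (by linarith) hR0 (by ring)⟩,
      fun _ => rfl⟩
  choose P hP using hrow
  refine ⟨P, fun h s a => ⟨q (G.H - h), hP h s a⟩, fun h s a => ?_⟩
  rw [← hq]
  simp only [mean, hP, mul_sum, ← sum_add_distrib]
  exact sum_congr rfl fun s' _ => by ring

lemma Game.exists_value_le_robustLift (hR0 : 0 ≤ G.R) (hR1 : G.R ≤ 1)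
    {π : ℕ → Fin S → Joint A → ℝ} (hπ : G.IsPolicy π) (i : Fin m) {W : ℕ → Fin S → ℝ}
    (hW0 : ∀ s, W 0 s = 0)
    (hW : ∀ n < G.H, ∀ s, ∑ a, π (G.H - n) s a * G.discGain i (G.H - n) s (W n) a ≤ W (n + 1) s)
    (s : Fin S) : ∃ P ∈ G.uncertaintySet, G.value π P i 1 s ≤ G.robustLift W G.H s := by
  obtain ⟨P, hP, hmean⟩ := Game.exists_uncertaintySet_mean_eq hR0 hR1 W
  refine ⟨P, hP, ?_⟩
  rw [Game.value, Nat.add_sub_cancel, ← zero_add (G.robustLift W G.H s)]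
  refine Game.expReturn_le hπ P i (by simp [Game.robustLift, hW0]) (fun n hn s => ?_) le_rfl s 0
  have hp := hπ _ (Game.sub_mem_Icc hn) s
  refine le_trans (le_of_eq ?_) (add_le_add (hW n hn s) le_rfl)
  rw [Game.robustLift_succ_eq_sum hp]
  refine sum_congr rfl fun a _ => ?_
  have hstep := hmean (G.H - n) s a
  rw [Nat.sub_sub_self hn.le] at hstep
  rw [Game.mean_robustLift, hstep, Game.discGain]
  ring

variable [∀ i, NeZero (A i)]

lemma Game.bestResponseValue_le (hR0 : 0 ≤ G.R) (hR1 : G.R ≤ 1) {π : Profile S A}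
    (hπ : G.IsProfile π) (i : Fin m) (s : Fin S) :
    G.bestResponseValue π i 1 s ≤ G.robustLift (G.bestDisc π i) G.H s := by
  have : Nonempty (stdSimplex ℝ (Fin (A i))) := ⟨⟨_, single_mem_stdSimplex ℝ (0 : Fin (A i))⟩⟩
  refine ciSup_le fun π' => ?_
  have hprof := hπ.update i π'
  obtain ⟨P, hP, hval⟩ := Game.exists_value_le_robustLift hR0 hR1 hprof.isPolicy i
    (fun _ => rfl) (fun n _ s => by
      simpa only [prodPolicy_update] using! G.prodMean_le_bestDisc π i n s (π' (G.H - n) s).2) s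
  refine (ciInf_le ⟨G.robustLift
    (G.policyDisc (Function.update π i fun t x a => π' t x a) i) G.H s, ?_⟩ ⟨P, hP⟩).trans hval
  rintro _ ⟨P, rfl⟩
  exact Game.robustLift_policyDisc_le_value hR0 hprof i s P.2

end values

section zeroSum
variable {S : ℕ} {A : Fin 2 → ℕ} {G : Game 2 S A}

lemma Game.IsZeroSum.discGain_add (hG : G.IsZeroSum) {h : ℕ} (hh : h ∈ Icc 1 G.H) (s : Fin S)
    (W W' : Fin S → ℝ) (a : Joint A) :
    G.discGain 0 h s W a + G.discGain 1 h s W' a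
      = (1 - G.R) * mean (G.P0 h s a) fun s' => W s' + W' s' := by
  rw [mean_add, Game.discGain, Game.discGain, (hG h hh s a).2]
  ring

lemma Game.IsZeroSum.policyDisc_add (hG : G.IsZeroSum) (π : Profile S A) {n : ℕ} (hn : n ≤ G.H)
    (s : Fin S) : G.policyDisc π 0 n s + G.policyDisc π 1 n s = 0 := by
  induction n generalizing s with
  | zero => simp [Game.policyDisc]
  | succ n ih =>
    rw [Game.policyDisc, Game.policyDisc, ← prodMean_add]
    refine sum_eq_zero fun a _ => mul_eq_zero_of_right _ ?_
    refine (hG.discGain_add (Game.sub_mem_Icc hn) s _ _ a).trans ?_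
    simp only [ih (Nat.le_of_succ_le hn), mean_const, mul_zero]

lemma Game.IsZeroSum.bestDisc_sub_policyDisc_le (hG : G.IsZeroSum) (hR1 : G.R ≤ 1)
    {π : Profile S A} (hπ : G.IsProfile π) (i : Fin 2) {n : ℕ} (hn : n ≤ G.H) (s : Fin S) :
    G.bestDisc π i n s - G.policyDisc π i n s ≤ G.bestDisc π 0 n s + G.bestDisc π 1 n s := by
  have h0 := Game.policyDisc_le_bestDisc hR1 hπ 0 hn s
  have h1 := Game.policyDisc_le_bestDisc hR1 hπ 1 hn s
  have hzero := hG.policyDisc_add π hn s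
  fin_cases i <;> simp only [Fin.zero_eta, Fin.mk_one] <;> linarith

lemma finite_iInf_le_iInf_add {S : ℕ} [NeZero S] {V W : Fin S → ℝ} {e : ℝ}
    (h : ∀ s, V s - W s ≤ e) : ⨅ s, V s ≤ (⨅ s, W s) + e := by
  obtain ⟨t, ht⟩ := exists_eq_finite_iInf W
  linarith [finite_iInf_le V t, h t]

lemma Game.robustLift_sub_le {m S : ℕ} [NeZero S] {A : Fin m → ℕ} {G : Game m S A}
    (hR0 : 0 ≤ G.R) {V W : ℕ → Fin S → ℝ} {e : ℕ → ℝ} {n : ℕ}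
    (h : ∀ j ≤ n, ∀ s, V j s - W j s ≤ e j) (s : Fin S) :
    G.robustLift V n s - G.robustLift W n s ≤ e n + G.R * ∑ j ∈ range n, e j := by
  have hsum : ∑ j ∈ range n, ⨅ s', V j s' ≤ ∑ j ∈ range n, ((⨅ s', W j s') + e j) :=
    sum_le_sum fun j hj => finite_iInf_le_iInf_add (h j (mem_range.1 hj).le)
  rw [sum_add_distrib] at hsum
  rw [Game.robustLift, Game.robustLift]
  linarith [mul_le_mul_of_nonneg_left hsum hR0, h n le_rfl s]

variable [NeZero S] [∀ i, NeZero (A i)]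

lemma Game.IsZeroSum.gapNE_le (hG : G.IsZeroSum) (hR0 : 0 ≤ G.R) (hR1 : G.R ≤ 1)
    {π : Profile S A} (hπ : G.IsProfile π) (e : ℕ → ℝ)
    (he : ∀ n ≤ G.H, ∀ s, G.bestDisc π 0 n s + G.bestDisc π 1 n s ≤ e n) :
    G.gapNE π ≤ e G.H + G.R * ∑ j ∈ range G.H, e j :=
  ciSup_le fun s => ciSup_le fun i =>
    (sub_le_sub (Game.bestResponseValue_le hR0 hR1 hπ i s)
      (Game.robustLift_policyDisc_le hR0 hπ i s)).trans
      (Game.robustLift_sub_le hR0 (fun n hn s =>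
        (hG.bestDisc_sub_policyDisc_le hR1 hπ i hn s).trans (he n hn s)) s)

end zeroSum

/-! ### Concentration of the data of one step -/

section concentration
variable {m S : ℕ} {A : Fin m → ℕ} (G : Game m S A)

/-- The excess of a value function over its minimum. -/
def excess (V : Fin m → Fin S → ℝ) (i : Fin m) (s : Fin S) : ℝ := V i s - ⨅ s', V i s'

lemma excess_nonneg (V : Fin m → Fin S → ℝ) (i : Fin m) (s : Fin S) : 0 ≤ excess V i s :=
  sub_nonneg.2 (finite_iInf_le _ s)

/-- The sampled gain of player `i` at step `h`, without the part `min V` that all samples share. -/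
def Game.centredGain (h : ℕ) (V : Fin m → Fin S → ℝ) (i : Fin m) (s : Fin S)
    (z : Joint A × Fin S) : ℝ :=
  G.r i h s z.1 + (1 - G.R) * excess V i z.2

/-- The expectation of a function `φ` of the centred gain when the actions have the product
law `μ`. -/
def Game.gainMean (h : ℕ) (V : Fin m → Fin S → ℝ) (i : Fin m) (s : Fin S) (φ : ℝ → ℝ)
    (μ : (j : Fin m) → Fin (A j) → ℝ) : ℝ :=
  prodMean μ fun a => mean (G.P0 h s a) fun s' => φ (G.centredGain h V i s (a, s'))

/-- The variance of the centred gain when the actions have the product law `μ`. -/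
def Game.gainVar (h : ℕ) (V : Fin m → Fin S → ℝ) (i : Fin m) (s : Fin S)
    (μ : (j : Fin m) → Fin (A j) → ℝ) : ℝ :=
  G.gainMean h V i s (· ^ 2) μ - G.gainMean h V i s id μ ^ 2

variable {G}

lemma Game.qHat_eq (h : ℕ) (V : Fin m → Fin S → ℝ) (x : Sample S A) (i : Fin m) (s : Fin S)
    (ai : Fin (A i)) :
    G.qHat h V x i s ai = G.centredGain h V i s (x i s ai) + ⨅ s', V i s' := by
  simp only [Game.qHat, Game.centredGain, excess]; ring

lemma Game.gainMean_eq_sum (h : ℕ) (V : Fin m → Fin S → ℝ) (i : Fin m) (s : Fin S) (φ : ℝ → ℝ)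
    (μ : (j : Fin m) → Fin (A j) → ℝ) :
    G.gainMean h V i s φ μ
      = ∑ a, μ i a * G.gainMean h V i s φ (Function.update μ i (Pi.single a 1)) :=
  prodMean_eq_sum μ i _

lemma Game.gainMean_le {h : ℕ} {V : Fin m → Fin S → ℝ} {hi : ℝ} {i : Fin m} {s : Fin S}
    {μ : (j : Fin m) → Fin (A j) → ℝ} (hμ : ∀ j, μ j ∈ stdSimplex ℝ (Fin (A j)))
    (hhi : ∀ z, G.centredGain h V i s z ≤ hi) : G.gainMean h V i s id μ ≤ hi :=
  prodMean_le hμ fun a => mean_le (G.P0 h s a) _ fun _ => hhi _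

lemma Game.le_gainMean {h : ℕ} {V : Fin m → Fin S → ℝ} {lo : ℝ} {i : Fin m} {s : Fin S}
    {μ : (j : Fin m) → Fin (A j) → ℝ} (hμ : ∀ j, μ j ∈ stdSimplex ℝ (Fin (A j)))
    (hlo : ∀ z, lo ≤ G.centredGain h V i s z) : lo ≤ G.gainMean h V i s id μ :=
  le_prodMean hμ fun a => le_mean (G.P0 h s a) _ fun _ => hlo _

section sampleLaw
variable (h : ℕ) (V : Fin m → Fin S → ℝ) (p : (i : Fin m) → Fin S → stdSimplex ℝ (Fin (A i)))
  (i : Fin m) (s : Fin S)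

lemma Game.rexp_sampleLaw (ai : Fin (A i)) (f : Joint A × Fin S → ℝ) :
    rexp (G.sampleLaw h p) (fun y => f (y i s ai))
      = prodMean (Function.update (fun j => ⇑(p j s)) i (Pi.single ai 1))
          fun a => mean (G.P0 h s a) fun s' => f (a, s') := by
  refine (rexp_indepPMF_apply (X := fun i : Fin m => Fin S → Fin (A i) → Joint A × Fin S) _ i
    (fun z => f (z s ai))).trans ?_
  refine (rexp_indepPMF_apply (X := fun _ : Fin S => Fin (A i) → Joint A × Fin S) _ s
    (fun z => f (z ai))).trans ?_
  refine (rexp_indepPMF_apply (X := fun _ : Fin (A i) => Joint A × Fin S) _ ai f).trans ?_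
  rw [rexp_bind, rexp_indepPMF]
  simp only [rexp_map, rexp_simplexPMF]
  congr 1
  funext j a
  rcases eq_or_ne j i with rfl | hj
  · simp only [Function.update_self, PMF.pure_apply, Pi.single_apply]
    split_ifs <;> simp
  · simp only [Function.update_of_ne hj, simplexPMF_toReal]

lemma Game.rexp_gain (ai : Fin (A i)) (φ : ℝ → ℝ) :
    rexp (G.sampleLaw h p) (fun y => φ (G.centredGain h V i s (y i s ai)))
      = G.gainMean h V i s φ (Function.update (fun j => ⇑(p j s)) i (Pi.single ai 1)) :=
  G.rexp_sampleLaw h p i s ai fun z => φ (G.centredGain h V i s z)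

lemma Game.rexp_mean_gain (φ : ℝ → ℝ) :
    rexp (G.sampleLaw h p) (fun y => mean (p i s) fun ai => φ (G.centredGain h V i s (y i s ai)))
      = G.gainMean h V i s φ (fun j => ⇑(p j s)) := by
  simp only [mean]
  rw [rexp_sum, G.gainMean_eq_sum]
  exact sum_congr rfl fun a _ => by rw [rexp_mul_left, Game.rexp_gain]

lemma Game.rexp_gain_sub_sq (ai : Fin (A i)) :
    rexp (G.sampleLaw h p) (fun y =>
      (G.gainMean h V i s id (Function.update (fun j => ⇑(p j s)) i (Pi.single ai 1))
        - G.centredGain h V i s (y i s ai)) ^ 2)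
      = G.gainVar h V i s (Function.update (fun j => ⇑(p j s)) i (Pi.single ai 1)) := by
  set c := G.gainMean h V i s id (Function.update (fun j => ⇑(p j s)) i (Pi.single ai 1)) with hc
  have hsq : ∀ y : Sample S A, (c - G.centredGain h V i s (y i s ai)) ^ 2
      = G.centredGain h V i s (y i s ai) ^ 2 - 2 * c * id (G.centredGain h V i s (y i s ai))
        + c ^ 2 := fun y => by rw [id]; ring
  simp only [hsq]
  rw [rexp_add, rexp_sub, rexp_mul_left, rexp_const, Game.rexp_gain h V p i s ai (· ^ 2),
    Game.rexp_gain h V p i s ai id, Game.gainVar, ← hc]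
  ring

lemma Game.rexp_mean_gain_sub_sq :
    rexp (G.sampleLaw h p) (fun y => mean (p i s) fun ai => (G.centredGain h V i s (y i s ai)
      - G.gainMean h V i s id (fun j => ⇑(p j s))) ^ 2)
      = G.gainVar h V i s (fun j => ⇑(p j s)) := by
  set c := G.gainMean h V i s id (fun j => ⇑(p j s)) with hc
  have hmean : rexp (G.sampleLaw h p)
      (fun y => mean (p i s) fun ai => G.centredGain h V i s (y i s ai)) = c :=
    Game.rexp_mean_gain h V p i s id
  simp only [mean_sub_sq]
  rw [rexp_add, rexp_sub, rexp_mul_left, rexp_const, Game.rexp_mean_gain h V p i s (· ^ 2), hmean,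
    Game.gainVar, ← hc]
  ring

end sampleLaw

lemma Game.QHat_congr (cα : ℝ) (K h : ℕ) (V : Fin m → Fin S → ℝ) {x x' : ℕ → Sample S A}
    (i : Fin m) (s : Fin S) {k : ℕ} (hx : ∀ j ∈ Icc 1 k, x j = x' j) :
    G.QHat cα K h V x i s k = G.QHat cα K h V x' i s k := by
  induction k with
  | zero => rfl
  | succ k ih =>
    funext ai
    rw [Game.QHat, Game.QHat, hx (k + 1) (by simp),
      ih fun j hj => hx j (Icc_subset_Icc_right k.le_succ hj)]

variable [∀ i, NeZero (A i)]

lemma Game.iterPolicy_congr (cα : ℝ) (K h : ℕ) (V : Fin m → Fin S → ℝ) {x x' : ℕ → Sample S A}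
    {k : ℕ} (hx : ∀ j < k, x j = x' j) :
    G.iterPolicy cα K h V x k = G.iterPolicy cα K h V x' k := by
  funext i s
  rw [Game.iterPolicy, Game.iterPolicy, G.QHat_congr cα K h V i s (k := k - 1) fun j hj => hx j (by
    simp only [mem_Icc] at hj; lia)]

/-- The weights with which the players act in round `k` in state `s`. -/
def Game.roundWeights (G : Game m S A) (cα : ℝ) (K h : ℕ) (V : Fin m → Fin S → ℝ)
    (x : ℕ → Sample S A) (s : Fin S) (k : ℕ) (j : Fin m) : Fin (A j) → ℝ :=
  G.iterPolicy cα K h V x k j s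

/-- The weights of `Game.roundWeights`, except that player `i` plays the action `ai`. -/
def Game.deviationWeights (G : Game m S A) (cα : ℝ) (K h : ℕ) (V : Fin m → Fin S → ℝ)
    (x : ℕ → Sample S A) (i : Fin m) (s : Fin S) (ai : Fin (A i)) (k : ℕ) :
    (j : Fin m) → Fin (A j) → ℝ :=
  Function.update (G.roundWeights cα K h V x s k) i (Pi.single ai 1)

lemma Game.roundWeights_mem (cα : ℝ) (K h : ℕ) (V : Fin m → Fin S → ℝ) (x : ℕ → Sample S A)
    (s : Fin S) (k : ℕ) (j : Fin m) :
    G.roundWeights cα K h V x s k j ∈ stdSimplex ℝ (Fin (A j)) :=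
  (G.iterPolicy cα K h V x k j s).2

lemma Game.roundWeights_congr (cα : ℝ) (K h : ℕ) (V : Fin m → Fin S → ℝ) {x x' : ℕ → Sample S A}
    (s : Fin S) {k : ℕ} (hx : ∀ j < k, x j = x' j) :
    G.roundWeights cα K h V x s k = G.roundWeights cα K h V x' s k := by
  funext j
  rw [Game.roundWeights, Game.roundWeights, G.iterPolicy_congr cα K h V hx]

lemma Game.deviationWeights_mem (cα : ℝ) (K h : ℕ) (V : Fin m → Fin S → ℝ) (x : ℕ → Sample S A)
    (i : Fin m) (s : Fin S) (ai : Fin (A i)) (k : ℕ) (j : Fin m) :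
    G.deviationWeights cα K h V x i s ai k j ∈ stdSimplex ℝ (Fin (A j)) :=
  update_single_mem_stdSimplex (G.roundWeights_mem cα K h V x s k) i ai j

/-- The exponent controlling the estimation error of the gain of the action `ai`: `x` holds the
data of the rounds before round `k`, and `y` those of round `k`. -/
def Game.actionExponent (G : Game m S A) (cα : ℝ) (K h : ℕ) (V : Fin m → Fin S → ℝ) (t : ℝ)
    (i : Fin m) (s : Fin S) (ai : Fin (A i)) (k : ℕ) (x : ℕ → Sample S A) (y : Sample S A) : ℝ :=
  t * weightAlpha cα K k * (G.gainMean h V i s id (G.deviationWeights cα K h V x i s ai k)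
    - G.centredGain h V i s (y i s ai))
  - (t * weightAlpha cα K k) ^ 2 * G.gainVar h V i s (G.deviationWeights cα K h V x i s ai k)

/-- The exponent controlling the estimation error of the gain of the current policy, with `x` and
`y` as in `Game.actionExponent`. -/
def Game.policyExponent (G : Game m S A) (cα : ℝ) (K h : ℕ) (V : Fin m → Fin S → ℝ) (t : ℝ)
    (i : Fin m) (s : Fin S) (k : ℕ) (x : ℕ → Sample S A) (y : Sample S A) : ℝ :=
  t * weightAlpha cα K k * (mean (G.iterPolicy cα K h V x k i s)
      (fun ai => G.centredGain h V i s (y i s ai))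
    - G.gainMean h V i s id (G.roundWeights cα K h V x s k))
  - (t * weightAlpha cα K k) ^ 2 * G.gainVar h V i s (G.roundWeights cα K h V x s k)

/-- The exponent controlling the empirical variances, with `x` and `y` as in
`Game.actionExponent`. -/
def Game.varExponent (G : Game m S A) (cα : ℝ) (K h : ℕ) (V : Fin m → Fin S → ℝ) (τ : ℝ)
    (i : Fin m) (s : Fin S) (k : ℕ) (x : ℕ → Sample S A) (y : Sample S A) : ℝ :=
  τ * weightAlpha cα K k * var (G.iterPolicy cα K h V x k i s)
      (fun ai => G.centredGain h V i s (y i s ai))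
  - 2 * (τ * weightAlpha cα K k * G.gainVar h V i s (G.roundWeights cα K h V x s k))

/-- The data `x` of a step on which all empirical quantities concentrate, up to a deviation whose
probability is at most `exp (-a)` for each of them. -/
def Game.GoodData (G : Game m S A) (cα : ℝ) (K h : ℕ) (V : Fin m → Fin S → ℝ) (t τ a : ℝ)
    (x : ℕ → Sample S A) : Prop :=
  ∀ i s, (∀ ai, ∑ k ∈ Icc 1 K, G.actionExponent cα K h V t i s ai k x (x k) ≤ a) ∧
    ∑ k ∈ Icc 1 K, G.policyExponent cα K h V t i s k x (x k) ≤ a ∧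
    ∑ k ∈ Icc 1 K, G.varExponent cα K h V τ i s k x (x k) ≤ a

variable {cα : ℝ} {K h : ℕ} {V : Fin m → Fin S → ℝ} {lo D t τ : ℝ}

section exponent
variable {k : ℕ} {i : Fin m} {s : Fin S}

lemma Game.rexp_exp_actionExponent_le (hlo : ∀ z, lo ≤ G.centredGain h V i s z)
    (hhi : ∀ z, G.centredGain h V i s z ≤ lo + D) (x : ℕ → Sample S A)
    (ht : 0 ≤ t * weightAlpha cα K k)
    (htD : t * weightAlpha cα K k * D ≤ 1) (ai : Fin (A i)) :
    rexp (G.sampleLaw h (G.iterPolicy cα K h V x k))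
      (fun y => Real.exp (G.actionExponent cα K h V t i s ai k x y)) ≤ 1 := by
  refine rexp_exp_mul_sub_sq_mul_le_one _ ht htD (fun y => ?_) ?_
    (Game.rexp_gain_sub_sq h V _ i s ai).le
  · linarith [Game.gainMean_le (G.deviationWeights_mem cα K h V x i s ai k) hhi, hlo (y i s ai)]
  · rw [rexp_sub, rexp_const, sub_eq_zero]
    exact (Game.rexp_gain h V (G.iterPolicy cα K h V x k) i s ai id).symm

lemma Game.rexp_exp_policyExponent_le (hlo : ∀ z, lo ≤ G.centredGain h V i s z)
    (hhi : ∀ z, G.centredGain h V i s z ≤ lo + D) (x : ℕ → Sample S A)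
    (ht : 0 ≤ t * weightAlpha cα K k)
    (htD : t * weightAlpha cα K k * D ≤ 1) :
    rexp (G.sampleLaw h (G.iterPolicy cα K h V x k))
      (fun y => Real.exp (G.policyExponent cα K h V t i s k x y)) ≤ 1 := by
  set p := G.iterPolicy cα K h V x k
  refine rexp_exp_mul_sub_sq_mul_le_one _ ht htD (fun y => ?_) ?_ ?_
  · linarith [Game.le_gainMean (G.roundWeights_mem cα K h V x s k) hlo,
      mean_le (p i s) (fun ai => G.centredGain h V i s (y i s ai)) fun ai => hhi _]
  · rw [rexp_sub, rexp_const, sub_eq_zero]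
    exact Game.rexp_mean_gain h V p i s id
  · refine (rexp_mono _ fun y => ?_).trans (Game.rexp_mean_gain_sub_sq h V p i s).le
    refine le_trans (le_of_eq ?_) (sq_mean_le (p i s) _)
    simp only [sub_eq_add_neg]
    rw [mean_add, mean_const]
    rfl

lemma Game.rexp_exp_varExponent_le (hlo : ∀ z, lo ≤ G.centredGain h V i s z)
    (hhi : ∀ z, G.centredGain h V i s z ≤ lo + D) (x : ℕ → Sample S A)
    (hτ : 0 ≤ τ * weightAlpha cα K k)
    (hτD : τ * weightAlpha cα K k * D ^ 2 ≤ 1) :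
    rexp (G.sampleLaw h (G.iterPolicy cα K h V x k))
      (fun y => Real.exp (G.varExponent cα K h V τ i s k x y)) ≤ 1 := by
  set p := G.iterPolicy cα K h V x k
  refine rexp_exp_sub_two_mul_le_one _ (fun y => mul_nonneg hτ (var_nonneg _ _)) (fun y => ?_) ?_
  · refine (mul_le_mul_of_nonneg_left ?_ hτ).trans hτD
    refine (var_le_sub_mean_mul (p i s) _ (fun _ => hlo _) fun _ => hhi _).trans ?_
    nlinarith [mean_le (p i s) (fun ai => G.centredGain h V i s (y i s ai)) fun _ => hhi _,
      le_mean (p i s) (fun ai => G.centredGain h V i s (y i s ai)) fun _ => hlo _]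
  · rw [rexp_mul_left]
    refine mul_le_mul_of_nonneg_left ?_ hτ
    exact (rexp_mono _ fun y => var_le_mean_sub_sq _ _ _).trans
      (Game.rexp_mean_gain_sub_sq h V p i s).le

end exponent

variable [NeZero S]

lemma Game.pexp_roundsLaw_exp_le_one (z : ℕ → (ℕ → Sample S A) → Sample S A → ℝ)
    (hz : ∀ k x x', (∀ j < k, x j = x' j) → z k x = z k x') {n : ℕ}
    (hexp : ∀ k ∈ Icc 1 n, ∀ x,
      rexp (G.sampleLaw h (G.iterPolicy cα K h V x k)) (fun y => Real.exp (z k x y)) ≤ 1) :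
    pexp (G.roundsLaw cα K h V n)
      (fun x => ENNReal.ofReal (Real.exp (∑ k ∈ Icc 1 n, z k x (x k)))) ≤ 1 := by
  induction n with
  | zero => simp [pexp_const]
  | succ n ih =>
    rw [Game.roundsLaw, pexp_bind]
    refine le_trans (pexp_mono _ fun x => ?_)
      (ih fun k hk => hexp k (Icc_subset_Icc_right n.le_succ hk))
    have hsplit : ∀ y, ENNReal.ofReal (Real.exp (∑ k ∈ Icc 1 (n + 1),
          z k (Function.update x (n + 1) y) (Function.update x (n + 1) y k)))
        = ENNReal.ofReal (Real.exp (∑ k ∈ Icc 1 n, z k x (x k)))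
          * ENNReal.ofReal (Real.exp (z (n + 1) x y)) := by
      intro y
      have hpast : ∀ k ≤ n + 1, z k (Function.update x (n + 1) y) = z k x := fun k hk =>
        hz k _ _ fun j hj => Function.update_of_ne (by lia) _ _
      rw [← ENNReal.ofReal_mul (Real.exp_pos _).le, ← Real.exp_add, sum_Icc_succ_top (by lia),
        hpast (n + 1) le_rfl, Function.update_self]
      congr 3
      refine sum_congr rfl fun k hk => ?_
      have : k ≤ n := (mem_Icc.1 hk).2
      rw [hpast k (by lia), Function.update_of_ne (by lia)]
    rw [pexp_map]
    simp only [hsplit]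
    rw [pexp_mul_left, pexp_ofReal _ _ fun y => (Real.exp_pos _).le]
    exact mul_le_of_le_one_right' (ENNReal.ofReal_le_one.2 (hexp (n + 1) (by simp) x))

lemma Game.pexp_roundsLaw_indicator_le (z : ℕ → (ℕ → Sample S A) → Sample S A → ℝ)
    (hz : ∀ k x x', (∀ j < k, x j = x' j) → z k x = z k x')
    (hexp : ∀ k ∈ Icc 1 K, ∀ x,
      rexp (G.sampleLaw h (G.iterPolicy cα K h V x k)) (fun y => Real.exp (z k x y)) ≤ 1) (a : ℝ) :
    pexp (G.roundsLaw cα K h V K) ({x | a < ∑ k ∈ Icc 1 K, z k x (x k)}.indicator 1)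
      ≤ ENNReal.ofReal (Real.exp (-a)) := by
  calc _ ≤ pexp (G.roundsLaw cα K _ V K) (fun x => ENNReal.ofReal (Real.exp (-a))
        * ENNReal.ofReal (Real.exp (∑ k ∈ Icc 1 K, z k x (x k)))) := by
        refine pexp_mono _ (Set.indicator_le fun x (hx : a < _) => ?_)
        rw [← ENNReal.ofReal_mul (Real.exp_pos _).le, ← Real.exp_add]
        exact ENNReal.one_le_ofReal.2 (Real.one_le_exp (by linarith))
    _ ≤ _ := by
        rw [pexp_mul_left]
        exact mul_le_of_le_one_right' (Game.pexp_roundsLaw_exp_le_one z hz hexp)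

lemma Game.pexp_not_goodData_le (ht : ∀ k ∈ Icc 1 K, 0 ≤ t * weightAlpha cα K k)
    (hτ : ∀ k ∈ Icc 1 K, 0 ≤ τ * weightAlpha cα K k)
    (htD : ∀ k ∈ Icc 1 K, t * weightAlpha cα K k * D ≤ 1)
    (hτD : ∀ k ∈ Icc 1 K, τ * weightAlpha cα K k * D ^ 2 ≤ 1)
    (hlo : ∀ i s z, lo ≤ G.centredGain h V i s z)
    (hhi : ∀ i s z, G.centredGain h V i s z ≤ lo + D) (a : ℝ) :
    pexp (G.roundsLaw cα K h V K) ({x | ¬ G.GoodData cα K h V t τ a x}.indicator 1)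
      ≤ (∑ i, ∑ _s : Fin S, ((A i : ℝ≥0∞) + 2)) * ENNReal.ofReal (Real.exp (-a)) := by
  simp only [Game.GoodData, not_forall, not_and_or, not_le]
  rw [sum_mul]
  refine (pexp_indicator_exists_le _ _).trans (sum_le_sum fun i _ => ?_)
  rw [sum_mul]
  refine (pexp_indicator_exists_le _ _).trans (sum_le_sum fun s _ => ?_)
  rw [add_mul, two_mul]
  refine (pexp_indicator_or_le _ _ _).trans (add_le_add ?_ ((pexp_indicator_or_le _ _ _).trans
    (add_le_add ?_ ?_)))
  · refine (pexp_indicator_exists_le _ _).trans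
      ((sum_le_card_nsmul _ _ (ENNReal.ofReal (Real.exp (-a))) fun ai _ => ?_).trans ?_)
    · exact Game.pexp_roundsLaw_indicator_le (G.actionExponent cα K h V t i s ai)
        (fun k x x' hx => by
          funext y
          simp only [Game.actionExponent, Game.deviationWeights,
            G.roundWeights_congr cα K h V s hx])
        (fun k hk x => Game.rexp_exp_actionExponent_le (hlo i s) (hhi i s) x (ht k hk) (htD k hk)
          ai) a
    · rw [card_univ, Fintype.card_fin, nsmul_eq_mul]
  · exact Game.pexp_roundsLaw_indicator_le (G.policyExponent cα K h V t i s)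
      (fun k x x' hx => by
        funext y
        simp only [Game.policyExponent, G.roundWeights_congr cα K h V s hx,
          G.iterPolicy_congr cα K h V hx])
      (fun k hk x => Game.rexp_exp_policyExponent_le (hlo i s) (hhi i s) x (ht k hk) (htD k hk)) a
  · exact Game.pexp_roundsLaw_indicator_le (G.varExponent cα K h V τ i s)
      (fun k x x' hx => by
        funext y
        simp only [Game.varExponent, G.roundWeights_congr cα K h V s hx,
          G.iterPolicy_congr cα K h V hx])
      (fun k hk x => Game.rexp_exp_varExponent_le (hlo i s) (hhi i s) x (hτ k hk) (hτD k hk)) a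

end concentration

/-! ### The parameter regime -/

section regime
variable {m S : ℕ} {A : Fin m → ℕ}

/-- The logarithmic factor `log (K S (A_1 + ⋯ + A_m) / δ)`. -/
def logFactor (S : ℕ) (A : Fin m → ℕ) (δ : ℝ) (K : ℕ) : ℝ :=
  Real.log (K * S * (∑ j, (A j : ℝ)) / δ)

/-- The scale `√(log³ / (K L))` of the estimation errors. -/
def Game.errScale (G : Game m S A) (δ : ℝ) (K : ℕ) : ℝ :=
  Real.sqrt (logFactor S A δ K ^ 3 / (K * G.effHorizon))

/-- The coefficient of the quadratic potentials, in units of the error scale. It collects the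
constants of the bonus, of the regret and of the two concentration bounds. -/
def potConst (cα cb : ℝ) : ℝ := (1 + 64 * cα) * (1 + cb) + 3 * cb + 2 + 2 * Real.sqrt cα

/-- The relations between the parameters under which one step of the algorithm is analysed. -/
structure Game.Regime (G : Game m S A) (cα cb δ : ℝ) (K : ℕ) : Prop where
  cα_pos : 0 < cα
  one_le_K : 1 ≤ K
  one_le_L : 1 ≤ G.effHorizon
  one_le_step : 1 ≤ cα * Real.log K
  step_le : cα * Real.log K * burnInRatio cα ≤ K / 2
  log_K_le : Real.log K ≤ logFactor S A δ K
  log_A_le : ∀ i, Real.log (A i) ≤ logFactor S A δ K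
  half_le : 1 / 2 ≤ logFactor S A δ K
  le_cb : 4 * Real.sqrt (cα * burnInRatio cα) ≤ cb
  small : potConst cα cb * G.errScale δ K * (8 * G.effHorizon) ≤ 1

namespace Game.Regime
variable {G : Game m S A} {cα cb δ : ℝ} {K : ℕ}

lemma K_pos (hr : G.Regime cα cb δ K) : (0 : ℝ) < K := by exact_mod_cast hr.one_le_K

lemma L_pos (hr : G.Regime cα cb δ K) : 0 < G.effHorizon := one_pos.trans_le hr.one_le_L

lemma log_pos (hr : G.Regime cα cb δ K) : 0 < Real.log K :=
  pos_of_mul_pos_right (one_pos.trans_le hr.one_le_step) hr.cα_pos.le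

lemma logFactor_pos (hr : G.Regime cα cb δ K) : 0 < logFactor S A δ K :=
  one_half_pos.trans_le hr.half_le

lemma cb_nonneg (hr : G.Regime cα cb δ K) : 0 ≤ cb := le_trans (by positivity) hr.le_cb

lemma errScale_pos (hr : G.Regime cα cb δ K) : 0 < G.errScale δ K :=
  Real.sqrt_pos.2 (div_pos (pow_pos hr.logFactor_pos 3) (mul_pos hr.K_pos hr.L_pos))

lemma cb_mul_errScale_nonneg (hr : G.Regime cα cb δ K) : 0 ≤ cb * G.errScale δ K :=
  mul_nonneg hr.cb_nonneg hr.errScale_pos.le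

lemma errScale_sq (hr : G.Regime cα cb δ K) :
    G.errScale δ K ^ 2 * (K * G.effHorizon) = logFactor S A δ K ^ 3 := by
  have hKL := mul_pos hr.K_pos hr.L_pos
  rw [Game.errScale, Real.sq_sqrt (div_nonneg (pow_pos hr.logFactor_pos 3).le hKL.le),
    div_mul_cancel₀ _ hKL.ne']

lemma one_add_cb_le_potConst (hr : G.Regime cα cb δ K) : 1 + cb ≤ potConst cα cb := by
  have := hr.cb_nonneg
  have := hr.cα_pos
  rw [potConst]
  linarith [Real.sqrt_nonneg cα, show 0 ≤ 64 * cα * (1 + cb) by positivity]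

lemma one_le_potConst (hr : G.Regime cα cb δ K) : 1 ≤ potConst cα cb := by
  linarith [hr.one_add_cb_le_potConst, hr.cb_nonneg]

lemma errScale_mul_le (hr : G.Regime cα cb δ K) : G.errScale δ K * (8 * G.effHorizon) ≤ 1 := by
  refine le_trans ?_ hr.small
  rw [mul_assoc]
  exact le_mul_of_one_le_left (mul_nonneg hr.errScale_pos.le (by linarith [hr.L_pos]))
    hr.one_le_potConst

lemma cb_mul_errScale_mul_le (hr : G.Regime cα cb δ K) :
    cb * G.errScale δ K * (8 * G.effHorizon) ≤ 1 := by
  refine le_trans ?_ hr.small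
  have := hr.errScale_pos
  have := hr.L_pos
  have : cb ≤ potConst cα cb := by linarith [hr.one_add_cb_le_potConst]
  gcongr

lemma weightAlpha_le (hr : G.Regime cα cb δ K) {k : ℕ} (hk : k ∈ Icc 1 K) :
    weightAlpha cα K k ≤ cα * logFactor S A δ K / K := by
  refine (RobustMG.weightAlpha_le hr.one_le_step hk).trans ?_
  have := hr.K_pos
  have := hr.cα_pos
  have := hr.log_K_le
  gcongr

lemma one_le_errScale_mul (hr : G.Regime cα cb δ K) : 1 ≤ G.errScale δ K * K := by
  have hb := hr.errScale_pos
  have hK := hr.K_pos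
  have hcube : (1 / 2) ^ 3 ≤ G.errScale δ K ^ 2 * (K * G.effHorizon) := by
    rw [hr.errScale_sq]
    exact pow_le_pow_left₀ one_half_pos.le hr.half_le 3
  calc (1 : ℝ) ≤ 8 * (G.errScale δ K ^ 2 * (K * G.effHorizon)) := by linarith
    _ = G.errScale δ K * (8 * G.effHorizon) * (G.errScale δ K * K) := by ring
    _ ≤ 1 * (G.errScale δ K * K) := by gcongr; exact hr.errScale_mul_le
    _ = G.errScale δ K * K := one_mul _

lemma two_mul_L_div_K_le (hr : G.Regime cα cb δ K) :
    2 * G.effHorizon / K ≤ 2 * (G.errScale δ K * G.effHorizon) := by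
  rw [div_le_iff₀ hr.K_pos]
  calc 2 * G.effHorizon = 2 * G.effHorizon * 1 := (mul_one _).symm
    _ ≤ 2 * G.effHorizon * (G.errScale δ K * K) :=
        mul_le_mul_of_nonneg_left hr.one_le_errScale_mul (by linarith [hr.L_pos])
    _ = 2 * (G.errScale δ K * G.effHorizon) * K := by ring

end Game.Regime

end regime

/-! ### Deterministic bounds for one step -/

section step
variable {m S : ℕ} {A : Fin m → ℕ} {G : Game m S A}

lemma Game.QHat_eq_sum (cα : ℝ) (K h : ℕ) (V : Fin m → Fin S → ℝ) (x : ℕ → Sample S A)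
    (i : Fin m) (s : Fin S) (n : ℕ) (ai : Fin (A i)) :
    G.QHat cα K h V x i s n ai
      = ∑ k ∈ Icc 1 n, stepWeight (stepAlpha cα K) n k * G.qHat h V (x k) i s ai := by
  induction n with
  | zero => simp [Game.QHat]
  | succ n ih => rw [sum_stepWeight_succ, ← ih, Game.QHat]

namespace Game.Regime
variable {cα cb δ : ℝ} {K : ℕ}

lemma stepEta_mul_div_le (hr : G.Regime cα cb δ K) {k : ℕ} (hk : burnIn cα K < k) :
    G.stepEta cα K k * stepAlpha cα K k / (1 - stepAlpha cα K k) ≤ cb * G.errScale δ K :=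
  (RobustMG.stepEta_mul_div_le G hr.cα_pos hr.one_le_step hr.one_le_K hr.L_pos hr.step_le
    hr.log_pos.le hr.log_K_le hr.half_le hk).trans
    (mul_le_mul_of_nonneg_right hr.le_cb hr.errScale_pos.le)

lemma sum_weightAlpha_mul_burnIn_le (hr : G.Regime cα cb δ K) :
    ∑ k ∈ Icc 1 K, weightAlpha cα K k * (if burnIn cα K < k then 0 else 1) ≤ 1 / K := by
  have hweight : ∀ k ∈ Icc 1 (burnIn cα K), 0 ≤ weightAlpha cα K k := fun k hk =>
    stepWeight_nonneg _ (fun _ h => (stepAlpha_pos hr.one_le_step h).le)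
      (fun _ h => stepAlpha_le_one hr.one_le_step h) (mem_Icc.1 hk).1
  calc ∑ k ∈ Icc 1 K, weightAlpha cα K k * (if burnIn cα K < k then 0 else 1)
      = ∑ k ∈ Icc 1 K with ¬ burnIn cα K < k, weightAlpha cα K k := by
        rw [sum_filter]
        exact sum_congr rfl fun k _ => by split_ifs <;> simp
    _ ≤ ∑ k ∈ Icc 1 (burnIn cα K), weightAlpha cα K k :=
        sum_le_sum_of_subset_of_nonneg
          (fun k hk => by simp only [mem_filter, mem_Icc] at hk ⊢; lia) fun k hk _ => hweight k hk
    _ ≤ 1 / K := sum_weightAlpha_burnIn_le hr.cα_pos hr.one_le_step hr.one_le_K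
        (hr.step_le.trans (half_le_self hr.K_pos.le))

lemma sum_regret_le (hr : G.Regime cα cb δ K) {D : ℝ} (hD : 0 ≤ D) (M : ℕ → ℝ) {v : ℕ → ℝ}
    (hv : ∀ k, 0 ≤ v k) :
    ∑ k ∈ Icc 1 K, weightAlpha cα K k * (M k + if burnIn cα K < k then
        G.stepEta cα K k * stepAlpha cα K k / (1 - stepAlpha cα K k) * v k else D)
      ≤ ∑ k ∈ Icc 1 K, weightAlpha cα K k * M k
        + cb * G.errScale δ K * ∑ k ∈ Icc 1 K, weightAlpha cα K k * v k + D * (1 / K) := by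
  refine le_trans ?_ (add_le_add_right
    (mul_le_mul_of_nonneg_left hr.sum_weightAlpha_mul_burnIn_le hD) _)
  simp only [mul_sum, ← sum_add_distrib]
  refine sum_le_sum fun k hk => ?_
  have hw := weightAlpha_nonneg hr.one_le_step hk
  calc weightAlpha cα K k * (M k + if burnIn cα K < k then
        G.stepEta cα K k * stepAlpha cα K k / (1 - stepAlpha cα K k) * v k else D)
      ≤ weightAlpha cα K k * (M k + (cb * G.errScale δ K * v k
        + D * if burnIn cα K < k then 0 else 1)) := by
        gcongr
        split_ifs with hburn
        · simpa using mul_le_mul_of_nonneg_right (hr.stepEta_mul_div_le hburn) (hv k)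
        · simpa using mul_nonneg hr.cb_mul_errScale_nonneg (hv k)
    _ = _ := by ring

end Game.Regime

variable [∀ i, NeZero (A i)]

/-- The weighted mean of the sampled gains under the current policies. -/
def Game.playedGain (G : Game m S A) (cα : ℝ) (K h : ℕ) (V : Fin m → Fin S → ℝ)
    (x : ℕ → Sample S A) (i : Fin m) (s : Fin S) : ℝ :=
  ∑ k ∈ Icc 1 K, weightAlpha cα K k *
    mean (G.iterPolicy cα K h V x k i s) (G.qHat h V (x k) i s)

/-- The weighted variance of the sampled gains under the current policies. -/
def Game.playedVar (G : Game m S A) (cα : ℝ) (K h : ℕ) (V : Fin m → Fin S → ℝ)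
    (x : ℕ → Sample S A) (i : Fin m) (s : Fin S) : ℝ :=
  ∑ k ∈ Icc 1 K, weightAlpha cα K k *
    var (G.iterPolicy cα K h V x k i s) (G.qHat h V (x k) i s)

namespace Game.Regime
variable {cα cb δ : ℝ} {K h : ℕ} {V : Fin m → Fin S → ℝ} {x : ℕ → Sample S A} {i : Fin m}

lemma valueHat_eq (hr : G.Regime cα cb δ K) (s : Fin S) :
    G.valueHat cα cb δ K h V x i s
      = min (G.playedGain cα K h V x i s + cb * G.errScale δ K * G.playedVar cα K h V x i s
          + cb * G.errScale δ K * G.effHorizon) ((G.H : ℝ) - h + 1) := by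
  have hbonus : G.bonus cα cb δ K h V x i s
      = cb * G.errScale δ K * (G.playedVar cα K h V x i s + G.effHorizon) := by
    rw [Game.bonus, Game.playedVar]
    simp only [mul_add, sum_add_distrib, ← sum_mul, sum_weightAlpha hr.one_le_step hr.one_le_K,
      one_mul]
    rfl
  rw [Game.valueHat, hbonus, mul_add, ← add_assoc, Game.playedGain]

lemma valueHat_le (hr : G.Regime cα cb δ K) (s : Fin S) :
    G.valueHat cα cb δ K h V x i s ≤ G.playedGain cα K h V x i s
      + cb * G.errScale δ K * G.playedVar cα K h V x i s
      + cb * G.errScale δ K * G.effHorizon := by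
  rw [hr.valueHat_eq]
  exact min_le_left _ _

lemma playedVar_nonneg (hr : G.Regime cα cb δ K) (s : Fin S) : 0 ≤ G.playedVar cα K h V x i s :=
  sum_nonneg fun _ hk => mul_nonneg (weightAlpha_nonneg hr.one_le_step hk) (var_nonneg _ _)

variable {lo D : ℝ}

lemma playedGain_add_le (hr : G.Regime cα cb δ K) (hD : D ≤ 2 * G.effHorizon) (s : Fin S)
    (hq : ∀ k s ai, G.qHat h V (x k) i s ai ∈ Set.Icc lo (lo + D)) :
    G.playedGain cα K h V x i s + cb * G.errScale δ K * G.playedVar cα K h V x i s ≤ lo + D := by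
  have hsmall : cb * G.errScale δ K * (lo + D - lo) ≤ 1 := by
    refine (mul_le_mul_of_nonneg_left ?_ hr.cb_mul_errScale_nonneg).trans hr.cb_mul_errScale_mul_le
    linarith [hr.L_pos]
  calc G.playedGain cα K h V x i s + cb * G.errScale δ K * G.playedVar cα K h V x i s
      = ∑ k ∈ Icc 1 K, weightAlpha cα K k *
          (mean (G.iterPolicy cα K h V x k i s) (G.qHat h V (x k) i s) + cb * G.errScale δ K
            * var (G.iterPolicy cα K h V x k i s) (G.qHat h V (x k) i s)) := by
        rw [Game.playedGain, Game.playedVar, mul_sum, ← sum_add_distrib]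
        exact sum_congr rfl fun k _ => by ring
    _ ≤ lo + D := sum_weightAlpha_mul_le hr.one_le_step hr.one_le_K fun k _ =>
        mean_add_mul_var_le _ _ (fun ai => (hq k s ai).1) (fun ai => (hq k s ai).2)
          hr.cb_mul_errScale_nonneg hsmall

lemma le_playedGain_add (hr : G.Regime cα cb δ K) (s : Fin S)
    (hq : ∀ k s ai, lo ≤ G.qHat h V (x k) i s ai) :
    lo ≤ G.playedGain cα K h V x i s + cb * G.errScale δ K * G.playedVar cα K h V x i s :=
  le_add_of_le_of_nonneg
    (le_sum_weightAlpha_mul hr.one_le_step hr.one_le_K fun k _ => le_mean _ _ (hq k s))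
    (mul_nonneg hr.cb_mul_errScale_nonneg (hr.playedVar_nonneg s))

lemma le_valueHat (hr : G.Regime cα cb δ K) (hD : D ≤ 2 * G.effHorizon) (s : Fin S)
    (hq : ∀ k s ai, G.qHat h V (x k) i s ai ∈ Set.Icc lo (lo + D))
    (hcap : lo + D ≤ (G.H : ℝ) - h + 1) :
    G.playedGain cα K h V x i s + cb * G.errScale δ K * G.playedVar cα K h V x i s
      ≤ G.valueHat cα cb δ K h V x i s := by
  rw [hr.valueHat_eq]
  exact le_min (le_add_of_nonneg_right (mul_nonneg hr.cb_mul_errScale_nonneg hr.L_pos.le))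
    ((hr.playedGain_add_le hD s hq).trans hcap)

lemma lo_le_valueHat (hr : G.Regime cα cb δ K) (hD : D ≤ 2 * G.effHorizon) (s : Fin S)
    (hq : ∀ k s ai, G.qHat h V (x k) i s ai ∈ Set.Icc lo (lo + D))
    (hcap : lo + D ≤ (G.H : ℝ) - h + 1) : lo ≤ G.valueHat cα cb δ K h V x i s :=
  (hr.le_playedGain_add s fun k s ai => (hq k s ai).1).trans (hr.le_valueHat hD s hq hcap)

lemma valueHat_sub_le (hr : G.Regime cα cb δ K) (hD : D ≤ 2 * G.effHorizon)
    (hq : ∀ k s ai, G.qHat h V (x k) i s ai ∈ Set.Icc lo (lo + D)) (s s' : Fin S) :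
    G.valueHat cα cb δ K h V x i s - G.valueHat cα cb δ K h V x i s' ≤ D := by
  have hD0 : 0 ≤ D := by linarith [(hq 0 s 0).1.trans (hq 0 s 0).2]
  have hlo := hr.le_playedGain_add s' fun k s ai => (hq k s ai).1
  have hhi := hr.playedGain_add_le hD s hq
  rw [hr.valueHat_eq, hr.valueHat_eq, sub_le_iff_le_add', ← min_add_add_right]
  exact min_le_min (by linarith) (by linarith)

lemma sum_weightAlpha_mul_qHat_le (hr : G.Regime cα cb δ K) (hD : D ≤ 2 * G.effHorizon)
    (s : Fin S) (hq : ∀ k s ai, G.qHat h V (x k) i s ai ∈ Set.Icc lo (lo + D)) (ai : Fin (A i)) :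
    ∑ k ∈ Icc 1 K, weightAlpha cα K k * G.qHat h V (x k) i s ai
      ≤ G.playedGain cα K h V x i s + cb * G.errScale δ K * G.playedVar cα K h V x i s
        + (2 + 2 * Real.sqrt cα) * (G.errScale δ K * G.effHorizon) := by
  have hc := hr.one_le_step
  have hD0 : 0 ≤ D := by linarith [(hq 0 s 0).1.trans (hq 0 s 0).2]
  have hstable : ∀ k ∈ Icc (burnIn cα K + 1) K,
      G.stepEta cα K k * stepAlpha cα K k / (1 - stepAlpha cα K k) * D ≤ 1 := fun k hk => by
    refine (mul_le_mul (hr.stepEta_mul_div_le (mem_Icc.1 hk).1) ?_ hD0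
      hr.cb_mul_errScale_nonneg).trans hr.cb_mul_errScale_mul_le
    linarith [hr.L_pos]
  have hregret := expWeights_regret hr.one_le_K (one_le_burnIn cα hr.one_le_K) (stepAlpha_one hc)
    (fun _ => stepAlpha_pos hc) (fun _ => stepAlpha_lt_one hc)
    (fun _ => stepEta_pos G hc hr.log_pos hr.L_pos)
    (fun _ => one_sub_mul_stepEta_le G hc hr.log_pos hr.L_pos)
    (q := fun k => G.qHat h V (x k) i s) (Q := G.QHat cα K h V x i s) (fun _ _ => rfl)
    (fun k _ ai => (hq k s ai).1) (fun k _ ai => (hq k s ai).2) hstable ai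
  rw [Game.QHat_eq_sum, Fintype.card_fin] at hregret
  have hlog : Real.log (A i) / G.stepEta cα K (K + 1)
      ≤ 2 * Real.sqrt cα * (G.errScale δ K * G.effHorizon) :=
    (div_le_div_of_nonneg_right (hr.log_A_le i) (Real.sqrt_nonneg _)).trans
      (log_div_stepEta_le G hr.cα_pos hr.one_le_K hr.log_pos hr.L_pos hr.half_le)
  have hburn : D * (1 / K) ≤ 2 * G.effHorizon / K := by
    rw [mul_one_div]
    exact div_le_div_of_nonneg_right hD hr.K_pos.le
  have hsum := hr.sum_regret_le hD0
    (fun k => mean (G.iterPolicy cα K h V x k i s) (G.qHat h V (x k) i s))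
    fun k => var_nonneg (G.iterPolicy cα K h V x k i s) (G.qHat h V (x k) i s)
  calc _ ≤ _ := hregret
    _ ≤ _ := add_le_add hsum hlog
    _ ≤ _ := by
      rw [Game.playedGain, Game.playedVar]
      linarith [hr.two_mul_L_div_K_le]

end Game.Regime

end step

/-! ### Quadratic potentials -/

-- In the next two lemmas `v'` is the new value estimate at a state, `μ` the minimum of the old
-- one, `U` the excess of `v'` over its own minimum, `Y` and `Q` the first two moments of the
-- centred gain, and `E` the mean squared excess at the next state. The variance `Q - Y ^ 2` is
-- self-bounding: `v'` is close to `μ + Y`, so `Y` is nearly `U`, and `Q - Y ^ 2` is nearly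
-- `E - U ^ 2`, which telescopes along a trajectory.
lemma add_potential_le {v' μ U Y Q E β L : ℝ} (hβ : 0 ≤ β) (hL : 1 ≤ L) (hβL : β * (8 * L) ≤ 1)
    (hU0 : 0 ≤ U) (hU : U ≤ 2 * L) (hUv : U ≤ v' - μ + 1) (hQ : Q ≤ E + (1 + 4 * L))
    (hvar : 0 ≤ Q - Y ^ 2) (hv' : v' ≤ μ + Y + β * (Q - Y ^ 2 + L)) :
    v' + 2 * β * U ^ 2 ≤ μ + Y + 2 * β * E + 27 * (β * L) := by
  set v := Q - Y ^ 2 with hv_def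
  have hY : U - 2 - β * v ≤ Y := by linarith
  have hYsq : U ^ 2 - 2 * U * (2 + β * v) ≤ Y ^ 2 := by
    linarith [sq_nonneg (Y - U), mul_le_mul_of_nonneg_left hY hU0]
  have hcross : 2 * U * (2 + β * v) ≤ 4 * L * (2 + β * v) :=
    mul_le_mul_of_nonneg_right (by linarith) (by positivity)
  have habsorb : 4 * L * (β * v) ≤ v / 2 := by linarith [mul_le_mul_of_nonneg_right hβL hvar]
  have hself : v ≤ 2 * (E - U ^ 2) + 26 * L := by linarith [hv_def]
  linarith [mul_le_mul_of_nonneg_left hself hβ]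

lemma le_sub_potential {v' μ U Y Q E β L : ℝ} (hβ : 0 ≤ β) (hL : 1 ≤ L) (hβL : β * (8 * L) ≤ 1)
    (hU0 : 0 ≤ U) (hU : U ≤ 2 * L) (hUv : U ≤ v' - μ + 1) (hQ : Q ≤ E + (1 + 4 * L))
    (hvar : 0 ≤ Q - Y ^ 2) (hv' : μ + Y ≤ v' + β * (Q - Y ^ 2 + L)) :
    μ + Y - 2 * β * E ≤ v' - 2 * β * U ^ 2 + 27 * (β * L) := by
  set v := Q - Y ^ 2 with hv_def
  set g := v' - μ - Y with hg_def
  have hYsq : U ^ 2 - 2 * U * (g + 1) ≤ Y ^ 2 := by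
    have hUg : U - g - 1 ≤ Y := by linarith [hg_def]
    linarith [sq_nonneg (Y - U), mul_le_mul_of_nonneg_left hUg hU0]
  have hself : v ≤ E - U ^ 2 + 9 * L + 2 * U * g := by linarith [hv_def]
  have hneg_g : -g ≤ 2 * β * (E - U ^ 2) + 19 * (β * L) := by
    rcases le_total g 0 with hg0 | hg0
    · have hv : v ≤ E - U ^ 2 + 9 * L := by linarith [mul_nonpos_of_nonneg_of_nonpos hU0 hg0]
      linarith [mul_le_mul_of_nonneg_left hv hβ, mul_nonneg hβ hvar]
    · have hβv : β * 0 ≤ β * (E - U ^ 2 + 9 * L + 2 * U * g) :=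
        mul_le_mul_of_nonneg_left (hvar.trans hself) hβ
      have hβU : 4 * β * U ≤ 1 := by linarith [mul_le_mul_of_nonneg_left hU hβ]
      linarith [mul_le_mul_of_nonneg_right hβU hg0, show 0 ≤ β * L by positivity]
  linarith [show 0 ≤ β * L by positivity]

/-! ### Moments of the gains -/

section moments
variable {m S : ℕ} {A : Fin m → ℕ}

/-- The expectation of `F` when a round `k` is drawn with probability `weightAlpha cα K k` and the
actions are then drawn from the product law `ν k`. -/
def roundMean (cα : ℝ) (K : ℕ) (ν : ℕ → (j : Fin m) → Fin (A j) → ℝ) (F : Joint A → ℝ) : ℝ :=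
  ∑ k ∈ Icc 1 K, weightAlpha cα K k * prodMean (ν k) F

section roundMean
variable {cα : ℝ} {K : ℕ} {ν : ℕ → (j : Fin m) → Fin (A j) → ℝ} {F F' : Joint A → ℝ}

lemma roundMean_add :
    roundMean cα K ν (fun a => F a + F' a) = roundMean cα K ν F + roundMean cα K ν F' := by
  simp only [roundMean, prodMean_add, mul_add, sum_add_distrib]

lemma roundMean_mul_left (c : ℝ) :
    roundMean cα K ν (fun a => c * F a) = c * roundMean cα K ν F := by
  simp only [roundMean, prodMean_mul_left, mul_sum, mul_left_comm]

lemma roundMean_const (hc : 1 ≤ cα * Real.log K) (hK : 1 ≤ K)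
    (hν : ∀ k j, ν k j ∈ stdSimplex ℝ (Fin (A j))) (c : ℝ) :
    roundMean cα K ν (fun _ => c) = c := by
  simp only [roundMean, prodMean_const _ fun j => (hν _ j).2, ← sum_mul, sum_weightAlpha hc hK,
    one_mul]

lemma roundMean_mono (hc : 1 ≤ cα * Real.log K)
    (hν : ∀ k j, ν k j ∈ stdSimplex ℝ (Fin (A j))) (h : ∀ a, F a ≤ F' a) :
    roundMean cα K ν F ≤ roundMean cα K ν F' :=
  sum_le_sum fun k hk => mul_le_mul_of_nonneg_left (prodMean_mono _ (fun j => (hν k j).1) h)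
    (weightAlpha_nonneg hc hk)

end roundMean

/-- The discounted mean of the squared excess at the next state. -/
def Game.nextQuad (G : Game m S A) (h : ℕ) (V : Fin m → Fin S → ℝ) (i : Fin m) (s : Fin S)
    (a : Joint A) : ℝ :=
  (1 - G.R) * mean (G.P0 h s a) fun s' => excess V i s' ^ 2

/-- The expectation of a function `φ` of the centred gain under the mixture of the round
laws `ν k`. -/
def Game.avgGain (G : Game m S A) (cα : ℝ) (K h : ℕ) (V : Fin m → Fin S → ℝ) (i : Fin m)
    (s : Fin S) (φ : ℝ → ℝ) (ν : ℕ → (j : Fin m) → Fin (A j) → ℝ) : ℝ :=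
  roundMean cα K ν fun a => mean (G.P0 h s a) fun s' => φ (G.centredGain h V i s (a, s'))

/-- The variance of the centred gain under the mixture of the round laws `ν k`. -/
def Game.avgGainVar (G : Game m S A) (cα : ℝ) (K h : ℕ) (V : Fin m → Fin S → ℝ) (i : Fin m)
    (s : Fin S) (ν : ℕ → (j : Fin m) → Fin (A j) → ℝ) : ℝ :=
  G.avgGain cα K h V i s (· ^ 2) ν - G.avgGain cα K h V i s id ν ^ 2

variable {G : Game m S A} {h : ℕ} {V : Fin m → Fin S → ℝ} {i : Fin m} {s : Fin S}

lemma Game.nextQuad_nonneg (hR1 : G.R ≤ 1) (a : Joint A) : 0 ≤ G.nextQuad h V i s a :=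
  mul_nonneg (sub_nonneg.2 hR1) (le_mean _ _ fun _ => sq_nonneg _)

lemma Game.mean_centredGain (a : Joint A) :
    mean (G.P0 h s a) (fun s' => G.centredGain h V i s (a, s'))
      = G.r i h s a + (1 - G.R) * (mean (G.P0 h s a) (V i) - ⨅ s', V i s') := by
  have hgain : (fun s' => G.centredGain h V i s (a, s'))
      = fun s' => (1 - G.R) * V i s' + (G.r i h s a - (1 - G.R) * ⨅ s', V i s') := by
    funext s'
    rw [Game.centredGain, excess]
    ring
  rw [hgain, mean_add, mean_mul_left, mean_const]
  ring

lemma Game.discGain_add_mul_excess_sq (c : ℝ) (a : Joint A) :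
    G.discGain i h s (fun s' => V i s' + c * excess V i s' ^ 2) a + G.R * (⨅ s', V i s')
      = (⨅ s', V i s') + mean (G.P0 h s a) (fun s' => G.centredGain h V i s (a, s'))
        + c * G.nextQuad h V i s a := by
  rw [Game.discGain, mean_add, mean_mul_left, Game.mean_centredGain, Game.nextQuad]
  ring

lemma add_mul_sq_le {r γ u L : ℝ} (hr : |r| ≤ 1) (hγ : γ ∈ Set.Icc 0 1)
    (hu : u ∈ Set.Icc 0 (2 * L)) : (r + γ * u) ^ 2 ≤ γ * u ^ 2 + (1 + 4 * L) := by
  obtain ⟨hγ0, hγ1⟩ := hγ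
  obtain ⟨hu0, huL⟩ := hu
  have hr2 : r ^ 2 ≤ 1 := (sq_le_one_iff_abs_le_one r).2 hr
  have hγu : γ * u ≤ 2 * L := (mul_le_of_le_one_left hu0 hγ1).trans huL
  have hcross : r * (γ * u) ≤ 1 * (γ * u) :=
    mul_le_mul_of_nonneg_right (abs_le.1 hr).2 (mul_nonneg hγ0 hu0)
  have hsq : (γ * u) ^ 2 ≤ γ * u ^ 2 := by
    rw [mul_pow]
    exact mul_le_mul_of_nonneg_right (pow_le_of_le_one hγ0 hγ1 two_ne_zero) (sq_nonneg u)
  linarith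

lemma Game.mean_centredGain_sq_le (hR : G.R ∈ Set.Icc 0 1) {L : ℝ} (hrew : ∀ a, |G.r i h s a| ≤ 1)
    (hV : ∀ s', excess V i s' ≤ 2 * L) (a : Joint A) :
    mean (G.P0 h s a) (fun s' => G.centredGain h V i s (a, s') ^ 2)
      ≤ G.nextQuad h V i s a + (1 + 4 * L) := by
  rw [Game.nextQuad, ← mean_mul_left, ← mean_const (G.P0 h s a) (1 + 4 * L), ← mean_add]
  exact mean_mono _ fun s' => add_mul_sq_le (hrew a) ⟨sub_nonneg.2 hR.2, by linarith [hR.1]⟩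
    ⟨excess_nonneg V i s', hV s'⟩

lemma sq_prodMean_le {μ : (j : Fin m) → Fin (A j) → ℝ}
    (hμ : ∀ j, μ j ∈ stdSimplex ℝ (Fin (A j))) (F : Joint A → ℝ) :
    prodMean μ F ^ 2 ≤ prodMean μ fun a => F a ^ 2 :=
  Real.pow_arith_mean_le_arith_mean_pow_of_even _ _ _ (fun _ _ => prod_nonneg fun j _ => (hμ j).1 _)
    (by simpa [prodMean] using prodMean_const μ (fun j => (hμ j).2) 1) even_two

lemma Game.gainVar_nonneg {μ : (j : Fin m) → Fin (A j) → ℝ}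
    (hμ : ∀ j, μ j ∈ stdSimplex ℝ (Fin (A j))) : 0 ≤ G.gainVar h V i s μ :=
  sub_nonneg.2 ((sq_prodMean_le hμ _).trans
    (prodMean_mono μ (fun j => (hμ j).1) fun a => sq_mean_le (G.P0 h s a) _))

section avgGain
variable {cα : ℝ} {K : ℕ} {ν : ℕ → (j : Fin m) → Fin (A j) → ℝ}

lemma Game.roundMean_discGain (hc : 1 ≤ cα * Real.log K) (hK : 1 ≤ K)
    (hν : ∀ k j, ν k j ∈ stdSimplex ℝ (Fin (A j))) (c : ℝ) :
    roundMean cα K ν (G.discGain i h s fun s' => V i s' + c * excess V i s' ^ 2)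
        + G.R * (⨅ s', V i s')
      = (⨅ s', V i s') + G.avgGain cα K h V i s id ν
        + c * roundMean cα K ν (G.nextQuad h V i s) := by
  rw [← roundMean_const hc hK hν (G.R * _), ← roundMean_add]
  simp only [Game.discGain_add_mul_excess_sq]
  rw [roundMean_add, roundMean_add, roundMean_const hc hK hν, roundMean_mul_left]
  rfl

lemma Game.avgGain_sq_le (hc : 1 ≤ cα * Real.log K) (hK : 1 ≤ K)
    (hν : ∀ k j, ν k j ∈ stdSimplex ℝ (Fin (A j))) (hR : G.R ∈ Set.Icc 0 1) {L : ℝ}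
    (hrew : ∀ a, |G.r i h s a| ≤ 1) (hV : ∀ s', excess V i s' ≤ 2 * L) :
    G.avgGain cα K h V i s (· ^ 2) ν ≤ roundMean cα K ν (G.nextQuad h V i s) + (1 + 4 * L) := by
  rw [← roundMean_const hc hK hν (1 + 4 * L), ← roundMean_add]
  exact roundMean_mono hc hν (Game.mean_centredGain_sq_le hR hrew hV)

lemma Game.sum_weightAlpha_mul_gainVar_nonneg (hc : 1 ≤ cα * Real.log K)
    (hν : ∀ k j, ν k j ∈ stdSimplex ℝ (Fin (A j))) :
    0 ≤ ∑ k ∈ Icc 1 K, weightAlpha cα K k * G.gainVar h V i s (ν k) :=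
  sum_nonneg fun k hk => mul_nonneg (weightAlpha_nonneg hc hk) (Game.gainVar_nonneg (hν k))

lemma Game.sum_weightAlpha_mul_gainVar_le (hc : 1 ≤ cα * Real.log K) (hK : 1 ≤ K) :
    ∑ k ∈ Icc 1 K, weightAlpha cα K k * G.gainVar h V i s (ν k)
      ≤ G.avgGainVar cα K h V i s ν := by
  simp only [Game.gainVar, mul_sub, sum_sub_distrib]
  exact sub_le_sub_left (sq_sum_weightAlpha_mul_le hc hK fun k => G.gainMean h V i s id (ν k)) _

lemma Game.avgGainVar_nonneg (hc : 1 ≤ cα * Real.log K) (hK : 1 ≤ K)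
    (hν : ∀ k j, ν k j ∈ stdSimplex ℝ (Fin (A j))) : 0 ≤ G.avgGainVar cα K h V i s ν :=
  (Game.sum_weightAlpha_mul_gainVar_nonneg hc hν).trans (Game.sum_weightAlpha_mul_gainVar_le hc hK)

end avgGain

end moments

/-! ### Good data -/

section goodData
variable {m S : ℕ} {A : Fin m → ℕ}

/-- The parameter of the exponential supermartingales for the gains: the largest `t` for which
`t * weightAlpha cα K k ≤ errScale` follows from `Game.Regime.weightAlpha_le`. -/
def Game.gainParam (G : Game m S A) (cα δ : ℝ) (K : ℕ) : ℝ :=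
  G.errScale δ K / (cα * logFactor S A δ K / K)

/-- The parameter of the exponential supermartingales for the variances: the largest `τ` for which
`τ * weightAlpha cα K k * (2 * L) ^ 2 ≤ 1` follows from `Game.Regime.weightAlpha_le`. -/
def Game.varParam (G : Game m S A) (cα δ : ℝ) (K : ℕ) : ℝ :=
  1 / (cα * logFactor S A δ K / K * (2 * G.effHorizon) ^ 2)

namespace Game.Regime
variable {G : Game m S A} {cα cb δ : ℝ} {K : ℕ}

lemma gainParam_pos (hr : G.Regime cα cb δ K) : 0 < G.gainParam cα δ K :=
  div_pos hr.errScale_pos (div_pos (mul_pos hr.cα_pos hr.logFactor_pos) hr.K_pos)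

lemma varParam_pos (hr : G.Regime cα cb δ K) : 0 < G.varParam cα δ K := by
  have := hr.L_pos
  exact one_div_pos.2 (mul_pos (div_pos (mul_pos hr.cα_pos hr.logFactor_pos) hr.K_pos)
    (by positivity))

lemma gainParam_mul_weightAlpha_le (hr : G.Regime cα cb δ K) {k : ℕ} (hk : k ∈ Icc 1 K) :
    G.gainParam cα δ K * weightAlpha cα K k ≤ G.errScale δ K :=
  (mul_le_mul_of_nonneg_left (hr.weightAlpha_le hk) hr.gainParam_pos.le).trans_eq
    (div_mul_cancel₀ _ (div_pos (mul_pos hr.cα_pos hr.logFactor_pos) hr.K_pos).ne')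

lemma varParam_mul_weightAlpha_le (hr : G.Regime cα cb δ K) {k : ℕ} (hk : k ∈ Icc 1 K) :
    G.varParam cα δ K * weightAlpha cα K k * (2 * G.effHorizon) ^ 2 ≤ 1 := by
  have hL := hr.L_pos
  have hpos : 0 < cα * logFactor S A δ K / K :=
    div_pos (mul_pos hr.cα_pos hr.logFactor_pos) hr.K_pos
  rw [Game.varParam, mul_assoc, one_div_mul_eq_div, div_le_one (by positivity)]
  gcongr
  exact hr.weightAlpha_le hk

lemma eight_mul_logFactor_le_gainParam_mul (hr : G.Regime cα cb δ K) :
    8 * logFactor S A δ K ≤ G.gainParam cα δ K * (16 * cα * (G.errScale δ K * G.effHorizon)) := by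
  have hι := hr.logFactor_pos
  have hK := hr.K_pos
  have hα := hr.cα_pos
  have heq : G.gainParam cα δ K * (16 * cα * (G.errScale δ K * G.effHorizon))
      = 16 * (G.errScale δ K ^ 2 * (K * G.effHorizon)) / logFactor S A δ K := by
    rw [Game.gainParam]; field_simp
  rw [heq, hr.errScale_sq, le_div_iff₀ hι]
  linarith [mul_le_mul_of_nonneg_right hr.half_le (sq_nonneg (logFactor S A δ K))]

lemma eight_mul_logFactor_le_varParam_mul (hr : G.Regime cα cb δ K) :
    8 * logFactor S A δ K ≤ G.varParam cα δ K * (64 * cα * G.effHorizon) := by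
  have hι := hr.logFactor_pos
  have hL := hr.L_pos
  have hK := hr.K_pos
  have hα := hr.cα_pos
  have heq : G.varParam cα δ K * (64 * cα * G.effHorizon)
      = 16 * K / (logFactor S A δ K * G.effHorizon) := by
    rw [Game.varParam]; field_simp; norm_num
  have herr : G.errScale δ K * G.effHorizon ≤ 1 := by
    linarith [hr.errScale_mul_le, mul_pos hr.errScale_pos hL]
  have hcube : logFactor S A δ K ^ 3 * G.effHorizon ≤ (K : ℝ) :=
    calc logFactor S A δ K ^ 3 * G.effHorizon
        = (K : ℝ) * (G.errScale δ K * G.effHorizon) ^ 2 := by rw [← hr.errScale_sq]; ring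
      _ ≤ (K : ℝ) := mul_le_of_le_one_right hK.le
          (pow_le_one₀ (mul_pos hr.errScale_pos hL).le herr)
  rw [heq, le_div_iff₀ (mul_pos hι hL)]
  linarith [mul_le_mul_of_nonneg_left hr.half_le
    (show 0 ≤ logFactor S A δ K ^ 2 * G.effHorizon by positivity)]

lemma sum_weightAlpha_mul_error_le (hr : G.Regime cα cb δ K) {X v : ℕ → ℝ}
    (hv : ∀ k ∈ Icc 1 K, 0 ≤ v k)
    (hX : ∑ k ∈ Icc 1 K, (G.gainParam cα δ K * weightAlpha cα K k * X k
      - (G.gainParam cα δ K * weightAlpha cα K k) ^ 2 * v k) ≤ 8 * logFactor S A δ K) :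
    ∑ k ∈ Icc 1 K, weightAlpha cα K k * X k
      ≤ G.errScale δ K * (∑ k ∈ Icc 1 K, weightAlpha cα K k * v k)
        + 16 * cα * (G.errScale δ K * G.effHorizon) := by
  rw [← sub_le_iff_le_add', mul_sum, ← sum_sub_distrib]
  refine le_of_mul_le_mul_left (le_trans ?_
    (hX.trans hr.eight_mul_logFactor_le_gainParam_mul)) hr.gainParam_pos
  rw [mul_sum]
  refine sum_le_sum fun k hk => ?_
  have hweight := mul_nonneg hr.gainParam_pos.le (weightAlpha_nonneg hr.one_le_step hk)
  have hvar := mul_le_mul_of_nonneg_right (hr.gainParam_mul_weightAlpha_le hk)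
    (mul_nonneg hweight (hv k hk))
  linarith

lemma sum_weightAlpha_mul_var_le (hr : G.Regime cα cb δ K) {Z v : ℕ → ℝ}
    (hZ : ∑ k ∈ Icc 1 K, (G.varParam cα δ K * weightAlpha cα K k * Z k
      - 2 * (G.varParam cα δ K * weightAlpha cα K k * v k)) ≤ 8 * logFactor S A δ K) :
    ∑ k ∈ Icc 1 K, weightAlpha cα K k * Z k
      ≤ 2 * (∑ k ∈ Icc 1 K, weightAlpha cα K k * v k) + 64 * cα * G.effHorizon := by
  rw [← sub_le_iff_le_add', mul_sum, ← sum_sub_distrib]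
  refine le_of_mul_le_mul_left (le_trans (le_of_eq ?_)
    (hZ.trans hr.eight_mul_logFactor_le_varParam_mul)) hr.varParam_pos
  rw [mul_sum]
  exact sum_congr rfl fun k _ => by ring

end Game.Regime

variable [∀ i, NeZero (A i)]

/-- Good data at the confidence level at which one step fails with probability at most
`exp (-8 * logFactor)`, up to the number of events. -/
def Game.IsGood (G : Game m S A) (cα δ : ℝ) (K h : ℕ) (V : Fin m → Fin S → ℝ)
    (x : ℕ → Sample S A) : Prop :=
  G.GoodData cα K h V (G.gainParam cα δ K) (G.varParam cα δ K) (8 * logFactor S A δ K) x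

variable {G : Game m S A} {cα cb δ : ℝ} {K h : ℕ} {V : Fin m → Fin S → ℝ}
  {x : ℕ → Sample S A} {i : Fin m}

lemma Game.playedGain_eq (hc : 1 ≤ cα * Real.log K) (hK : 1 ≤ K) (s : Fin S) :
    G.playedGain cα K h V x i s = (⨅ s', V i s') + ∑ k ∈ Icc 1 K, weightAlpha cα K k *
      mean (G.iterPolicy cα K h V x k i s) (fun ai => G.centredGain h V i s (x k i s ai)) := by
  simp only [Game.playedGain, funext (Game.qHat_eq h V _ i s), mean_add, mean_const, mul_add,
    sum_add_distrib, ← sum_mul, sum_weightAlpha hc hK, one_mul, add_comm]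

lemma Game.playedVar_eq (s : Fin S) :
    G.playedVar cα K h V x i s = ∑ k ∈ Icc 1 K, weightAlpha cα K k *
      var (G.iterPolicy cα K h V x k i s) (fun ai => G.centredGain h V i s (x k i s ai)) := by
  simp only [Game.playedVar, funext (Game.qHat_eq h V _ i s), var_add_const]

namespace Game.Regime

lemma playedGain_le_of_good (hr : G.Regime cα cb δ K) (hx : G.IsGood cα δ K h V x) (s : Fin S) :
    G.playedGain cα K h V x i s
      ≤ (⨅ s', V i s') + G.avgGain cα K h V i s id (G.roundWeights cα K h V x s)
        + G.errScale δ K * G.avgGainVar cα K h V i s (G.roundWeights cα K h V x s)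
        + 16 * cα * (G.errScale δ K * G.effHorizon) := by
  have herr := hr.sum_weightAlpha_mul_error_le
    (fun k _ => Game.gainVar_nonneg (G.roundWeights_mem cα K h V x s k)) (hx i s).2.1
  simp only [mul_sub, sum_sub_distrib] at herr
  have hvar := mul_le_mul_of_nonneg_left (Game.sum_weightAlpha_mul_gainVar_le (G := G) (h := h)
    (V := V) (i := i) (s := s) (ν := G.roundWeights cα K h V x s) hr.one_le_step hr.one_le_K)
    hr.errScale_pos.le
  rw [Game.playedGain_eq hr.one_le_step hr.one_le_K, Game.avgGain, roundMean]
  simp only [Game.gainMean] at herr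
  linarith

lemma playedVar_le_of_good (hr : G.Regime cα cb δ K) (hx : G.IsGood cα δ K h V x) (s : Fin S) :
    G.playedVar cα K h V x i s
      ≤ 2 * G.avgGainVar cα K h V i s (G.roundWeights cα K h V x s) + 64 * cα * G.effHorizon := by
  rw [Game.playedVar_eq]
  have := hr.sum_weightAlpha_mul_var_le (hx i s).2.2
  linarith [Game.sum_weightAlpha_mul_gainVar_le (G := G) (h := h) (V := V) (i := i) (s := s)
    (ν := G.roundWeights cα K h V x s) hr.one_le_step hr.one_le_K]

lemma valueHat_le_of_good (hr : G.Regime cα cb δ K) (hx : G.IsGood cα δ K h V x) (s : Fin S) :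
    G.valueHat cα cb δ K h V x i s
      ≤ (⨅ s', V i s') + G.avgGain cα K h V i s id (G.roundWeights cα K h V x s)
        + potConst cα cb * G.errScale δ K
          * (G.avgGainVar cα K h V i s (G.roundWeights cα K h V x s) + G.effHorizon) := by
  have hvalue := hr.valueHat_le (h := h) (V := V) (x := x) (i := i) s
  have hgain := hr.playedGain_le_of_good (i := i) hx s
  have hbonus := mul_le_mul_of_nonneg_left (hr.playedVar_le_of_good (i := i) hx s)
    hr.cb_mul_errScale_nonneg
  have hvar0 : 0 ≤ G.avgGainVar cα K h V i s (G.roundWeights cα K h V x s) :=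
    Game.avgGainVar_nonneg hr.one_le_step hr.one_le_K (G.roundWeights_mem cα K h V x s)
  have hcoeff : 0 ≤ 2 * Real.sqrt cα + 64 * cα * cb + 64 * cα := by
    have := hr.cb_nonneg
    have := hr.cα_pos
    positivity
  have hvar : (1 + 2 * cb) * (G.errScale δ K * G.avgGainVar cα K h V i s
      (G.roundWeights cα K h V x s)) ≤ potConst cα cb * (G.errScale δ K *
        G.avgGainVar cα K h V i s (G.roundWeights cα K h V x s)) :=
    mul_le_mul_of_nonneg_right (by rw [potConst]; linarith [hr.cb_nonneg])
      (mul_nonneg hr.errScale_pos.le hvar0)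
  have hconst : (16 * cα + 64 * cα * cb + cb) * (G.errScale δ K * G.effHorizon)
      ≤ potConst cα cb * (G.errScale δ K * G.effHorizon) :=
    mul_le_mul_of_nonneg_right
      (by rw [potConst]; linarith [hr.cb_nonneg, hr.cα_pos, Real.sqrt_nonneg cα])
      (mul_nonneg hr.errScale_pos.le hr.L_pos.le)
  linarith

lemma le_valueHat_of_good (hr : G.Regime cα cb δ K) (hx : G.IsGood cα δ K h V x) {lo D : ℝ}
    (hD : D ≤ 2 * G.effHorizon) (s : Fin S)
    (hq : ∀ k s ai, G.qHat h V (x k) i s ai ∈ Set.Icc lo (lo + D))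
    (hcap : lo + D ≤ (G.H : ℝ) - h + 1) (ai : Fin (A i)) :
    (⨅ s', V i s') + G.avgGain cα K h V i s id (G.deviationWeights cα K h V x i s ai)
      ≤ G.valueHat cα cb δ K h V x i s + potConst cα cb * G.errScale δ K
          * (G.avgGainVar cα K h V i s (G.deviationWeights cα K h V x i s ai)
            + G.effHorizon) := by
  have hvalue := hr.le_valueHat hD s hq hcap
  have hregret := hr.sum_weightAlpha_mul_qHat_le hD s hq ai
  simp only [Game.qHat_eq, mul_add, sum_add_distrib, ← sum_mul,
    sum_weightAlpha hr.one_le_step hr.one_le_K, one_mul] at hregret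
  have hν := G.deviationWeights_mem cα K h V x i s ai
  have herr := hr.sum_weightAlpha_mul_error_le (fun k _ => Game.gainVar_nonneg (hν k))
    ((hx i s).1 ai)
  simp only [mul_sub, sum_sub_distrib] at herr
  rw [Game.avgGain, roundMean]
  simp only [Game.gainMean] at herr
  have hvar := mul_le_mul_of_nonneg_left (Game.sum_weightAlpha_mul_gainVar_le (G := G) (h := h)
    (V := V) (i := i) (s := s) (ν := G.deviationWeights cα K h V x i s ai) hr.one_le_step
    hr.one_le_K) hr.errScale_pos.le
  have hvar' := mul_le_mul_of_nonneg_right hr.one_le_potConst (mul_nonneg hr.errScale_pos.le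
    (Game.avgGainVar_nonneg (G := G) (h := h) (V := V) (i := i) (s := s) hr.one_le_step
      hr.one_le_K hν))
  have hconst : (16 * cα + 2 + 2 * Real.sqrt cα) * (G.errScale δ K * G.effHorizon)
      ≤ potConst cα cb * (G.errScale δ K * G.effHorizon) := by
    refine mul_le_mul_of_nonneg_right ?_ (mul_nonneg hr.errScale_pos.le hr.L_pos.le)
    rw [potConst]
    linarith [hr.cb_nonneg, hr.cα_pos, mul_nonneg hr.cα_pos.le hr.cb_nonneg]
  linarith

end Game.Regime

end goodData

/-! ### One step of the algorithm -/

section stepBound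
variable {m S : ℕ} {A : Fin m → ℕ}

/-- Step `h` has rewards in `[-1, 1]` and starts from values `V` of span at most `D`, lying below
the cap of the value estimates. The last two conditions keep the spans of `V` and of the gains at
step `h` within the scale of the analysis. -/
structure Game.StepInput (G : Game m S A) (h : ℕ) (V : Fin m → Fin S → ℝ) (D : ℝ) : Prop where
  R_mem : G.R ∈ Set.Icc 0 1
  abs_r_le : ∀ i s a, |G.r i h s a| ≤ 1
  span : ∀ i s s', V i s - V i s' ≤ D
  cap : ∀ i s, V i s ≤ (G.H : ℝ) - h
  span_le : D ≤ 2 * G.effHorizon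
  next_span_le : 2 + (1 - G.R) * D ≤ 2 * G.effHorizon

/-- The coefficient of the quadratic potential that absorbs the variances of a step. -/
def Game.potCoeff (G : Game m S A) (cα cb δ : ℝ) (K : ℕ) : ℝ :=
  2 * (potConst cα cb * G.errScale δ K)

/-- The error of a step with good data, once the variances are absorbed into the potential. -/
def Game.stepError (G : Game m S A) (cα cb δ : ℝ) (K : ℕ) : ℝ :=
  27 * (potConst cα cb * G.errScale δ K * G.effHorizon)

variable {G : Game m S A} {h : ℕ} {V : Fin m → Fin S → ℝ} {D cα cb δ : ℝ} {K : ℕ}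

namespace Game.Regime

lemma potConst_mul_errScale_nonneg (hr : G.Regime cα cb δ K) :
    0 ≤ potConst cα cb * G.errScale δ K :=
  mul_nonneg (by linarith [hr.one_le_potConst]) hr.errScale_pos.le

lemma potCoeff_nonneg (hr : G.Regime cα cb δ K) : 0 ≤ G.potCoeff cα cb δ K :=
  mul_nonneg zero_le_two hr.potConst_mul_errScale_nonneg

lemma stepError_nonneg (hr : G.Regime cα cb δ K) : 0 ≤ G.stepError cα cb δ K :=
  mul_nonneg (by norm_num) (mul_nonneg hr.potConst_mul_errScale_nonneg hr.L_pos.le)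

lemma potCoeff_mul_sq_le (hr : G.Regime cα cb δ K) {U : ℝ} (hU0 : 0 ≤ U)
    (hU : U ≤ 2 * G.effHorizon) : G.potCoeff cα cb δ K * U ^ 2 ≤ G.effHorizon := by
  calc G.potCoeff cα cb δ K * U ^ 2
      ≤ G.potCoeff cα cb δ K * (2 * G.effHorizon) ^ 2 := by
        have := hr.potCoeff_nonneg
        gcongr
    _ = potConst cα cb * G.errScale δ K * (8 * G.effHorizon) * G.effHorizon := by
        rw [Game.potCoeff]; ring
    _ ≤ G.effHorizon := mul_le_of_le_one_left hr.L_pos.le hr.small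

end Game.Regime

lemma Game.StepInput.le_centredGain (hi : G.StepInput h V D) (i : Fin m) (s : Fin S)
    (z : Joint A × Fin S) : -1 ≤ G.centredGain h V i s z := by
  rw [Game.centredGain]
  linarith [(abs_le.1 (hi.abs_r_le i s z.1)).1,
    mul_nonneg (sub_nonneg.2 hi.R_mem.2) (excess_nonneg V i z.2)]

lemma Game.StepInput.le_avgGain (hi : G.StepInput h V D) (hr : G.Regime cα cb δ K)
    {ν : ℕ → (j : Fin m) → Fin (A j) → ℝ} (hν : ∀ k j, ν k j ∈ stdSimplex ℝ (Fin (A j)))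
    (i : Fin m) (s : Fin S) : -1 ≤ G.avgGain cα K h V i s id ν :=
  le_sum_weightAlpha_mul hr.one_le_step hr.one_le_K fun k _ =>
    Game.le_gainMean (hν k) (hi.le_centredGain i s)

section
variable [NeZero S]

lemma Game.StepInput.excess_le (hi : G.StepInput h V D) (i : Fin m) (s : Fin S) :
    excess V i s ≤ D := by
  obtain ⟨t, ht⟩ := exists_eq_finite_iInf (V i)
  rw [excess, ← ht]
  exact hi.span i s t

lemma Game.StepInput.centredGain_le (hi : G.StepInput h V D) (i : Fin m) (s : Fin S)
    (z : Joint A × Fin S) : G.centredGain h V i s z ≤ -1 + (2 + (1 - G.R) * D) := by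
  rw [Game.centredGain]
  linarith [(abs_le.1 (hi.abs_r_le i s z.1)).2,
    mul_le_mul_of_nonneg_left (hi.excess_le i z.2) (sub_nonneg.2 hi.R_mem.2)]

lemma Game.StepInput.avgGain_le (hi : G.StepInput h V D) (hr : G.Regime cα cb δ K)
    {ν : ℕ → (j : Fin m) → Fin (A j) → ℝ} (hν : ∀ k j, ν k j ∈ stdSimplex ℝ (Fin (A j)))
    (i : Fin m) (s : Fin S) : G.avgGain cα K h V i s id ν ≤ -1 + (2 + (1 - G.R) * D) :=
  sum_weightAlpha_mul_le hr.one_le_step hr.one_le_K fun k _ =>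
    Game.gainMean_le (hν k) (hi.centredGain_le i s)

lemma Game.StepInput.exists_qHat_mem_Icc (hi : G.StepInput h V D) (x : ℕ → Sample S A)
    (i : Fin m) : ∃ D' ≤ 2 + (1 - G.R) * D, (⨅ s', V i s') - 1 + D' ≤ (G.H : ℝ) - h + 1 ∧
      ∀ k s ai, G.qHat h V (x k) i s ai
        ∈ Set.Icc ((⨅ s', V i s') - 1) ((⨅ s', V i s') - 1 + D') := by
  refine ⟨min (2 + (1 - G.R) * D) ((G.H : ℝ) - h + 1 - ((⨅ s', V i s') - 1)),
    min_le_left _ _, le_sub_iff_add_le'.1 (min_le_right _ _), fun k s ai => ⟨?_, ?_⟩⟩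
  · rw [Game.qHat_eq]
    linarith [hi.le_centredGain i s (x k i s ai)]
  refine sub_le_iff_le_add'.1 (le_min ?_ ?_)
  · rw [Game.qHat_eq]
    linarith [hi.centredGain_le i s (x k i s ai)]
  · have hrew := (abs_le.1 (hi.abs_r_le i s (x k i s ai).1)).2
    have hnext := mul_le_mul_of_nonneg_left (hi.cap i (x k i s ai).2) (sub_nonneg.2 hi.R_mem.2)
    have hworst := mul_le_mul_of_nonneg_left
      ((finite_iInf_le (V i) s).trans (hi.cap i s)) hi.R_mem.1
    rw [Game.qHat]
    linarith

end

variable [∀ i, NeZero (A i)] {x : ℕ → Sample S A}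

/-- The new values `V'`, corrected by a quadratic potential with coefficient `c`, are up to an
error `f` below the gains of the played policies and above the gain of every action. -/
def Game.StepBound (G : Game m S A) (cα : ℝ) (K h : ℕ) (V : Fin m → Fin S → ℝ)
    (x : ℕ → Sample S A) (V' : Fin m → Fin S → ℝ) (c f : ℝ) : Prop :=
  ∀ i s, V' i s + c * excess V' i s ^ 2
      ≤ roundMean cα K (G.roundWeights cα K h V x s)
          (G.discGain i h s fun s' => V i s' + c * excess V i s' ^ 2)
        + G.R * (⨅ s', V i s') + f ∧
    ∀ ai, roundMean cα K (G.deviationWeights cα K h V x i s ai)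
          (G.discGain i h s fun s' => V i s' + (-c) * excess V i s' ^ 2)
        + G.R * (⨅ s', V i s')
      ≤ V' i s - c * excess V' i s ^ 2 + f

namespace Game.StepInput
variable [NeZero S]

lemma valueHat_span (hi : G.StepInput h V D) (hr : G.Regime cα cb δ K)
    (x : ℕ → Sample S A) (i : Fin m) (s s' : Fin S) :
    G.valueHat cα cb δ K h V x i s - G.valueHat cα cb δ K h V x i s' ≤ 2 + (1 - G.R) * D := by
  obtain ⟨D', hD', -, hq⟩ := hi.exists_qHat_mem_Icc x i
  exact (hr.valueHat_sub_le (hD'.trans hi.next_span_le) hq s s').trans hD'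

lemma excess_valueHat_le (hi : G.StepInput h V D) (hr : G.Regime cα cb δ K)
    (x : ℕ → Sample S A) (i : Fin m) (s : Fin S) :
    excess (G.valueHat cα cb δ K h V x) i s ≤ 2 * G.effHorizon := by
  obtain ⟨t, ht⟩ := exists_eq_finite_iInf (G.valueHat cα cb δ K h V x i)
  rw [excess, ← ht]
  exact (hi.valueHat_span hr x i s t).trans hi.next_span_le

lemma iInf_sub_one_le_valueHat (hi : G.StepInput h V D) (hr : G.Regime cα cb δ K)
    (x : ℕ → Sample S A) (i : Fin m) (s : Fin S) :
    (⨅ s', V i s') - 1 ≤ G.valueHat cα cb δ K h V x i s := by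
  obtain ⟨D', hD', hcap, hq⟩ := hi.exists_qHat_mem_Icc x i
  exact hr.lo_le_valueHat (hD'.trans hi.next_span_le) s hq hcap

lemma valueHat_le (hi : G.StepInput h V D) (hr : G.Regime cα cb δ K)
    (x : ℕ → Sample S A) (i : Fin m) (s : Fin S) :
    G.valueHat cα cb δ K h V x i s ≤ (⨅ s', V i s') + 2 * G.effHorizon := by
  obtain ⟨D', hD', -, hq⟩ := hi.exists_qHat_mem_Icc x i
  linarith [hr.valueHat_le (h := h) (V := V) (x := x) (i := i) s, hr.cb_mul_errScale_mul_le,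
    hr.playedGain_add_le (hD'.trans hi.next_span_le) s hq, hD'.trans hi.next_span_le]

lemma excess_valueHat_le_sub (hi : G.StepInput h V D) (hr : G.Regime cα cb δ K)
    (x : ℕ → Sample S A) (i : Fin m) (s : Fin S) :
    excess (G.valueHat cα cb δ K h V x) i s
      ≤ G.valueHat cα cb δ K h V x i s - (⨅ s', V i s') + 1 := by
  obtain ⟨t, ht⟩ := exists_eq_finite_iInf (G.valueHat cα cb δ K h V x i)
  rw [excess, ← ht]
  linarith [hi.iInf_sub_one_le_valueHat hr x i t]

lemma stepBound_of_isGood (hi : G.StepInput h V D) (hr : G.Regime cα cb δ K)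
    (hx : G.IsGood cα δ K h V x) :
    G.StepBound cα K h V x (G.valueHat cα cb δ K h V x) (G.potCoeff cα cb δ K)
      (G.stepError cα cb δ K) := by
  intro i s
  have hU0 := excess_nonneg (G.valueHat cα cb δ K h V x) i s
  have hU := hi.excess_valueHat_le hr x i s
  have hUv := hi.excess_valueHat_le_sub hr x i s
  have hsq : ∀ {ν : ℕ → (j : Fin m) → Fin (A j) → ℝ},
      (∀ k j, ν k j ∈ stdSimplex ℝ (Fin (A j))) → G.avgGain cα K h V i s (· ^ 2) ν
        ≤ roundMean cα K ν (G.nextQuad h V i s) + (1 + 4 * G.effHorizon) := fun hν =>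
    Game.avgGain_sq_le hr.one_le_step hr.one_le_K hν hi.R_mem (hi.abs_r_le i s)
      fun s' => (hi.excess_le i s').trans hi.span_le
  refine ⟨?_, fun ai => ?_⟩
  · have hν := G.roundWeights_mem cα K h V x s
    rw [Game.roundMean_discGain hr.one_le_step hr.one_le_K hν]
    exact add_potential_le hr.potConst_mul_errScale_nonneg hr.one_le_L hr.small hU0 hU hUv
      (hsq hν) (Game.avgGainVar_nonneg hr.one_le_step hr.one_le_K hν) (hr.valueHat_le_of_good hx s)
  · have hν := G.deviationWeights_mem cα K h V x i s ai
    obtain ⟨D', hD', hcap, hq⟩ := hi.exists_qHat_mem_Icc x i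
    rw [Game.roundMean_discGain hr.one_le_step hr.one_le_K hν, neg_mul, ← sub_eq_add_neg]
    exact le_sub_potential hr.potConst_mul_errScale_nonneg hr.one_le_L hr.small hU0 hU hUv
      (hsq hν) (Game.avgGainVar_nonneg hr.one_le_step hr.one_le_K hν)
      (hr.le_valueHat_of_good hx (hD'.trans hi.next_span_le) s hq hcap ai)

lemma stepBound (hi : G.StepInput h V D) (hr : G.Regime cα cb δ K) (x : ℕ → Sample S A) :
    G.StepBound cα K h V x (G.valueHat cα cb δ K h V x) (G.potCoeff cα cb δ K)
      (G.stepError cα cb δ K + 5 * G.effHorizon) := by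
  intro i s
  have hL := hr.one_le_L
  have hpot := hr.potCoeff_mul_sq_le (excess_nonneg _ i s) (hi.excess_valueHat_le hr x i s)
  have hquad : ∀ {ν : ℕ → (j : Fin m) → Fin (A j) → ℝ},
      (∀ k j, ν k j ∈ stdSimplex ℝ (Fin (A j))) →
      0 ≤ G.potCoeff cα cb δ K * roundMean cα K ν (G.nextQuad h V i s) := fun hν =>
    mul_nonneg hr.potCoeff_nonneg ((roundMean_const hr.one_le_step hr.one_le_K hν 0).symm.le.trans
      (roundMean_mono hr.one_le_step hν (Game.nextQuad_nonneg hi.R_mem.2)))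
  refine ⟨?_, fun ai => ?_⟩
  · have hν := G.roundWeights_mem cα K h V x s
    rw [Game.roundMean_discGain hr.one_le_step hr.one_le_K hν]
    linarith [hquad hν, hi.le_avgGain hr hν i s, hi.valueHat_le hr x i s, hr.stepError_nonneg]
  · have hν := G.deviationWeights_mem cα K h V x i s ai
    rw [Game.roundMean_discGain hr.one_le_step hr.one_le_K hν]
    linarith [hquad hν, hi.avgGain_le hr hν i s, hi.iInf_sub_one_le_valueHat hr x i s,
      hr.stepError_nonneg, hi.next_span_le]

lemma pexp_not_isGood_le (hi : G.StepInput h V D) (hr : G.Regime cα cb δ K) :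
    pexp (G.roundsLaw cα K h V K) ({x | ¬ G.IsGood cα δ K h V x}.indicator 1)
      ≤ (∑ i, ∑ _s : Fin S, ((A i : ℝ≥0∞) + 2))
        * ENNReal.ofReal (Real.exp (-(8 * logFactor S A δ K))) := by
  have hweight := fun k hk => weightAlpha_nonneg (k := k) hr.one_le_step hk
  refine Game.pexp_not_goodData_le (lo := -1) (D := 2 * G.effHorizon)
    (fun k hk => mul_nonneg hr.gainParam_pos.le (hweight k hk))
    (fun k hk => mul_nonneg hr.varParam_pos.le (hweight k hk)) (fun k hk => ?_)
    (fun k hk => hr.varParam_mul_weightAlpha_le hk) hi.le_centredGain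
    (fun i s z => (hi.centredGain_le i s z).trans (by linarith [hi.next_span_le])) _
  have hL := hr.L_pos
  calc G.gainParam cα δ K * weightAlpha cα K k * (2 * G.effHorizon)
      ≤ G.errScale δ K * (2 * G.effHorizon) := by gcongr; exact hr.gainParam_mul_weightAlpha_le hk
    _ ≤ 1 := by linarith [hr.errScale_mul_le, mul_pos hr.errScale_pos hL]

end Game.StepInput

end stepBound

/-! ### The induction over the steps -/

/-- The state of the algorithm between two steps: the current value estimates, and the policies
found at the steps processed so far. -/
abbrev RunState (S : ℕ) (A : Fin 2 → ℕ) : Type := (Fin 2 → Fin S → ℝ) × Profile S A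

lemma Game.sum_pow_le_effHorizon {m S : ℕ} {A : Fin m → ℕ} {G : Game m S A} (hR0 : 0 ≤ G.R)
    (hR1 : G.R < 1) {n : ℕ} (hn : n ≤ G.H) :
    ∑ j ∈ range n, (1 - G.R) ^ j ≤ G.effHorizon := by
  have hH : ∑ j ∈ range n, (1 - G.R) ^ j ≤ G.H := by
    calc ∑ j ∈ range n, (1 - G.R) ^ j ≤ ∑ _j ∈ range n, (1 : ℝ) :=
          sum_le_sum fun j _ => pow_le_one₀ (by linarith) (by linarith)
      _ = n := by simp
      _ ≤ G.H := by exact_mod_cast hn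
  rw [Game.effHorizon]
  split_ifs with hR
  · exact hH
  refine le_min hH ?_
  rw [le_div_iff₀ (lt_of_le_of_ne hR0 (Ne.symm hR))]
  linarith [geom_sum_mul (1 - G.R) n, pow_nonneg (sub_nonneg.2 hR1.le) n]

section induction
variable {S : ℕ} {A : Fin 2 → ℕ} {G : Game 2 S A}

lemma Game.IsZeroSum.abs_r_le (hG : G.IsZeroSum) {h : ℕ} (hh : h ∈ Icc 1 G.H) (i : Fin 2)
    (s : Fin S) (a : Joint A) : |G.r i h s a| ≤ 1 := by
  obtain ⟨⟨hr0, hr1⟩, hneg⟩ := hG h hh s a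
  have h0 : |G.r 0 h s a| ≤ 1 := by rwa [abs_of_nonneg hr0]
  fin_cases i
  · exact h0
  · simpa only [Fin.mk_one, hneg, abs_neg] using h0

lemma Game.bestDisc_congr {π π' : Profile S A} (i : Fin 2) {n : ℕ}
    (h : ∀ j, ∀ k < n, π j (G.H - k) = π' j (G.H - k)) :
    G.bestDisc π i n = G.bestDisc π' i n := by
  induction n with
  | zero => rfl
  | succ n ih =>
    funext s
    rw [Game.bestDisc, Game.bestDisc, ih fun j k hk => h j k (by lia)]
    simp only [h _ n (Nat.lt_succ_self n)]

lemma Game.discGain_add_const (i : Fin 2) (h : ℕ) (s : Fin S) (W : Fin S → ℝ) (c : ℝ)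
    (a : Joint A) :
    G.discGain i h s (fun s' => W s' + c) a = G.discGain i h s W a + (1 - G.R) * c := by
  rw [Game.discGain, Game.discGain, mean_add, mean_const]
  ring

lemma sum_mul_prodMean_update {κ : Type*} (t : Finset κ) (w : κ → ℝ)
    (ν : κ → (j : Fin 2) → Fin (A j) → ℝ) (i : Fin 2) (p : Fin (A i) → ℝ) (F : Joint A → ℝ) :
    ∑ k ∈ t, w k * prodMean (Function.update (ν k) i p) F
      = prodMean (Function.update (fun j a => ∑ k ∈ t, w k * ν k j a) i p) F := by
  obtain ⟨j, hj⟩ : ∃ j : Fin 2, j ≠ i := exists_ne i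
  -- Only the weights of the single opponent `j` of `i` are left to average.
  have hopp : ∀ μ : (j : Fin 2) → Fin (A j) → ℝ, Function.update μ i p
      = Function.update (Function.update (fun (l : Fin 2) (_ : Fin (A l)) => (0 : ℝ)) i p)
          j (μ j) := by
    intro μ
    funext l
    rcases (by lia : l = i ∨ l = j) with rfl | rfl
    · rw [Function.update_self, Function.update_of_ne hj.symm, Function.update_self]
    · rw [Function.update_self, Function.update_of_ne hj]
  rw [hopp, prodMean_update_sum]
  exact sum_congr rfl fun k _ => by rw [hopp]

lemma Game.IsZeroSum.roundMean_discGain_add_le (hG : G.IsZeroSum) (hR1 : G.R ≤ 1) {cα : ℝ}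
    {K h : ℕ} (hc : 1 ≤ cα * Real.log K) (hK : 1 ≤ K) (hh : h ∈ Icc 1 G.H)
    {ν : ℕ → (j : Fin 2) → Fin (A j) → ℝ} (hν : ∀ k j, ν k j ∈ stdSimplex ℝ (Fin (A j)))
    (s : Fin S) {W W' : Fin S → ℝ} {b : ℝ} (hW : ∀ s', W s' + W' s' ≤ b) :
    roundMean cα K ν (G.discGain 0 h s W) + roundMean cα K ν (G.discGain 1 h s W')
      ≤ (1 - G.R) * b := by
  rw [← roundMean_add, ← roundMean_const hc hK hν ((1 - G.R) * b)]
  refine roundMean_mono hc hν fun a => ?_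
  rw [hG.discGain_add hh]
  exact mul_le_mul_of_nonneg_left (mean_le _ _ hW) (sub_nonneg.2 hR1)

/-- The values of `o` bracket the optimal discounted values against its policies with `n` steps to
go, up to the error `e`: lowered by a quadratic potential they dominate these optimal values, and
raised by it they have a small sum. The shifts `k` are the accumulated contributions `R min V` of
the contamination to the values. -/
structure Game.Brackets (G : Game 2 S A) (c : ℝ) (n : ℕ) (o : RunState S A) (k : Fin 2 → ℝ)
    (e : ℝ) : Prop where
  bestDisc_le : ∀ i s, G.bestDisc o.2 i n s ≤ o.1 i s - k i - c * excess o.1 i s ^ 2 + e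
  sum_le : ∀ s, ∑ i, (o.1 i s - k i + c * excess o.1 i s ^ 2) ≤ 2 * e

lemma Game.Brackets.bestDisc_add_le {c : ℝ} {n : ℕ} {o : RunState S A} {k : Fin 2 → ℝ} {e : ℝ}
    (hc : 0 ≤ c) (hB : G.Brackets c n o k e) (s : Fin S) :
    G.bestDisc o.2 0 n s + G.bestDisc o.2 1 n s ≤ 4 * e := by
  have hsum := hB.sum_le s
  rw [Fin.sum_univ_two] at hsum
  linarith [hB.bestDisc_le 0 s, hB.bestDisc_le 1 s, mul_nonneg hc (sq_nonneg (excess o.1 0 s)),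
    mul_nonneg hc (sq_nonneg (excess o.1 1 s))]

/-- What is known after `n` steps of which at most `N` were exceptional: the values have
controlled span, and they bracket the optimal discounted values. The errors `e j` of all stages
`j` are recorded, since they all enter the equilibrium gap; a step costs `f`, and an exceptional
one a further multiple of the effective horizon. -/
structure Game.RunInvariant (G : Game 2 S A) (c f : ℝ) (n : ℕ) (o : RunState S A) (N : ℕ) :
    Prop where
  profile : ∀ i, ∀ h ∈ Icc (G.H - n + 1) G.H, ∀ s, o.2 i h s ∈ stdSimplex ℝ (Fin (A i))
  span : ∀ i s s', o.1 i s - o.1 i s' ≤ 2 * ∑ j ∈ range n, (1 - G.R) ^ j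
  cap : ∀ i s, o.1 i s ≤ n
  exists_brackets : ∃ (k : Fin 2 → ℝ) (e : ℕ → ℝ), G.Brackets c n o k (e n) ∧
    (∀ j < n, ∀ s, G.bestDisc o.2 0 j s + G.bestDisc o.2 1 j s ≤ 4 * e j) ∧
    e n + G.R * ∑ j ∈ range n, e j ≤ n * f + N * (5 * G.effHorizon)

lemma Game.runInvariant_zero [NeZero S] (c f : ℝ) : G.RunInvariant c f 0 (0, 0) 0 where
  profile := by
    intro i h hh
    simp only [mem_Icc] at hh
    lia
  span := by simp
  cap := by simp
  exists_brackets := ⟨0, 0, ⟨by simp [Game.bestDisc, excess], by simp [excess]⟩, by simp, by simp⟩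

/-- The least number of exceptional steps compatible with a state, infinite if there is none. -/
def Game.badCount (G : Game 2 S A) (c f : ℝ) (n : ℕ) (o : RunState S A) : ℝ≥0∞ :=
  ⨅ N : ℕ, ⨅ _ : G.RunInvariant c f n o N, (N : ℝ≥0∞)

lemma Game.exists_runInvariant_of_badCount_lt {c f t : ℝ} {n : ℕ} {o : RunState S A}
    (h : G.badCount c f n o < ENNReal.ofReal t) :
    ∃ N : ℕ, (N : ℝ) < t ∧ G.RunInvariant c f n o N := by
  simp only [Game.badCount, iInf_lt_iff] at h
  obtain ⟨N, hI, hN⟩ := h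
  rw [← ENNReal.ofReal_natCast] at hN
  exact ⟨N, (ENNReal.ofReal_lt_ofReal_iff_of_nonneg N.cast_nonneg).1 hN, hI⟩

lemma Game.RunInvariant.isRobustNE [NeZero S] [∀ i, NeZero (A i)] {c f ε : ℝ} {N : ℕ}
    {o : RunState S A} (hG : G.IsZeroSum) (hR0 : 0 ≤ G.R) (hR1 : G.R ≤ 1) (hc : 0 ≤ c)
    (hI : G.RunInvariant c f G.H o N) (hε : 4 * (G.H * f + N * (5 * G.effHorizon)) ≤ ε) :
    G.IsRobustNE ε o.2 := by
  obtain ⟨k, e, hB, hpast, herr⟩ := hI.exists_brackets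
  have hprofile : G.IsProfile o.2 := fun i h hh => hI.profile i h (by simpa using hh)
  refine ⟨hprofile, (hG.gapNE_le hR0 hR1 hprofile (fun j => 4 * e j) fun n hn s => ?_).trans ?_⟩
  · rcases hn.lt_or_eq with hlt | rfl
    · exact hpast n hlt s
    · exact hB.bestDisc_add_le hc s
  · rw [← mul_sum]
    linarith

lemma Game.RunInvariant.stepInput {c f : ℝ} {n N : ℕ} {o : RunState S A}
    (hG : G.IsZeroSum) (hR0 : 0 ≤ G.R) (hR1 : G.R < 1) (hn : n < G.H)
    (hI : G.RunInvariant c f n o N) :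
    G.StepInput (G.H - n) o.1 (2 * ∑ j ∈ range n, (1 - G.R) ^ j) where
  R_mem := ⟨hR0, hR1.le⟩
  abs_r_le := hG.abs_r_le (Game.sub_mem_Icc hn)
  span := hI.span
  cap i s := by
    rw [Nat.cast_sub hn.le]
    linarith [hI.cap i s]
  span_le := mul_le_mul_of_nonneg_left (Game.sum_pow_le_effHorizon hR0 hR1 hn.le) zero_le_two
  next_span_le := by
    have hnext := Game.sum_pow_le_effHorizon hR0 hR1 (Nat.succ_le_of_lt hn)
    rw [sum_range_succ', pow_zero] at hnext
    simp only [pow_succ', ← mul_sum] at hnext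
    linarith

variable [∀ i, NeZero (A i)] {cα cb δ : ℝ} {K : ℕ}

/-- The state after one more step with the data `x`. -/
def Game.stepState (G : Game 2 S A) (cα cb δ : ℝ) (K n : ℕ) (o : RunState S A)
    (x : ℕ → Sample S A) : RunState S A :=
  (G.valueHat cα cb δ K (G.H - n) o.1 x,
    fun i => Function.update (o.2 i) (G.H - n) (G.avgPolicy cα K (G.H - n) o.1 x i))

lemma Game.run_succ [NeZero S] (n : ℕ) :
    G.run cα cb δ K (n + 1) = (G.run cα cb δ K n).bind fun o =>
      (G.roundsLaw cα K (G.H - n) o.1 K).map (G.stepState cα cb δ K n o) :=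
  rfl

lemma Game.roundMean_deviationWeights (h : ℕ) (V : Fin 2 → Fin S → ℝ) (x : ℕ → Sample S A)
    (i : Fin 2) (s : Fin S) (ai : Fin (A i)) (F : Joint A → ℝ) :
    roundMean cα K (G.deviationWeights cα K h V x i s ai) F
      = prodMean (Function.update (fun j => G.avgPolicy cα K h V x j s) i (Pi.single ai 1)) F :=
  sum_mul_prodMean_update (Icc 1 K) (weightAlpha cα K) (G.roundWeights cα K h V x s) i _ F

lemma Game.avgPolicy_mem (hc : 1 ≤ cα * Real.log K) (hK : 1 ≤ K) (h : ℕ)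
    (V : Fin 2 → Fin S → ℝ) (x : ℕ → Sample S A) (i : Fin 2) (s : Fin S) :
    G.avgPolicy cα K h V x i s ∈ stdSimplex ℝ (Fin (A i)) := by
  refine ⟨fun a => sum_nonneg fun k hk =>
    mul_nonneg (weightAlpha_nonneg hc hk) (simplex_nonneg _ _), ?_⟩
  simp only [Game.avgPolicy]
  rw [sum_comm]
  simp only [← mul_sum, simplex_sum, mul_one]
  exact sum_weightAlpha hc hK

section stepState
variable {n : ℕ} (o : RunState S A) (x : ℕ → Sample S A)

lemma Game.stepState_snd_self (j : Fin 2) :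
    (G.stepState cα cb δ K n o x).2 j (G.H - n) = G.avgPolicy cα K (G.H - n) o.1 x j :=
  Function.update_self ..

lemma Game.stepState_snd_of_ne {h : ℕ} (hh : h ≠ G.H - n) (j : Fin 2) :
    (G.stepState cα cb δ K n o x).2 j h = o.2 j h :=
  Function.update_of_ne hh ..

lemma Game.bestDisc_stepState (hn : n < G.H) (i : Fin 2) {j : ℕ} (hj : j ≤ n) :
    G.bestDisc (G.stepState cα cb δ K n o x).2 i j = G.bestDisc o.2 i j :=
  Game.bestDisc_congr i fun l r hr => Game.stepState_snd_of_ne o x (by lia) l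

end stepState

variable {c f f' : ℝ} {n N N' : ℕ} {o : RunState S A} {x : ℕ → Sample S A}

lemma Game.Brackets.step (hG : G.IsZeroSum) (hR1 : G.R ≤ 1) (hc : 1 ≤ cα * Real.log K)
    (hK : 1 ≤ K) (hn : n < G.H) {k : Fin 2 → ℝ} {e : ℝ} (hB : G.Brackets c n o k e)
    (hb : G.StepBound cα K (G.H - n) o.1 x (G.valueHat cα cb δ K (G.H - n) o.1 x) c f') :
    G.Brackets c (n + 1) (G.stepState cα cb δ K n o x)
      (fun i => (1 - G.R) * k i + G.R * ⨅ s', o.1 i s') ((1 - G.R) * e + f') where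
  bestDisc_le i s := by
    rw [Game.bestDisc]
    refine ciSup_le fun ai => ?_
    have hν := G.deviationWeights_mem cα K (G.H - n) o.1 x i s ai
    simp only [Game.stepState_snd_self, Game.bestDisc_stepState o x hn i le_rfl]
    rw [← Game.roundMean_deviationWeights]
    have hgain : roundMean cα K (G.deviationWeights cα K (G.H - n) o.1 x i s ai)
          (G.discGain i (G.H - n) s (G.bestDisc o.2 i n))
        ≤ roundMean cα K (G.deviationWeights cα K (G.H - n) o.1 x i s ai)
            (G.discGain i (G.H - n) s fun s' => o.1 i s' + (-c) * excess o.1 i s' ^ 2)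
          + (1 - G.R) * (e - k i) := by
      rw [← roundMean_const hc hK hν ((1 - G.R) * (e - k i)), ← roundMean_add]
      refine roundMean_mono hc hν fun a => ?_
      rw [← Game.discGain_add_const]
      exact Game.discGain_mono hR1 i _ s (fun s' => by linarith [hB.bestDisc_le i s']) a
    simp only [Game.stepState]
    linarith [(hb i s).2 ai]
  sum_le s := by
    have hgain := hG.roundMean_discGain_add_le hR1 hc hK (Game.sub_mem_Icc hn)
      (G.roundWeights_mem cα K (G.H - n) o.1 x s) s (b := 2 * e + k 0 + k 1)
      (W := fun s' => o.1 0 s' + c * excess o.1 0 s' ^ 2)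
      (W' := fun s' => o.1 1 s' + c * excess o.1 1 s' ^ 2) fun s' => by
        have hsum := hB.sum_le s'
        rw [Fin.sum_univ_two] at hsum
        linarith
    simp only [Game.stepState, Fin.sum_univ_two]
    linarith [(hb 0 s).1, (hb 1 s).1]

variable [NeZero S]

lemma Game.RunInvariant.step (hG : G.IsZeroSum) (hR0 : 0 ≤ G.R) (hR1 : G.R < 1) (hc : 0 ≤ c)
    (hr : G.Regime cα cb δ K) (hn : n < G.H) (hI : G.RunInvariant c f n o N)
    (hb : G.StepBound cα K (G.H - n) o.1 x (G.valueHat cα cb δ K (G.H - n) o.1 x) c f')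
    (hf : f' + N * (5 * G.effHorizon) ≤ f + N' * (5 * G.effHorizon)) :
    G.RunInvariant c f (n + 1) (G.stepState cα cb δ K n o x) N' where
  profile i h hh s := by
    rcases eq_or_ne h (G.H - n) with rfl | hne
    · rw [Game.stepState_snd_self]
      exact Game.avgPolicy_mem hr.one_le_step hr.one_le_K _ _ _ i s
    · rw [Game.stepState_snd_of_ne _ _ hne]
      refine hI.profile i h ?_ s
      simp only [mem_Icc] at hh ⊢
      lia
  span i s s' := by
    refine ((hI.stepInput hG hR0 hR1 hn).valueHat_span hr x i s s').trans (le_of_eq ?_)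
    rw [sum_range_succ']
    simp only [pow_zero, pow_succ', ← mul_sum]
    ring
  cap i s := by
    refine (min_le_right _ _).trans (le_of_eq ?_)
    rw [Nat.cast_sub hn.le]
    push_cast
    ring
  exists_brackets := by
    obtain ⟨k, e, hB, hpast, herr⟩ := hI.exists_brackets
    have he : ∀ j < n + 1, Function.update e (n + 1) ((1 - G.R) * e n + f') j = e j :=
      fun j hj => Function.update_of_ne hj.ne ..
    refine ⟨fun i => (1 - G.R) * k i + G.R * ⨅ s', o.1 i s',
      Function.update e (n + 1) ((1 - G.R) * e n + f'), ?_, fun j hj s => ?_, ?_⟩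
    · rw [Function.update_self]
      exact hB.step hG hR1.le hr.one_le_step hr.one_le_K hn hb
    · rw [he j hj, Game.bestDisc_stepState o x hn 0 (Nat.le_of_lt_succ hj),
        Game.bestDisc_stepState o x hn 1 (Nat.le_of_lt_succ hj)]
      rcases Nat.lt_succ_iff_lt_or_eq.1 hj with hlt | rfl
      · exact hpast j hlt s
      · exact hB.bestDisc_add_le hc s
    · rw [Function.update_self, sum_congr rfl fun j hj => he j (mem_range.1 hj), sum_range_succ]
      push_cast
      linarith

namespace Game.Regime

lemma pexp_badCount_stepState_le (hr : G.Regime cα cb δ K) (hG : G.IsZeroSum) (hR0 : 0 ≤ G.R)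
    (hR1 : G.R < 1) (hn : n < G.H) (o : RunState S A) :
    pexp (G.roundsLaw cα K (G.H - n) o.1 K) (fun x =>
        G.badCount (G.potCoeff cα cb δ K) (G.stepError cα cb δ K) (n + 1)
          (G.stepState cα cb δ K n o x))
      ≤ G.badCount (G.potCoeff cα cb δ K) (G.stepError cα cb δ K) n o
        + (∑ i, ∑ _s : Fin S, ((A i : ℝ≥0∞) + 2))
          * ENNReal.ofReal (Real.exp (-(8 * logFactor S A δ K))) := by
  refine (le_iInf fun N => ?_).trans_eq ENNReal.iInf_add.symm
  refine (le_iInf fun hI => ?_).trans_eq ENNReal.iInf_add.symm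
  have hi := hI.stepInput hG hR0 hR1 hn
  have hc := hr.potCoeff_nonneg
  have hcount : ∀ x, G.badCount (G.potCoeff cα cb δ K) (G.stepError cα cb δ K) (n + 1)
        (G.stepState cα cb δ K n o x)
      ≤ N + {x | ¬ G.IsGood cα δ K (G.H - n) o.1 x}.indicator 1 x := by
    intro x
    by_cases hx : G.IsGood cα δ K (G.H - n) o.1 x
    · rw [Set.indicator_of_notMem (by simpa using hx), add_zero]
      exact iInf₂_le N (hI.step hG hR0 hR1 hc hr hn (hi.stepBound_of_isGood hr hx) le_rfl)
    · rw [Set.indicator_of_mem (by simpa using hx)]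
      refine (iInf₂_le (N + 1) (hI.step hG hR0 hR1 hc hr hn (hi.stepBound hr x) ?_)).trans ?_
      · push_cast
        linarith
      · simp
  refine (pexp_mono _ hcount).trans ?_
  rw [pexp_add, pexp_const]
  exact add_le_add le_rfl (hi.pexp_not_isGood_le hr)

lemma pexp_badCount_le (hr : G.Regime cα cb δ K) (hG : G.IsZeroSum) (hR0 : 0 ≤ G.R)
    (hR1 : G.R < 1) {n : ℕ} (hn : n ≤ G.H) :
    pexp (G.run cα cb δ K n) (G.badCount (G.potCoeff cα cb δ K) (G.stepError cα cb δ K) n)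
      ≤ n * ((∑ i, ∑ _s : Fin S, ((A i : ℝ≥0∞) + 2))
        * ENNReal.ofReal (Real.exp (-(8 * logFactor S A δ K)))) := by
  induction n with
  | zero =>
    rw [Game.run, pexp_pure]
    exact (iInf₂_le 0 (Game.runInvariant_zero _ _)).trans (by simp)
  | succ n ih =>
    simp only [Game.run_succ, pexp_bind, pexp_map]
    refine (pexp_mono _ (hr.pexp_badCount_stepState_le hG hR0 hR1 hn)).trans ?_
    rw [pexp_add, pexp_const, Nat.cast_add, Nat.cast_one, add_mul, one_mul]
    exact add_le_add (ih (Nat.le_of_succ_le hn)) le_rfl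

end Game.Regime

end induction

/-! ### The sample size -/

section sampleSize
variable {S : ℕ} {A : Fin 2 → ℕ}

/-- The smallest admissible constant `c_b` of the bonus. -/
def bonusThreshold (cα : ℝ) : ℝ := 4 * Real.sqrt (cα * burnInRatio cα)

lemma bonusThreshold_pos {cα : ℝ} (hα : 0 < cα) : 0 < bonusThreshold cα :=
  mul_pos four_pos (Real.sqrt_pos.2 (mul_pos hα (burnInRatio_pos cα)))

/-- The constant `C` of the sample size condition. The first two terms make the step sizes
admissible, the third one makes the accumulated step errors small, and the last one makes the
expected number of bad steps small. -/
def sampleConst (cα cb : ℝ) : ℝ :=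
  8 * (cα * burnInRatio cα) + 8 * Real.exp (1 / cα) + (216 * potConst cα cb) ^ 2 + 960

/-- The conditions on the constants, on the accuracy `ε`, on the failure probability `δ` and on the
number `K` of rounds, the sample size condition being divided by `H S (A_1 + A_2)`. -/
structure Game.EnoughSamples (G : Game 2 S A) (cα cb δ ε : ℝ) (K : ℕ) : Prop where
  cα_pos : 0 < cα
  bonusThreshold_le : bonusThreshold cα ≤ cb
  R_nonneg : 0 ≤ G.R
  R_lt_one : G.R < 1
  ε_pos : 0 < ε
  ε_le : ε ≤ G.H
  δ_pos : 0 < δ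
  δ_lt_one : δ < 1
  one_le_K : 1 ≤ K
  le_mul_sq : sampleConst cα cb * (G.H : ℝ) ^ 2 * G.effHorizon * logFactor S A δ K ^ 3 ≤ K * ε ^ 2

lemma mul_sq_le_of_sampleSize {C ε H S T L ι K : ℝ} (hε : 0 < ε) (hH : 0 < H) (hS : 0 < S)
    (hT : 0 < T) (h : C * H ^ 3 * S * T / ε ^ 2 * L * ι ^ 3 ≤ K * H * S * T) :
    C * H ^ 2 * L * ι ^ 3 ≤ K * ε ^ 2 := by
  refine le_of_mul_le_mul_right ?_ (mul_pos hH (mul_pos hS hT))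
  calc C * H ^ 2 * L * ι ^ 3 * (H * (S * T)) = C * H ^ 3 * S * T / ε ^ 2 * L * ι ^ 3 * ε ^ 2 := by
        field_simp
    _ ≤ K * H * S * T * ε ^ 2 := mul_le_mul_of_nonneg_right h (sq_nonneg ε)
    _ = K * ε ^ 2 * (H * (S * T)) := by ring

lemma le_sampleConst {cα : ℝ} (cb : ℝ) (hα : 0 < cα) :
    8 * (cα * burnInRatio cα) ≤ sampleConst cα cb ∧ 8 * Real.exp (1 / cα) ≤ sampleConst cα cb ∧
      (216 * potConst cα cb) ^ 2 ≤ sampleConst cα cb ∧ 960 ≤ sampleConst cα cb := by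
  have hburn := mul_pos hα (burnInRatio_pos cα)
  have hexp := Real.exp_pos (1 / cα)
  have hsq := sq_nonneg (216 * potConst cα cb)
  rw [sampleConst]
  refine ⟨?_, ?_, ?_, ?_⟩ <;> linarith

lemma sampleConst_pos {cα : ℝ} (cb : ℝ) (hα : 0 < cα) : 0 < sampleConst cα cb := by
  linarith [(le_sampleConst cb hα).2.2.2]

namespace Game.EnoughSamples
variable {G : Game 2 S A} {cα cb δ ε : ℝ} {K : ℕ}

lemma K_pos (hs : G.EnoughSamples cα cb δ ε K) : (0 : ℝ) < K := by exact_mod_cast hs.one_le_K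

lemma H_pos (hs : G.EnoughSamples cα cb δ ε K) : (0 : ℝ) < G.H := hs.ε_pos.trans_le hs.ε_le

lemma one_le_L (hs : G.EnoughSamples cα cb δ ε K) : 1 ≤ G.effHorizon := by
  have hH : 1 ≤ G.H := by exact_mod_cast hs.H_pos
  simpa using Game.sum_pow_le_effHorizon hs.R_nonneg hs.R_lt_one hH

lemma log_le_logFactor (hs : G.EnoughSamples cα cb δ ε K) {y : ℝ} (hy : 0 < y)
    (hle : y ≤ K * S * ∑ j, (A j : ℝ)) : Real.log y ≤ logFactor S A δ K := by
  refine Real.log_le_log hy (hle.trans ?_)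
  rw [le_div_iff₀ hs.δ_pos]
  exact mul_le_of_le_one_right (hy.le.trans hle) hs.δ_lt_one.le

variable [NeZero S] [∀ i, NeZero (A i)]

lemma log_two_add_log_K_le (hs : G.EnoughSamples cα cb δ ε K) :
    Real.log 2 + Real.log K ≤ logFactor S A δ K := by
  have hK := hs.K_pos
  have hS : (1 : ℝ) ≤ S := by exact_mod_cast NeZero.one_le
  have hA : (2 : ℝ) ≤ ∑ j, (A j : ℝ) := by
    simpa using card_nsmul_le_sum univ (fun j => (A j : ℝ)) 1
      fun j _ => by exact_mod_cast NeZero.one_le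
  rw [add_comm, ← Real.log_mul hK.ne' two_ne_zero]
  refine hs.log_le_logFactor (by positivity) ?_
  calc (K : ℝ) * 2 = K * 1 * 2 := by rw [mul_one]
    _ ≤ K * S * ∑ j, (A j : ℝ) := by gcongr

lemma log_A_le (hs : G.EnoughSamples cα cb δ ε K) (i : Fin 2) :
    Real.log (A i) ≤ logFactor S A δ K := by
  have hK : (1 : ℝ) ≤ K := by exact_mod_cast hs.one_le_K
  have hS : (1 : ℝ) ≤ S := by exact_mod_cast NeZero.one_le
  refine hs.log_le_logFactor (by exact_mod_cast NeZero.pos (A i)) ?_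
  calc (A i : ℝ) ≤ ∑ j, (A j : ℝ) :=
        single_le_sum (f := fun j => (A j : ℝ)) (fun j _ => Nat.cast_nonneg _) (mem_univ i)
    _ ≤ K * S * ∑ j, (A j : ℝ) := le_mul_of_one_le_left
        (sum_nonneg fun j _ => Nat.cast_nonneg _) (one_le_mul_of_one_le_of_one_le hK hS)

lemma half_le_logFactor (hs : G.EnoughSamples cα cb δ ε K) : 1 / 2 ≤ logFactor S A δ K := by
  have hlogK : 0 ≤ Real.log K := Real.log_natCast_nonneg K
  linarith [hs.log_two_add_log_K_le, Real.log_two_gt_d9]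

lemma eighth_le_logFactor_cube (hs : G.EnoughSamples cα cb δ ε K) :
    1 / 8 ≤ logFactor S A δ K ^ 3 := by
  have := pow_le_pow_left₀ one_half_pos.le hs.half_le_logFactor 3
  linarith

lemma exp_neg_logFactor (hs : G.EnoughSamples cα cb δ ε K) :
    Real.exp (-logFactor S A δ K) = δ / (K * S * ∑ j, (A j : ℝ)) := by
  have hK := hs.K_pos
  have hδ := hs.δ_pos
  have hS : (0 : ℝ) < S := by exact_mod_cast NeZero.pos S
  have hA : (0 : ℝ) < ∑ j, (A j : ℝ) :=
    sum_pos (fun j _ => by exact_mod_cast NeZero.pos (A j)) univ_nonempty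
  rw [logFactor, Real.exp_neg, Real.exp_log (by positivity), inv_div]

lemma mul_effHorizon_mul_cube_le (hs : G.EnoughSamples cα cb δ ε K) :
    sampleConst cα cb * (G.effHorizon * logFactor S A δ K ^ 3) ≤ K := by
  have hC := sampleConst_pos cb hs.cα_pos
  have hL := hs.one_le_L
  have hε := hs.ε_pos
  have hlog := hs.half_le_logFactor
  refine le_of_mul_le_mul_right (le_trans ?_ hs.le_mul_sq) (pow_pos hε 2)
  calc sampleConst cα cb * (G.effHorizon * logFactor S A δ K ^ 3) * ε ^ 2
      = sampleConst cα cb * ε ^ 2 * G.effHorizon * logFactor S A δ K ^ 3 := by ring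
    _ ≤ sampleConst cα cb * (G.H : ℝ) ^ 2 * G.effHorizon * logFactor S A δ K ^ 3 := by
        gcongr
        exact hs.ε_le

lemma mul_cube_le (hs : G.EnoughSamples cα cb δ ε K) :
    sampleConst cα cb * logFactor S A δ K ^ 3 ≤ K := by
  have hC := sampleConst_pos cb hs.cα_pos
  have hlog := hs.half_le_logFactor
  refine le_trans ?_ hs.mul_effHorizon_mul_cube_le
  gcongr
  exact le_mul_of_one_le_left (by positivity) hs.one_le_L

lemma mul_effHorizon_le (hs : G.EnoughSamples cα cb δ ε K) :
    sampleConst cα cb * G.effHorizon ≤ 8 * K := by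
  have hCL := mul_nonneg (sampleConst_pos cb hs.cα_pos).le (zero_le_one.trans hs.one_le_L)
  have := mul_le_mul_of_nonneg_left hs.eighth_le_logFactor_cube hCL
  linarith [hs.mul_effHorizon_mul_cube_le]

lemma mul_H_mul_effHorizon_le (hs : G.EnoughSamples cα cb δ ε K) :
    sampleConst cα cb * (G.H * G.effHorizon) ≤ 8 * (K * ε) := by
  have hC := sampleConst_pos cb hs.cα_pos
  have hL := zero_le_one.trans hs.one_le_L
  have hε := hs.ε_pos
  have hCHL : sampleConst cα cb * (G.H : ℝ) ^ 2 * G.effHorizon ≤ 8 * (K * ε ^ 2) := by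
    have := mul_le_mul_of_nonneg_left hs.eighth_le_logFactor_cube
      (show 0 ≤ sampleConst cα cb * (G.H : ℝ) ^ 2 * G.effHorizon by positivity)
    linarith [hs.le_mul_sq]
  refine le_of_sq_le_sq ?_ (by positivity)
  calc (sampleConst cα cb * (G.H * G.effHorizon)) ^ 2
      = sampleConst cα cb * (G.H : ℝ) ^ 2 * G.effHorizon * (sampleConst cα cb * G.effHorizon) := by
        ring
    _ ≤ 8 * (K * ε ^ 2) * (8 * K) :=
        mul_le_mul hCHL hs.mul_effHorizon_le (by positivity) (by positivity)
    _ = (8 * (K * ε)) ^ 2 := by ring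

lemma errScale_mul_sq_mul_le (hs : G.EnoughSamples cα cb δ ε K) :
    sampleConst cα cb * (G.errScale δ K * G.effHorizon * G.H) ^ 2 ≤ ε ^ 2 := by
  have hK := hs.K_pos
  have hL := one_pos.trans_le hs.one_le_L
  have hlog := hs.half_le_logFactor
  have hsq : G.errScale δ K ^ 2 = logFactor S A δ K ^ 3 / (K * G.effHorizon) :=
    Real.sq_sqrt (by positivity)
  calc sampleConst cα cb * (G.errScale δ K * G.effHorizon * G.H) ^ 2
      = sampleConst cα cb * (G.H : ℝ) ^ 2 * G.effHorizon * logFactor S A δ K ^ 3 / K := by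
        rw [mul_pow, mul_pow, hsq]
        field_simp
    _ ≤ ε ^ 2 := by
        rw [div_le_iff₀ hK, mul_comm _ (K : ℝ)]
        exact hs.le_mul_sq

lemma potConst_mul_errScale_le (hs : G.EnoughSamples cα cb δ ε K) :
    216 * potConst cα cb * (G.errScale δ K * G.effHorizon * G.H) ≤ ε := by
  refine le_of_sq_le_sq (le_trans ?_ hs.errScale_mul_sq_mul_le) hs.ε_pos.le
  rw [mul_pow]
  exact mul_le_mul_of_nonneg_right (le_sampleConst cb hs.cα_pos).2.2.1 (sq_nonneg _)

lemma one_le_mul_log (hs : G.EnoughSamples cα cb δ ε K) : 1 ≤ cα * Real.log K := by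
  have hexp : Real.exp (1 / cα) ≤ K := by
    have hC := sampleConst_pos cb hs.cα_pos
    have := mul_le_mul_of_nonneg_left hs.eighth_le_logFactor_cube hC.le
    linarith [(le_sampleConst cb hs.cα_pos).2.1, hs.mul_cube_le]
  have hlog := Real.log_le_log (Real.exp_pos _) hexp
  rwa [Real.log_exp, div_le_iff₀' hs.cα_pos] at hlog

lemma mul_log_mul_burnInRatio_le (hs : G.EnoughSamples cα cb δ ε K) :
    cα * Real.log K * burnInRatio cα ≤ K / 2 := by
  have hburn := mul_pos hs.cα_pos (burnInRatio_pos cα)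
  have hhalf := hs.half_le_logFactor
  have hlog : Real.log K / 4 ≤ logFactor S A δ K ^ 3 := by
    calc Real.log K / 4 ≤ logFactor S A δ K * (1 / 2) ^ 2 := by
          linarith [hs.log_two_add_log_K_le, Real.log_two_gt_d9]
      _ ≤ logFactor S A δ K * logFactor S A δ K ^ 2 := by gcongr
      _ = logFactor S A δ K ^ 3 := by ring
  have hcube : 8 * (cα * burnInRatio cα) * logFactor S A δ K ^ 3 ≤ K := by
    refine le_trans ?_ hs.mul_cube_le
    gcongr
    exact (le_sampleConst cb hs.cα_pos).1
  linarith [mul_le_mul_of_nonneg_left hlog (mul_nonneg (by norm_num : (0 : ℝ) ≤ 8) hburn.le)]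

lemma regime (hs : G.EnoughSamples cα cb δ ε K) : G.Regime cα cb δ K where
  cα_pos := hs.cα_pos
  one_le_K := hs.one_le_K
  one_le_L := hs.one_le_L
  one_le_step := hs.one_le_mul_log
  step_le := hs.mul_log_mul_burnInRatio_le
  log_K_le := by linarith [hs.log_two_add_log_K_le, Real.log_two_gt_d9]
  log_A_le := hs.log_A_le
  half_le := hs.half_le_logFactor
  le_cb := hs.bonusThreshold_le
  small := by
    have hpot : 216 * potConst cα cb * (G.errScale δ K * G.effHorizon) ≤ 1 := by
      refine le_of_mul_le_mul_right ?_ hs.H_pos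
      linarith [hs.potConst_mul_errScale_le, hs.ε_le]
    linarith

/-! ### The failure probability -/

lemma sum_failures_le (hs : G.EnoughSamples cα cb δ ε K) :
    (∑ i, ∑ _s : Fin S, ((A i : ℝ≥0∞) + 2))
        * ENNReal.ofReal (Real.exp (-(8 * logFactor S A δ K)))
      ≤ ENNReal.ofReal (3 * δ / K) := by
  have hS : (0 : ℝ) < S := by exact_mod_cast NeZero.pos S
  have hA : ∀ i, (1 : ℝ) ≤ A i := fun i => by exact_mod_cast NeZero.one_le
  have hsum : (0 : ℝ) < ∑ j, (A j : ℝ) :=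
    sum_pos (fun j _ => zero_lt_one.trans_le (hA j)) univ_nonempty
  have hcount : (∑ i, ∑ _s : Fin S, ((A i : ℝ≥0∞) + 2))
      ≤ ENNReal.ofReal (3 * (S * ∑ j, (A j : ℝ))) := by
    calc (∑ i, ∑ _s : Fin S, ((A i : ℝ≥0∞) + 2))
        ≤ ∑ i, ∑ _s : Fin S, ((3 * A i : ℕ) : ℝ≥0∞) := by
          gcongr with i
          exact_mod_cast (by linarith [NeZero.one_le (n := A i)] : A i + 2 ≤ 3 * A i)
      _ = ((3 * (S * ∑ j, A j) : ℕ) : ℝ≥0∞) := by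
          simp only [sum_const, card_univ, Fintype.card_fin, nsmul_eq_mul, mul_sum]
          push_cast
          exact sum_congr rfl fun i _ => by ring
      _ = ENNReal.ofReal (3 * (S * ∑ j, (A j : ℝ))) := by
          rw [← ENNReal.ofReal_natCast]
          push_cast
          rfl
  have hexp : Real.exp (-(8 * logFactor S A δ K)) ≤ δ / (K * S * ∑ j, (A j : ℝ)) := by
    rw [← hs.exp_neg_logFactor]
    exact Real.exp_le_exp.2 (by linarith [hs.half_le_logFactor])
  have hK := hs.K_pos
  calc _ ≤ ENNReal.ofReal (3 * (S * ∑ j, (A j : ℝ)))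
        * ENNReal.ofReal (δ / (K * S * ∑ j, (A j : ℝ))) := by gcongr
    _ = ENNReal.ofReal (3 * δ / K) := by
        rw [← ENNReal.ofReal_mul (by positivity)]
        congr 1
        field_simp

/-- Each bad step costs `O(L)`, so that the accuracy `ε` tolerates `ε / (40 L)` of them. -/
lemma pexp_mul_badCount_le (hs : G.EnoughSamples cα cb δ ε K) (hG : G.IsZeroSum) :
    pexp (G.run cα cb δ K G.H) (fun o => ENNReal.ofReal (ε / (40 * G.effHorizon))⁻¹
        * G.badCount (G.potCoeff cα cb δ K) (G.stepError cα cb δ K) G.H o)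
      ≤ ENNReal.ofReal δ := by
  have hδ := hs.δ_pos
  have hε := hs.ε_pos
  have hK := hs.K_pos
  have hL := one_pos.trans_le hs.one_le_L
  have hbad := (hs.regime.pexp_badCount_le hG hs.R_nonneg hs.R_lt_one le_rfl).trans
    (mul_le_mul_right hs.sum_failures_le _)
  have hHL : 960 * (G.H * G.effHorizon) ≤ 8 * (K * ε) := by
    refine le_trans ?_ hs.mul_H_mul_effHorizon_le
    gcongr
    exact (le_sampleConst cb hs.cα_pos).2.2.2
  rw [pexp_mul_left]
  refine (mul_le_mul_right hbad _).trans ?_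
  rw [← ENNReal.ofReal_natCast, ← ENNReal.ofReal_mul (by positivity),
    ← ENNReal.ofReal_mul (by positivity)]
  refine ENNReal.ofReal_le_ofReal ?_
  calc (ε / (40 * G.effHorizon))⁻¹ * (G.H * (3 * δ / K))
      = 960 * (G.H * G.effHorizon) / (8 * (K * ε)) * δ := by
        field_simp
        ring
    _ ≤ 1 * δ := by
        gcongr
        exact div_le_one_of_le₀ hHL (by positivity)
    _ = δ := one_mul _

lemma isRobustNE_of_badCount_lt (hs : G.EnoughSamples cα cb δ ε K) (hG : G.IsZeroSum)
    {o : RunState S A}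
    (ho : G.badCount (G.potCoeff cα cb δ K) (G.stepError cα cb δ K) G.H o
      < ENNReal.ofReal (ε / (40 * G.effHorizon))) : G.IsRobustNE ε o.2 := by
  obtain ⟨N, hN, hI⟩ := Game.exists_runInvariant_of_badCount_lt ho
  refine hI.isRobustNE hG hs.R_nonneg hs.R_lt_one.le hs.regime.potCoeff_nonneg ?_
  rw [lt_div_iff₀ (by linarith [hs.one_le_L])] at hN
  have herr : 4 * (G.H * G.stepError cα cb δ K)
      = 108 * potConst cα cb * (G.errScale δ K * G.effHorizon * G.H) := by
    rw [Game.stepError]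
    ring
  linarith [hs.potConst_mul_errScale_le]

theorem one_sub_le_toOuterMeasure_output (hs : G.EnoughSamples cα cb δ ε K) (hG : G.IsZeroSum) :
    ENNReal.ofReal (1 - δ) ≤ (G.output cα cb δ K).toOuterMeasure {π | G.IsRobustNE ε π} := by
  rw [ENNReal.ofReal_sub _ hs.δ_pos.le, ENNReal.ofReal_one, Game.output,
    PMF.toOuterMeasure_map_apply]
  refine one_sub_le_toOuterMeasure_of_pexp_le _ _ _ (hs.pexp_mul_badCount_le hG) fun o ho => ?_
  have htol : 0 < ε / (40 * G.effHorizon) :=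
    div_pos hs.ε_pos (by linarith [hs.one_le_L])
  have hbad := not_lt.1 fun hlt => ho (hs.isRobustNE_of_badCount_lt hG hlt)
  calc (1 : ℝ≥0∞)
      = ENNReal.ofReal (ε / (40 * G.effHorizon))⁻¹ * ENNReal.ofReal (ε / (40 * G.effHorizon)) := by
        rw [← ENNReal.ofReal_mul (inv_pos.2 htol).le, inv_mul_cancel₀ htol.ne', ENNReal.ofReal_one]
    _ ≤ _ := by gcongr

end Game.EnoughSamples

end sampleSize

end RobustMG

end

open RobustMG in
theorem corollary1 :
    ∀ cα : ℝ, 0 < cα → ∃ cb₀ : ℝ, 0 < cb₀ ∧ ∀ cb : ℝ, cb₀ ≤ cb → ∃ C : ℝ, 0 < C ∧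
      ∀ (S : ℕ) [NeZero S] (A : Fin 2 → ℕ) [∀ i, NeZero (A i)] (G : RobustMG.Game 2 S A),
        G.IsZeroSum → 0 ≤ G.R → G.R < 1 →
        ∀ (ε δ : ℝ) (K : ℕ), 0 < ε → ε ≤ G.H → 0 < δ → δ < 1 → 0 < K →
          C * (G.H : ℝ) ^ 3 * S * (A 0 + A 1) / ε ^ 2 * G.effHorizon *
              Real.log (K * S * (A 0 + A 1) / δ) ^ 3
            ≤ (K : ℝ) * G.H * S * (A 0 + A 1) →
          ENNReal.ofReal (1 - δ) ≤
            (G.output cα cb δ K).toOuterMeasure {π | G.IsRobustNE ε π} := by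
  intro cα hα
  refine ⟨bonusThreshold cα, bonusThreshold_pos hα, fun cb hcb =>
    ⟨sampleConst cα cb, sampleConst_pos cb hα, ?_⟩⟩
  intro S _ A _ G hG hR0 hR1 ε δ K hε hεH hδ hδ1 hK hsize
  have hlog : Real.log (K * S * (A 0 + A 1) / δ) = logFactor S A δ K := by
    rw [logFactor, Fin.sum_univ_two]
  have hA : (0 : ℝ) < A 0 + A 1 := by exact_mod_cast Nat.add_pos_left (NeZero.pos (A 0)) (A 1)
  rw [hlog] at hsize
  have hs : G.EnoughSamples cα cb δ ε K :=
    ⟨hα, hcb, hR0, hR1, hε, hεH, hδ, hδ1, hK,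
      mul_sq_le_of_sampleSize hε (hε.trans_le hεH) (by exact_mod_cast NeZero.pos S) hA hsize⟩
  exact hs.one_sub_le_toOuterMeasure_output hG
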